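/- **Syntax.** Contextual LF has normal terms $M,N ::= R \mid \lambda x.M$, neutral terms $R ::= x \mid \mathbf c \mid R\,N \mid u[\sigma]$, substitutions $\sigma ::= \cdot \mid \mathsf{wk}_\psi \mid \sigma,M$, atomic types $P,Q ::= \mathbf a\,\vec M$, types $A,B ::= P \mid A\to B \mid \Pi\hat x{:}A.\,B$ (in $A\to B$ the type $B$ does not depend on the argument), and contexts $\Psi,\Phi ::= \cdot \mid \psi \mid \Psi,x{:}A \mid \Psi,\hat x{:}A$, where $x{:}A$ is a proof-relevant assumption and $\hat x{:}A$ a parameter. Schemas are finite sums $G$ of elements $\exists\overrightarrow{(x{:}A_o)}.A$; meta-types are $U ::= (\Psi\vdash P)\mid G$, meta-terms $C ::= (\hat\Psi\vdash R)\mid\Psi$, meta-contexts $\Delta ::= \cdot\mid\Delta,X{:}U$; computation types are $\tau ::= \lceil\Psi\vdash P\rceil \mid \tau_1\to\tau_2\mid\Pi^{\Box}X{:}U.\,\tau$; $\Gamma$ is a finite list of assumptions $y{:}\tau$, whose order is irrelevant. $\Sigma$ is a fixed well-formed signature of type families and constants $\mathbf c{:}A$. Terms are canonical ($\beta$-normal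 and $\eta$-long); $\eta_A(R)$ is the $\eta$-long form of a neutral term $R$ of type $A$; $[\cdot]$ is hereditary substitution, $[\![C/X]\!]$ is meta-substitution. $\Delta;\Psi\vdash M\Leftarrow A$ is LF typing of canonical terms (in which parameters and assumptions are treated alike), and $\Delta\Vdash C\Leftarrow U$ is meta-term typing: $(\hat\Psi\vdash R)\Leftarrow(\Psi\vdash P)$ if $R$ has type $P$ in $\Delta;\Psi$, and $\Psi\Leftarrow G$ if $\Psi$ is empty or starts with some $\psi{:}G\in\Delta$, and all its declarations are instances of elements of $G$. Below, $h{:}A\in\Sigma,\Psi$ means that $h$ is a proof-relevant assumption $x{:}A$ of $\Psi$ (not a parameter) or a constant $\mathbf c{:}A$ of $\Sigma$. **Sequent calculus for LF**, $\Delta;\Psi\Longrightarrow M:A$ and $\Delta;\Psi\Longrightarrow\sigma:\Phi$: - (init) $\Delta;\Psi\Longrightarrow\eta_A(h):A$ if $h{:}A\in\Sigma,\Psi$. - ($\Pi R$, $\to R$) $\Delta;\Psi\Longrightarrow\lambda x.M:\Pi\hat x{:}A.B$ from $\Delta;\Psi,\hat x{:}A\Longrightarrow M:B$, and $\Delta;\Psi\Longrightarrow\lambda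 x.M:A\to B$ from $\Delta;\Psi,x{:}A\Longrightarrow M:B$. - ($\Pi L$) For $h{:}\Pi\hat x{:}A.B\in\Sigma,\Psi$: from $\Delta;\Psi\vdash M\Leftarrow A$ and $\Delta;\Psi,x_2{:}[M/\hat x]B\Longrightarrow N:A'$ infer $\Delta;\Psi\Longrightarrow[h\,M/x_2]N:A'$. - ($\to L$) For $h{:}A\to B\in\Sigma,\Psi$: from $\Delta;\Psi\Longrightarrow M:A$ and $\Delta;\Psi,x_2{:}B\Longrightarrow N:A'$ infer $\Delta;\Psi\Longrightarrow[h\,M/x_2]N:A'$. - (reflect) For $u{:}(\Phi\vdash P)\in\Delta$: from $\Delta;\Psi\Longrightarrow\sigma:\Phi$ and $\Delta;\Psi,x{:}[\sigma]P\Longrightarrow M:A$ infer $\Delta;\Psi\Longrightarrow[u[\sigma]/x]M:A$. - (substitutions) $\Delta;\Psi\Longrightarrow\cdot:\cdot$; $\ \Delta;\psi,\Psi\Longrightarrow\mathsf{wk}_\psi:\psi$; from $\Delta;\Psi\Longrightarrow\sigma:\Phi$ infer $\Delta;\Psi\Longrightarrow(\sigma,N):(\Phi,x{:}B)$ if $\Delta;\Psi\Longrightarrow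 N:[\sigma]B$, and $\Delta;\Psi\Longrightarrow(\sigma,M):(\Phi,\hat x{:}B)$ if $\Delta;\Psi\vdash M\Leftarrow[\sigma]B$. (In the left rules and reflect, $A'$, respectively $A$, is a type over $\Psi$.) **Sequent calculus for computations**, $\Delta;\Gamma\Longrightarrow\tau$ (proof terms omitted): - (init) $\tau\in\Gamma$. ($\to R$) $\Gamma\Longrightarrow\tau_1\to\tau_2$ from $\Gamma,y{:}\tau_1\Longrightarrow\tau_2$. ($\Pi^\Box R$) $\Delta;\Gamma\Longrightarrow\Pi^\Box X{:}U.\tau$ from $\Delta,X{:}U;\Gamma\Longrightarrow\tau$. - ($\to L$) For $\tau_1\to\tau_2\in\Gamma$: from $\Delta;\Gamma\Longrightarrow\tau_1$ and $\Delta;\Gamma,y_2{:}\tau_2\Longrightarrow\tau$ infer $\Delta;\Gamma\Longrightarrow\tau$. - ($\Pi^\Box L$) For $\Pi^\Box X{:}U.\tau'\in\Gamma$: from $\Delta\Vdash C\Leftarrow U$ and $\Delta;\Gamma,y_2{:}[\![C/X]\!]\tau'\Longrightarrow\tau$ infer $\Delta;\Gamma\Longrightarrow\tau$. - ($\Box R$)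 $\Delta;\Gamma\Longrightarrow\lceil\Psi\vdash P\rceil$ from $\Delta;\Psi\Longrightarrow R:P$. ($\Box L$) For $\lceil\Psi\vdash P\rceil\in\Gamma$: from $\Delta,X{:}(\Psi\vdash P);\Gamma\Longrightarrow\tau$ infer $\Delta;\Gamma\Longrightarrow\tau$. **Focusing calculus for LF**: uniform proofs $\Delta;\Psi\stackrel{u}{\Longrightarrow}M:A$, uniform substitution proofs $\Delta;\Psi\stackrel{u}{\Longrightarrow}\sigma:\Phi$, and focused proofs $\Delta;\Psi>R:A\rightrightarrows M:P$ ($M$ proves $P$ with focus on the neutral term $R$ of type $A$). - $\Pi R$, $\to R$ and the four substitution rules are as in the sequent calculus, with $\stackrel{u}{\Longrightarrow}$ for $\Longrightarrow$. - (transition on $\Delta$) For $X{:}(\Phi\vdash Q)\in\Delta$: from $\Delta;\Psi\stackrel{u}{\Longrightarrow}\sigma:\Phi$ and $[\sigma]Q=P$ infer $\Delta;\Psi\stackrel{u}{\Longrightarrow}X[\sigma]:P$; its premises are also written $\Delta>X{:}(\Phi\vdash Q);\Psi\rightrightarrows X[\sigma]:P$. - (transition on $\Sigma,\Psi$) For $h{:}A\in\Sigma,\Psi$: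 from $\Delta;\Psi>h:A\rightrightarrows M:P$ infer $\Delta;\Psi\stackrel{u}{\Longrightarrow}M:P$. - (focus) $\Delta;\Psi>R:P\rightrightarrows R:P$. From $\Delta;\Psi\stackrel{u}{\Longrightarrow}N:A$ and $\Delta;\Psi>R\,N:B\rightrightarrows M:P$ infer $\Delta;\Psi>R:A\to B\rightrightarrows M:P$. From $\Delta;\Psi\vdash N\Leftarrow A$ and $\Delta;\Psi>R\,N:[N/\hat x]B\rightrightarrows M:P$ infer $\Delta;\Psi>R:\Pi\hat x{:}A.B\rightrightarrows M:P$. **Focusing calculus for computations**: uniform right $\Delta;\Gamma\stackrel{R}{\Longrightarrow}\tau$, uniform left $\Delta;\Gamma\gg\Gamma'\stackrel{L}{\Longrightarrow}\lceil\Psi\vdash P\rceil$, left focus $\Delta;\Gamma>y{:}\tau\Rightarrow\lceil\Psi\vdash P\rceil$. - (right) $\to R$ and $\Pi^\Box R$ as above with $\stackrel{R}{\Longrightarrow}$; and $\Delta;\Gamma\stackrel{R}{\Longrightarrow}\lceil\Psi\vdash P\rceil$ from $\Delta;\cdot\gg\Gamma\stackrel{L}{\Longrightarrow}\lceil\Psi\vdash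 P\rceil$. - (left) $\Delta;\Gamma\gg\Gamma',y{:}\lceil\Phi\vdash Q\rceil\stackrel{L}{\Longrightarrow}\lceil\Psi\vdash P\rceil$ from $\Delta,X{:}(\Phi\vdash Q);\Gamma\gg\Gamma'\stackrel{L}{\Longrightarrow}\lceil\Psi\vdash P\rceil$; if $\tau$ is not of box type, $\Delta;\Gamma\gg\Gamma',y{:}\tau\stackrel{L}{\Longrightarrow}\lceil\Psi\vdash P\rceil$ from $\Delta;\Gamma,y{:}\tau\gg\Gamma'\stackrel{L}{\Longrightarrow}\lceil\Psi\vdash P\rceil$. Further, $\Delta;\Gamma\gg\cdot\stackrel{L}{\Longrightarrow}\lceil\Psi\vdash P\rceil$ from $\Delta;\Psi\stackrel{u}{\Longrightarrow}M:P$ for some $M$ (level), or from $\Delta;\Gamma>y{:}\tau\Rightarrow\lceil\Psi\vdash P\rceil$ for some $y{:}\tau\in\Gamma$. - (focus) $\Delta;\Gamma>y{:}\Pi^\Box X{:}U.\tau\Rightarrow\lceil\Psi\vdash P\rceil$ from $\Delta\Vdash C\Leftarrow U$ and $\Delta;\Gamma>y'{:}[\![C/X]\!]\tau\Rightarrow\lceil\Psi\vdash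 P\rceil$; $\ \Delta;\Gamma>y{:}\tau_1\to\tau_2\Rightarrow\lceil\Psi\vdash P\rceil$ from $\Delta;\Gamma\stackrel{R}{\Longrightarrow}\tau_1$ and $\Delta;\Gamma>y'{:}\tau_2\Rightarrow\lceil\Psi\vdash P\rceil$; $\ \Delta;\Gamma>y'{:}\lceil\Phi\vdash Q\rceil\Rightarrow\lceil\Psi\vdash P\rceil$ from $\Delta;\cdot\gg\Gamma,y'{:}\lceil\Phi\vdash Q\rceil\stackrel{L}{\Longrightarrow}\lceil\Psi\vdash P\rceil$. For $\Delta$ and $\Gamma$ let $\Delta^+$ be $\Delta$ extended by a declaration $X{:}(\Phi\vdash Q)$ for every assumption $\lceil\Phi\vdash Q\rceil$ of $\Gamma$, and let $\Gamma^-$ be $\Gamma$ without its assumptions of box type. **Theorem (Completeness).** Let $\Sigma$ be a well-formed signature and $\Delta$ a well-formed meta-context, and let all contexts and types below be well-formed. a) If $\Delta;\Psi\Longrightarrow M:A$ then $\Delta;\Psi\stackrel{u}{\Longrightarrow}M:A$. b) If $\Delta;\Psi\Longrightarrow\sigma:\Phi$ then $\Delta;\Psi\stackrel{u}{\Longrightarrow}\sigma:\Phi$.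 c) If $\Delta;\Psi\Longrightarrow M:P$ then $\Delta;\Psi>h:A\rightrightarrows M:P$ for some $h{:}A\in\Sigma,\Psi$, or $\Delta>X{:}(\Phi\vdash Q);\Psi\rightrightarrows M:P$ for some $X{:}(\Phi\vdash Q)\in\Delta$. d) If $\Delta;\Gamma\Longrightarrow\tau$ then $\Delta^+;\Gamma^-\stackrel{R}{\Longrightarrow}\tau$. e) If $\Delta;\Gamma\Longrightarrow\lceil\Psi\vdash P\rceil$ then $\Delta^+;\Gamma^-\gg\cdot\stackrel{L}{\Longrightarrow}\lceil\Psi\vdash P\rceil$. f) If $\Delta;\Gamma\Longrightarrow\lceil\Psi\vdash P\rceil$ then $\Delta^+;\Psi\stackrel{u}{\Longrightarrow}M:P$ for some $M$, or $\Delta^+;\Gamma^->y{:}\tau\Rightarrow\lceil\Psi\vdash P\rceil$ for some $y{:}\tau\in\Gamma^-$. -/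

import Mathlib

/-!
# Contextual LF and the computation logic of Beluga

Variables are de Bruijn indices. LF variables (bound by LF contexts and by `λ`, `Π`) and contextual
variables (bound by meta-contexts and by `Π□`) are two separate families of indices. In every
context the index `0` is the most recent declaration.
-/

namespace Beluga

/-! ## Terms and substitutions -/

mutual
/-- Normal terms `M ::= R | λx. M`. -/
inductive Tm : Type
  | neu : Ne → Tm
  | lam : Tm → Tm
/-- Neutral terms `R ::= x | c | R N | u[σ]`. -/
inductive Ne : Type
  | var : ℕ → Ne
  | const : ℕ → Ne
  | app : Ne → Tm → Ne
  | mvar : ℕ → Sb → Ne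
/-- Simultaneous substitutions `σ ::= · | wk_ψ | σ, M`. -/
inductive Sb : Type
  | empty : Sb
  | wk : ℕ → Sb
  | cons : Sb → Tm → Sb
end

/-- A renaming extended under one binder. -/
def liftRen (ρ : ℕ → ℕ) : ℕ → ℕ
  | 0 => 0
  | n + 1 => ρ n + 1

/-! Renaming of LF variables. The substitution `wk_ψ` mentions no LF variable. -/

mutual
def Tm.ren (ρ : ℕ → ℕ) : Tm → Tm
  | .neu R => .neu (R.ren ρ)
  | .lam M => .lam (M.ren (liftRen ρ))
def Ne.ren (ρ : ℕ → ℕ) : Ne → Ne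
  | .var i => .var (ρ i)
  | .const c => .const c
  | .app R N => .app (R.ren ρ) (N.ren ρ)
  | .mvar u σ => .mvar u (σ.ren ρ)
def Sb.ren (ρ : ℕ → ℕ) : Sb → Sb
  | .empty => .empty
  | .wk ψ => .wk ψ
  | .cons σ M => .cons (σ.ren ρ) (M.ren ρ)
end

/-! Renaming of contextual variables. -/

mutual
def Tm.mren (ρ : ℕ → ℕ) : Tm → Tm
  | .neu R => .neu (R.mren ρ)
  | .lam M => .lam (M.mren ρ)
def Ne.mren (ρ : ℕ → ℕ) : Ne → Ne
  | .var i => .var i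
  | .const c => .const c
  | .app R N => .app (R.mren ρ) (N.mren ρ)
  | .mvar u σ => .mvar (ρ u) (σ.mren ρ)
def Sb.mren (ρ : ℕ → ℕ) : Sb → Sb
  | .empty => .empty
  | .wk ψ => .wk (ρ ψ)
  | .cons σ M => .cons (σ.mren ρ) (M.mren ρ)
end

/-! ## Types and contexts of LF -/

/-- Atomic types `P ::= a M₁ … Mₙ`; the vector of arguments is the substitution
`·, M₁, …, Mₙ`. -/
structure Atom : Type where
  fam : ℕ
  args : Sb

/-- Types `A ::= P | A → B | Πx̂:A. B`. In `arr A B` the type `B` is not under a binder, so it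
cannot depend on the argument; in `pi A B` it is. -/
inductive Ty : Type
  | atom : Atom → Ty
  | arr : Ty → Ty → Ty
  | pi : Ty → Ty → Ty

/-- A declaration of an LF context is either proof-relevant, `x : A` (`hyp`), or a parameter,
`x̂ : A` (`param`). -/
inductive Role : Type
  | hyp
  | param

/-- LF contexts `Ψ ::= · | ψ | Ψ, x:A | Ψ, x̂:A`. -/
inductive Ctx : Type
  | nil : Ctx
  | cvar : ℕ → Ctx
  | snoc : Ctx → Role → Ty → Ctx

def Atom.ren (ρ : ℕ → ℕ) (P : Atom) : Atom := ⟨P.fam, P.args.ren ρ⟩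

def Atom.mren (ρ : ℕ → ℕ) (P : Atom) : Atom := ⟨P.fam, P.args.mren ρ⟩

def Ty.ren (ρ : ℕ → ℕ) : Ty → Ty
  | .atom P => .atom (P.ren ρ)
  | .arr A B => .arr (A.ren ρ) (B.ren ρ)
  | .pi A B => .pi (A.ren ρ) (B.ren (liftRen ρ))

def Ty.mren (ρ : ℕ → ℕ) : Ty → Ty
  | .atom P => .atom (P.mren ρ)
  | .arr A B => .arr (A.mren ρ) (B.mren ρ)
  | .pi A B => .pi (A.mren ρ) (B.mren ρ)

/-- Weakening of a type by one LF declaration. -/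
def Ty.shift (A : Ty) : Ty := A.ren Nat.succ

def Ctx.mren (ρ : ℕ → ℕ) : Ctx → Ctx
  | .nil => .nil
  | .cvar ψ => .cvar (ρ ψ)
  | .snoc Ψ r A => .snoc (Ψ.mren ρ) r (A.mren ρ)

/-- The number of variable declarations. -/
def Ctx.length : Ctx → ℕ
  | .nil => 0
  | .cvar _ => 0
  | .snoc Ψ _ _ => Ψ.length + 1

/-- The context variable at the front of a context, if there is one. -/
def Ctx.base : Ctx → Option ℕ
  | .nil => none
  | .cvar ψ => some ψ
  | .snoc Ψ _ _ => Ψ.base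

/-- `Ctx.Lookup Ψ x r A`: the variable `x` is declared in `Ψ`, in role `r` and with type `A`. -/
inductive Ctx.Lookup : Ctx → ℕ → Role → Ty → Prop
  | here {Ψ : Ctx} {r : Role} {A : Ty} : Ctx.Lookup (.snoc Ψ r A) 0 r A.shift
  | there {Ψ : Ctx} {r r₁ : Role} {A A₁ : Ty} {x : ℕ} :
      Ctx.Lookup Ψ x r A → Ctx.Lookup (.snoc Ψ r₁ A₁) (x + 1) r A.shift

/-- The canonical (η-long) form at type `A` of a neutral term of type `A`; it depends only on the
arrow structure of `A`. -/
def eta : Ty → Ne → Tm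
  | .atom _, R => .neu R
  | .arr A B, R => .lam (eta B (.app (R.ren Nat.succ) (eta A (.var 0))))
  | .pi A B, R => .lam (eta B (.app (R.ren Nat.succ) (eta A (.var 0))))

/-- The identity substitution of a context, in canonical form. -/
def idSb : Ctx → Sb
  | .nil => .empty
  | .cvar ψ => .wk ψ
  | .snoc Ψ _ A => .cons ((idSb Ψ).ren Nat.succ) (eta A (.var 0))

/-! ## Hereditary substitution

It is given by its graph: `Tm.HSub e M M₁` says that replacing every variable `i` of `M` by `e i`
and contracting the β-redexes that this creates ends, with the normal term `M₁`. On well-typed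
objects it always ends. A well-typed substitution whose domain starts with `ψ` starts with `wk_ψ`,
hence `wk_ψ` is mapped to itself. -/

/-- What a substitution does to the variables of its domain. An index out of range does not occur
in a well-formed object; it is sent to a dummy closed term. -/
def Sb.env : Sb → ℕ → Tm
  | .empty, _ => .neu (.const 0)
  | .wk _, _ => .neu (.const 0)
  | .cons _ M, 0 => M
  | .cons σ _, i + 1 => σ.env i

/-- The single substitution `[M/x]` for the most recent variable `x`. -/
def inst (M : Tm) : ℕ → Tm
  | 0 => M
  | i + 1 => .neu (.var i)

/-- Extension under one binder. -/
def liftEnv (e : ℕ → Tm) : ℕ → Tm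
  | 0 => .neu (.var 0)
  | i + 1 => (e i).ren Nat.succ

mutual
inductive Tm.HSub : (ℕ → Tm) → Tm → Tm → Prop
  | neu {e : ℕ → Tm} {R : Ne} {M : Tm} : Ne.HSub e R M → Tm.HSub e (.neu R) M
  | lam {e : ℕ → Tm} {M M₁ : Tm} : Tm.HSub (liftEnv e) M M₁ → Tm.HSub e (.lam M) (.lam M₁)
inductive Ne.HSub : (ℕ → Tm) → Ne → Tm → Prop
  | var {e : ℕ → Tm} {i : ℕ} : Ne.HSub e (.var i) (e i)
  | const {e : ℕ → Tm} {c : ℕ} : Ne.HSub e (.const c) (.neu (.const c))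
  | app_neu {e : ℕ → Tm} {R R₁ : Ne} {N N₁ : Tm} :
      Ne.HSub e R (.neu R₁) → Tm.HSub e N N₁ → Ne.HSub e (.app R N) (.neu (.app R₁ N₁))
  | app_lam {e : ℕ → Tm} {R : Ne} {N N₁ M M₁ : Tm} :
      Ne.HSub e R (.lam M) → Tm.HSub e N N₁ → Tm.HSub (inst N₁) M M₁ →
      Ne.HSub e (.app R N) M₁
  | mvar {e : ℕ → Tm} {u : ℕ} {σ σ₁ : Sb} :
      Sb.HSub e σ σ₁ → Ne.HSub e (.mvar u σ) (.neu (.mvar u σ₁))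
inductive Sb.HSub : (ℕ → Tm) → Sb → Sb → Prop
  | empty {e : ℕ → Tm} : Sb.HSub e .empty .empty
  | wk {e : ℕ → Tm} {ψ : ℕ} : Sb.HSub e (.wk ψ) (.wk ψ)
  | cons {e : ℕ → Tm} {σ σ₁ : Sb} {M M₁ : Tm} :
      Sb.HSub e σ σ₁ → Tm.HSub e M M₁ → Sb.HSub e (.cons σ M) (.cons σ₁ M₁)
end

inductive Atom.HSub (e : ℕ → Tm) : Atom → Atom → Prop
  | mk {a : ℕ} {σ σ₁ : Sb} : Sb.HSub e σ σ₁ → Atom.HSub e ⟨a, σ⟩ ⟨a, σ₁⟩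

inductive Ty.HSub : (ℕ → Tm) → Ty → Ty → Prop
  | atom {e : ℕ → Tm} {P P₁ : Atom} : Atom.HSub e P P₁ → Ty.HSub e (.atom P) (.atom P₁)
  | arr {e : ℕ → Tm} {A A₁ B B₁ : Ty} :
      Ty.HSub e A A₁ → Ty.HSub e B B₁ → Ty.HSub e (.arr A B) (.arr A₁ B₁)
  | pi {e : ℕ → Tm} {A A₁ B B₁ : Ty} :
      Ty.HSub e A A₁ → Ty.HSub (liftEnv e) B B₁ → Ty.HSub e (.pi A B) (.pi A₁ B₁)

/-! ## Meta-types, meta-terms, meta-contexts, computation types -/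

/-- Context schemas `G ::= ∃(x:A₀). A | G + ∃(x:A₀). A`; the block `x:A₀` is written as an LF
context (without a context variable). -/
inductive Schema : Type
  | elem : Ctx → Ty → Schema
  | plus : Schema → Ctx → Ty → Schema

/-- `G.Mem Φ A`: `∃Φ. A` is one of the elements of `G`. -/
inductive Schema.Mem : Schema → Ctx → Ty → Prop
  | elem {Φ : Ctx} {A : Ty} : Schema.Mem (.elem Φ A) Φ A
  | last {G : Schema} {Φ : Ctx} {A : Ty} : Schema.Mem (.plus G Φ A) Φ A
  | prev {G : Schema} {Φ Φ₁ : Ctx} {A A₁ : Ty} :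
      Schema.Mem G Φ A → Schema.Mem (.plus G Φ₁ A₁) Φ A

/-- Meta-types `U ::= (Ψ ⊢ P) | G`. -/
inductive MTy : Type
  | ctxt : Ctx → Atom → MTy
  | schema : Schema → MTy

/-- Meta-terms `C ::= (Ψ̂ ⊢ R) | Ψ`; the names listed in `Ψ̂` are the de Bruijn indices of `R`. -/
inductive MTm : Type
  | tm : Ne → MTm
  | ctx : Ctx → MTm

/-- Meta-contexts `Δ`, most recent declaration first; each declaration lives in the rest of the
list. -/
abbrev MCtx : Type := List MTy

/-- Computation types `τ ::= ⌈Ψ ⊢ P⌉ | τ₁ → τ₂ | Π□X:U. τ`. -/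
inductive CTy : Type
  | box : Ctx → Atom → CTy
  | arr : CTy → CTy → CTy
  | pi : MTy → CTy → CTy

/-- Computation contexts `Γ`. Computation types do not depend on computation variables, so an
assumption is given by its type. -/
abbrev CCtx : Type := List CTy

def Schema.mren (ρ : ℕ → ℕ) : Schema → Schema
  | .elem Φ A => .elem (Φ.mren ρ) (A.mren ρ)
  | .plus G Φ A => .plus (G.mren ρ) (Φ.mren ρ) (A.mren ρ)

def MTy.mren (ρ : ℕ → ℕ) : MTy → MTy
  | .ctxt Ψ P => .ctxt (Ψ.mren ρ) (P.mren ρ)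
  | .schema G => .schema (G.mren ρ)

def MTm.mren (ρ : ℕ → ℕ) : MTm → MTm
  | .tm R => .tm (R.mren ρ)
  | .ctx Ψ => .ctx (Ψ.mren ρ)

def CTy.mren (ρ : ℕ → ℕ) : CTy → CTy
  | .box Ψ P => .box (Ψ.mren ρ) (P.mren ρ)
  | .arr τ₁ τ₂ => .arr (τ₁.mren ρ) (τ₂.mren ρ)
  | .pi U τ => .pi (U.mren ρ) (τ.mren (liftRen ρ))

/-- Weakening of a computation context by one contextual variable. -/
def CCtx.shift (Γ : CCtx) : CCtx := Γ.map (CTy.mren Nat.succ)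

/-- `MCtx.Lookup Δ X U`: the contextual variable `X` is declared in `Δ` with meta-type `U`. -/
inductive MCtx.Lookup : MCtx → ℕ → MTy → Prop
  | here {Δ : MCtx} {U : MTy} : MCtx.Lookup (U :: Δ) 0 (U.mren Nat.succ)
  | there {Δ : MCtx} {U U₁ : MTy} {X : ℕ} :
      MCtx.Lookup Δ X U → MCtx.Lookup (U₁ :: Δ) (X + 1) (U.mren Nat.succ)

/-! ## Meta-substitution

`HMSub C j` is the graph of `⟦C/X⟧` where `X` is the contextual variable with index `j`, which
disappears. For terms, `k` is the number of LF variables in scope. An occurrence `X[σ]` becomes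
`[σ₁]R` for `C = (Ψ̂ ⊢ R)` and `σ₁ = ⟦C/X⟧σ`; an occurrence of `wk_X` becomes the weakening by `k`
variables of the identity substitution of the context `C`. -/

/-- The index of a contextual variable other than `j` after `j` has been removed. -/
def dropIdx (j i : ℕ) : ℕ := if i < j then i else i - 1

mutual
inductive Tm.HMSub : MTm → ℕ → ℕ → Tm → Tm → Prop
  | neu {C : MTm} {j k : ℕ} {R : Ne} {M : Tm} :
      Ne.HMSub C j k R M → Tm.HMSub C j k (.neu R) M
  | lam {C : MTm} {j k : ℕ} {M M₁ : Tm} :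
      Tm.HMSub C j (k + 1) M M₁ → Tm.HMSub C j k (.lam M) (.lam M₁)
inductive Ne.HMSub : MTm → ℕ → ℕ → Ne → Tm → Prop
  | var {C : MTm} {j k i : ℕ} : Ne.HMSub C j k (.var i) (.neu (.var i))
  | const {C : MTm} {j k c : ℕ} : Ne.HMSub C j k (.const c) (.neu (.const c))
  | app_neu {C : MTm} {j k : ℕ} {R R₁ : Ne} {N N₁ : Tm} :
      Ne.HMSub C j k R (.neu R₁) → Tm.HMSub C j k N N₁ →
      Ne.HMSub C j k (.app R N) (.neu (.app R₁ N₁))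
  | app_lam {C : MTm} {j k : ℕ} {R : Ne} {N N₁ M M₁ : Tm} :
      Ne.HMSub C j k R (.lam M) → Tm.HMSub C j k N N₁ → Tm.HSub (inst N₁) M M₁ →
      Ne.HMSub C j k (.app R N) M₁
  | mvar_ne {C : MTm} {j k u : ℕ} {σ σ₁ : Sb} :
      u ≠ j → Sb.HMSub C j k σ σ₁ →
      Ne.HMSub C j k (.mvar u σ) (.neu (.mvar (dropIdx j u) σ₁))
  | mvar_eq {R : Ne} {j k : ℕ} {σ σ₁ : Sb} {M : Tm} :
      Sb.HMSub (.tm R) j k σ σ₁ → Ne.HSub σ₁.env R M →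
      Ne.HMSub (.tm R) j k (.mvar j σ) M
inductive Sb.HMSub : MTm → ℕ → ℕ → Sb → Sb → Prop
  | empty {C : MTm} {j k : ℕ} : Sb.HMSub C j k .empty .empty
  | wk_ne {C : MTm} {j k ψ : ℕ} :
      ψ ≠ j → Sb.HMSub C j k (.wk ψ) (.wk (dropIdx j ψ))
  | wk_eq {Ψ : Ctx} {j k : ℕ} :
      Sb.HMSub (.ctx Ψ) j k (.wk j) ((idSb Ψ).ren (fun i => i + k))
  | cons {C : MTm} {j k : ℕ} {σ σ₁ : Sb} {M M₁ : Tm} :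
      Sb.HMSub C j k σ σ₁ → Tm.HMSub C j k M M₁ →
      Sb.HMSub C j k (.cons σ M) (.cons σ₁ M₁)
end

inductive Atom.HMSub (C : MTm) (j k : ℕ) : Atom → Atom → Prop
  | mk {a : ℕ} {σ σ₁ : Sb} : Sb.HMSub C j k σ σ₁ → Atom.HMSub C j k ⟨a, σ⟩ ⟨a, σ₁⟩

inductive Ty.HMSub (C : MTm) (j : ℕ) : ℕ → Ty → Ty → Prop
  | atom {k : ℕ} {P P₁ : Atom} :
      Atom.HMSub C j k P P₁ → Ty.HMSub C j k (.atom P) (.atom P₁)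
  | arr {k : ℕ} {A A₁ B B₁ : Ty} :
      Ty.HMSub C j k A A₁ → Ty.HMSub C j k B B₁ → Ty.HMSub C j k (.arr A B) (.arr A₁ B₁)
  | pi {k : ℕ} {A A₁ B B₁ : Ty} :
      Ty.HMSub C j k A A₁ → Ty.HMSub C j (k + 1) B B₁ → Ty.HMSub C j k (.pi A B) (.pi A₁ B₁)

inductive Ctx.HMSub : MTm → ℕ → Ctx → Ctx → Prop
  | nil {C : MTm} {j : ℕ} : Ctx.HMSub C j .nil .nil
  | cvar_ne {C : MTm} {j ψ : ℕ} : ψ ≠ j → Ctx.HMSub C j (.cvar ψ) (.cvar (dropIdx j ψ))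
  | cvar_eq {Ψ : Ctx} {j : ℕ} : Ctx.HMSub (.ctx Ψ) j (.cvar j) Ψ
  | snoc {C : MTm} {j : ℕ} {Ψ Ψ₁ : Ctx} {r : Role} {A A₁ : Ty} :
      Ctx.HMSub C j Ψ Ψ₁ → Ty.HMSub C j Ψ.length A A₁ →
      Ctx.HMSub C j (.snoc Ψ r A) (.snoc Ψ₁ r A₁)

inductive Schema.HMSub (C : MTm) (j : ℕ) : Schema → Schema → Prop
  | elem {Φ Φ₁ : Ctx} {A A₁ : Ty} :
      Ctx.HMSub C j Φ Φ₁ → Ty.HMSub C j Φ.length A A₁ →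
      Schema.HMSub C j (.elem Φ A) (.elem Φ₁ A₁)
  | plus {G G₁ : Schema} {Φ Φ₁ : Ctx} {A A₁ : Ty} :
      Schema.HMSub C j G G₁ → Ctx.HMSub C j Φ Φ₁ → Ty.HMSub C j Φ.length A A₁ →
      Schema.HMSub C j (.plus G Φ A) (.plus G₁ Φ₁ A₁)

inductive MTy.HMSub (C : MTm) (j : ℕ) : MTy → MTy → Prop
  | ctxt {Ψ Ψ₁ : Ctx} {P P₁ : Atom} :
      Ctx.HMSub C j Ψ Ψ₁ → Atom.HMSub C j Ψ.length P P₁ →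
      MTy.HMSub C j (.ctxt Ψ P) (.ctxt Ψ₁ P₁)
  | schema {G G₁ : Schema} :
      Schema.HMSub C j G G₁ → MTy.HMSub C j (.schema G) (.schema G₁)

inductive CTy.HMSub : MTm → ℕ → CTy → CTy → Prop
  | box {C : MTm} {j : ℕ} {Ψ Ψ₁ : Ctx} {P P₁ : Atom} :
      Ctx.HMSub C j Ψ Ψ₁ → Atom.HMSub C j Ψ.length P P₁ →
      CTy.HMSub C j (.box Ψ P) (.box Ψ₁ P₁)
  | arr {C : MTm} {j : ℕ} {τ τ₁ υ υ₁ : CTy} :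
      CTy.HMSub C j τ τ₁ → CTy.HMSub C j υ υ₁ → CTy.HMSub C j (.arr τ υ) (.arr τ₁ υ₁)
  | pi {C : MTm} {j : ℕ} {U U₁ : MTy} {τ τ₁ : CTy} :
      MTy.HMSub C j U U₁ → CTy.HMSub (C.mren Nat.succ) (j + 1) τ τ₁ →
      CTy.HMSub C j (.pi U τ) (.pi U₁ τ₁)

/-! ## Signatures and typing -/

/-- Declarations of a signature: a type family `a : Π(x₁:A₁)…(xₙ:Aₙ). type`, whose kind is recorded
as the LF context `x₁:A₁, …, xₙ:Aₙ`, or a constant `c : A`. -/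
inductive Decl : Type
  | fam : ℕ → Ctx → Decl
  | con : ℕ → Ty → Decl

/-- Signatures, most recent declaration first. -/
abbrev Sig : Type := List Decl

/-! LF typing of canonical forms. `TmChk S Δ Ψ M A` is `Δ; Ψ ⊢ M ⇐ A`, `NeSyn S Δ Ψ R A` is
`Δ; Ψ ⊢ R ⇒ A`, `SbChk S Δ Ψ σ Φ` is `Δ; Ψ ⊢ σ ⇐ Φ`. The roles of the declarations are
irrelevant for typing. -/

mutual
inductive TmChk (S : Sig) (Δ : MCtx) : Ctx → Tm → Ty → Prop
  | neu {Ψ : Ctx} {R : Ne} {P : Atom} :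
      NeSyn S Δ Ψ R (.atom P) → TmChk S Δ Ψ (.neu R) (.atom P)
  | lam_arr {Ψ : Ctx} {M : Tm} {A B : Ty} :
      TmChk S Δ (.snoc Ψ .hyp A) M B.shift → TmChk S Δ Ψ (.lam M) (.arr A B)
  | lam_pi {Ψ : Ctx} {M : Tm} {A B : Ty} :
      TmChk S Δ (.snoc Ψ .param A) M B → TmChk S Δ Ψ (.lam M) (.pi A B)
inductive NeSyn (S : Sig) (Δ : MCtx) : Ctx → Ne → Ty → Prop
  | var {Ψ : Ctx} {x : ℕ} {r : Role} {A : Ty} : Ψ.Lookup x r A → NeSyn S Δ Ψ (.var x) A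
  | const {Ψ : Ctx} {c : ℕ} {A : Ty} : Decl.con c A ∈ S → NeSyn S Δ Ψ (.const c) A
  | app_arr {Ψ : Ctx} {R : Ne} {N : Tm} {A B : Ty} :
      NeSyn S Δ Ψ R (.arr A B) → TmChk S Δ Ψ N A → NeSyn S Δ Ψ (.app R N) B
  | app_pi {Ψ : Ctx} {R : Ne} {N : Tm} {A B B₁ : Ty} :
      NeSyn S Δ Ψ R (.pi A B) → TmChk S Δ Ψ N A → Ty.HSub (inst N) B B₁ →
      NeSyn S Δ Ψ (.app R N) B₁
  | mvar {Ψ Φ : Ctx} {u : ℕ} {σ : Sb} {P P₁ : Atom} :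
      MCtx.Lookup Δ u (.ctxt Φ P) → SbChk S Δ Ψ σ Φ → Atom.HSub σ.env P P₁ →
      NeSyn S Δ Ψ (.mvar u σ) (.atom P₁)
inductive SbChk (S : Sig) (Δ : MCtx) : Ctx → Sb → Ctx → Prop
  | empty {Ψ : Ctx} : SbChk S Δ Ψ .empty .nil
  | wk {Ψ : Ctx} {ψ : ℕ} : Ψ.base = some ψ → SbChk S Δ Ψ (.wk ψ) (.cvar ψ)
  | cons {Ψ Φ : Ctx} {σ : Sb} {r : Role} {M : Tm} {B B₁ : Ty} :
      SbChk S Δ Ψ σ Φ → Ty.HSub σ.env B B₁ → TmChk S Δ Ψ M B₁ →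
      SbChk S Δ Ψ (.cons σ M) (.snoc Φ r B)
end

/-- `Δ; Ψ ⊢ A` is a type. -/
inductive TyWf (S : Sig) (Δ : MCtx) : Ctx → Ty → Prop
  | atom {Ψ Φ : Ctx} {a : ℕ} {σ : Sb} :
      Decl.fam a Φ ∈ S → SbChk S Δ Ψ σ Φ → TyWf S Δ Ψ (.atom ⟨a, σ⟩)
  | arr {Ψ : Ctx} {A B : Ty} : TyWf S Δ Ψ A → TyWf S Δ Ψ B → TyWf S Δ Ψ (.arr A B)
  | pi {Ψ : Ctx} {A B : Ty} :
      TyWf S Δ Ψ A → TyWf S Δ (.snoc Ψ .param A) B → TyWf S Δ Ψ (.pi A B)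

/-- `Δ ⊢ Ψ` is an LF context. -/
inductive CtxWf (S : Sig) (Δ : MCtx) : Ctx → Prop
  | nil : CtxWf S Δ .nil
  | cvar {ψ : ℕ} {G : Schema} : MCtx.Lookup Δ ψ (.schema G) → CtxWf S Δ (.cvar ψ)
  | snoc {Ψ : Ctx} {r : Role} {A : Ty} :
      CtxWf S Δ Ψ → TyWf S Δ Ψ A → CtxWf S Δ (.snoc Ψ r A)

/-- `Δ ⊢ U` is a meta-type. -/
inductive MTyWf (S : Sig) (Δ : MCtx) : MTy → Prop
  | ctxt {Ψ : Ctx} {P : Atom} :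
      CtxWf S Δ Ψ → TyWf S Δ Ψ (.atom P) → MTyWf S Δ (.ctxt Ψ P)
  | schema {G : Schema} :
      (∀ Φ A, G.Mem Φ A → Φ.base = none ∧ CtxWf S Δ Φ ∧ TyWf S Δ Φ A) →
      MTyWf S Δ (.schema G)

/-- `Δ` is a meta-context. -/
inductive MCtxWf (S : Sig) : MCtx → Prop
  | nil : MCtxWf S []
  | cons {Δ : MCtx} {U : MTy} : MCtxWf S Δ → MTyWf S Δ U → MCtxWf S (U :: Δ)

/-- `Δ ⊢ τ` is a computation type. -/
inductive CTyWf (S : Sig) : MCtx → CTy → Prop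
  | box {Δ : MCtx} {Ψ : Ctx} {P : Atom} :
      CtxWf S Δ Ψ → TyWf S Δ Ψ (.atom P) → CTyWf S Δ (.box Ψ P)
  | arr {Δ : MCtx} {τ₁ τ₂ : CTy} : CTyWf S Δ τ₁ → CTyWf S Δ τ₂ → CTyWf S Δ (.arr τ₁ τ₂)
  | pi {Δ : MCtx} {U : MTy} {τ : CTy} :
      MTyWf S Δ U → CTyWf S (U :: Δ) τ → CTyWf S Δ (.pi U τ)

/-- `Δ ⊢ Γ` is a computation context. -/
def CCtxWf (S : Sig) (Δ : MCtx) (Γ : CCtx) : Prop := ∀ τ ∈ Γ, CTyWf S Δ τ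

/-- Well-formed signatures: every declaration is closed, well-formed over the earlier ones, and has
a new name. -/
inductive SigWf : Sig → Prop
  | nil : SigWf []
  | fam {S : Sig} {a : ℕ} {K : Ctx} :
      SigWf S → (∀ K₁, Decl.fam a K₁ ∉ S) → K.base = none → CtxWf S [] K →
      SigWf (Decl.fam a K :: S)
  | con {S : Sig} {c : ℕ} {A : Ty} :
      SigWf S → (∀ A₁, Decl.con c A₁ ∉ S) → TyWf S [] .nil A → SigWf (Decl.con c A :: S)

/-- `Δ ⊩ Ψ ⇐ G`: every declaration of `Ψ` is an instance of an element of the schema `G`. -/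
inductive SchemaChk (S : Sig) (Δ : MCtx) (G : Schema) : Ctx → Prop
  | nil : SchemaChk S Δ G .nil
  | cvar {ψ : ℕ} : MCtx.Lookup Δ ψ (.schema G) → SchemaChk S Δ G (.cvar ψ)
  | snoc {Ψ Φ : Ctx} {r : Role} {σ : Sb} {A A₁ : Ty} :
      SchemaChk S Δ G Ψ → G.Mem Φ A → SbChk S Δ Ψ σ Φ → Ty.HSub σ.env A A₁ →
      SchemaChk S Δ G (.snoc Ψ r A₁)

/-- `Δ ⊩ C ⇐ U`. -/
inductive MTmChk (S : Sig) (Δ : MCtx) : MTm → MTy → Prop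
  | tm {Ψ : Ctx} {R : Ne} {P : Atom} :
      NeSyn S Δ Ψ R (.atom P) → MTmChk S Δ (.tm R) (.ctxt Ψ P)
  | ctx {Ψ : Ctx} {G : Schema} : SchemaChk S Δ G Ψ → MTmChk S Δ (.ctx Ψ) (.schema G)

/-! ## Sequent calculus for contextual LF -/

/-- The assumptions that may be used in a proof over `Ψ`: its proof-relevant declarations, and the
constants of the signature, to which every sequent has access. -/
inductive Assump (S : Sig) (Ψ : Ctx) : Ne → Ty → Prop
  | hyp {x : ℕ} {A : Ty} : Ψ.Lookup x .hyp A → Assump S Ψ (.var x) A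
  | con {c : ℕ} {A : Ty} : Decl.con c A ∈ S → Assump S Ψ (.const c) A

/-! `LFSeq S Δ Ψ M A` is `Δ; Ψ ⟹ M : A` and `LFSeqSb S Δ Ψ σ Φ` is `Δ; Ψ ⟹ σ : Φ`. Proof terms are
canonical: an assumption used as a proof of `A` is written in its η-long form. -/

mutual
inductive LFSeq (S : Sig) (Δ : MCtx) : Ctx → Tm → Ty → Prop
  | init {Ψ : Ctx} {h : Ne} {A : Ty} : Assump S Ψ h A → LFSeq S Δ Ψ (eta A h) A
  | piR {Ψ : Ctx} {M : Tm} {A B : Ty} :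
      LFSeq S Δ (.snoc Ψ .param A) M B → LFSeq S Δ Ψ (.lam M) (.pi A B)
  | piL {Ψ : Ctx} {h : Ne} {M N N₁ : Tm} {A B B₁ A₁ : Ty} :
      Assump S Ψ h (.pi A B) → TmChk S Δ Ψ M A → Ty.HSub (inst M) B B₁ →
      LFSeq S Δ (.snoc Ψ .hyp B₁) N A₁.shift → Tm.HSub (inst (.neu (.app h M))) N N₁ →
      LFSeq S Δ Ψ N₁ A₁
  | arrR {Ψ : Ctx} {M : Tm} {A B : Ty} :
      LFSeq S Δ (.snoc Ψ .hyp A) M B.shift → LFSeq S Δ Ψ (.lam M) (.arr A B)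
  | arrL {Ψ : Ctx} {h : Ne} {M N N₁ : Tm} {A B A₁ : Ty} :
      Assump S Ψ h (.arr A B) → LFSeq S Δ Ψ M A →
      LFSeq S Δ (.snoc Ψ .hyp B) N A₁.shift → Tm.HSub (inst (.neu (.app h M))) N N₁ →
      LFSeq S Δ Ψ N₁ A₁
  | reflect {Ψ Φ : Ctx} {u : ℕ} {σ : Sb} {P P₁ : Atom} {M M₁ : Tm} {A : Ty} :
      MCtx.Lookup Δ u (.ctxt Φ P) → LFSeqSb S Δ Ψ σ Φ → Atom.HSub σ.env P P₁ →
      LFSeq S Δ (.snoc Ψ .hyp (.atom P₁)) M A.shift → Tm.HSub (inst (.neu (.mvar u σ))) M M₁ →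
      LFSeq S Δ Ψ M₁ A
inductive LFSeqSb (S : Sig) (Δ : MCtx) : Ctx → Sb → Ctx → Prop
  | empty {Ψ : Ctx} : LFSeqSb S Δ Ψ .empty .nil
  | wk {Ψ : Ctx} {ψ : ℕ} : Ψ.base = some ψ → LFSeqSb S Δ Ψ (.wk ψ) (.cvar ψ)
  | subp {Ψ Φ : Ctx} {σ : Sb} {N : Tm} {B B₁ : Ty} :
      LFSeqSb S Δ Ψ σ Φ → Ty.HSub σ.env B B₁ → LFSeq S Δ Ψ N B₁ →
      LFSeqSb S Δ Ψ (.cons σ N) (.snoc Φ .hyp B)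
  | subu {Ψ Φ : Ctx} {σ : Sb} {M : Tm} {B B₁ : Ty} :
      LFSeqSb S Δ Ψ σ Φ → Ty.HSub σ.env B B₁ → TmChk S Δ Ψ M B₁ →
      LFSeqSb S Δ Ψ (.cons σ M) (.snoc Φ .param B)
end

/-! ## Sequent calculus for the computation logic -/

/-- `Δ; Γ ⟹ τ` is derivable. (Proof terms for computations are left out: no rule depends on
them.) -/
inductive CSeq (S : Sig) : MCtx → CCtx → CTy → Prop
  | init {Δ : MCtx} {Γ : CCtx} {τ : CTy} : τ ∈ Γ → CSeq S Δ Γ τ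
  | piR {Δ : MCtx} {Γ : CCtx} {U : MTy} {τ : CTy} :
      CSeq S (U :: Δ) Γ.shift τ → CSeq S Δ Γ (.pi U τ)
  | piL {Δ : MCtx} {Γ : CCtx} {U : MTy} {C : MTm} {τ₁ τ₂ τ : CTy} :
      CTy.pi U τ₁ ∈ Γ → MTmChk S Δ C U → CTy.HMSub C 0 τ₁ τ₂ → CSeq S Δ (τ₂ :: Γ) τ →
      CSeq S Δ Γ τ
  | arrR {Δ : MCtx} {Γ : CCtx} {τ₁ τ₂ : CTy} :
      CSeq S Δ (τ₁ :: Γ) τ₂ → CSeq S Δ Γ (.arr τ₁ τ₂)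
  | arrL {Δ : MCtx} {Γ : CCtx} {τ₁ τ₂ τ : CTy} :
      CTy.arr τ₁ τ₂ ∈ Γ → CSeq S Δ Γ τ₁ → CSeq S Δ (τ₂ :: Γ) τ → CSeq S Δ Γ τ
  | boxR {Δ : MCtx} {Γ : CCtx} {Ψ : Ctx} {R : Ne} {P : Atom} :
      LFSeq S Δ Ψ (.neu R) (.atom P) → CSeq S Δ Γ (.box Ψ P)
  | boxL {Δ : MCtx} {Γ : CCtx} {Ψ : Ctx} {P : Atom} {τ : CTy} :
      CTy.box Ψ P ∈ Γ → CSeq S (.ctxt Ψ P :: Δ) Γ.shift (τ.mren Nat.succ) → CSeq S Δ Γ τ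

/-! ## Focusing calculus for contextual LF

`Unif S Δ Ψ M A` says that `M` is a uniform proof of `A`, `UnifSb S Δ Ψ σ Φ` that `σ` witnesses a
uniform proof of `Φ`, and `Foc S Δ Ψ R A M P` that `M` is a focused proof of `P` with focus on the
neutral term `R : A`. -/

mutual
inductive Unif (S : Sig) (Δ : MCtx) : Ctx → Tm → Ty → Prop
  | piR {Ψ : Ctx} {M : Tm} {A B : Ty} :
      Unif S Δ (.snoc Ψ .param A) M B → Unif S Δ Ψ (.lam M) (.pi A B)
  | arrR {Ψ : Ctx} {M : Tm} {A B : Ty} :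
      Unif S Δ (.snoc Ψ .hyp A) M B.shift → Unif S Δ Ψ (.lam M) (.arr A B)
  | transMeta {Ψ Φ : Ctx} {X : ℕ} {σ : Sb} {Q P : Atom} :
      MCtx.Lookup Δ X (.ctxt Φ Q) → UnifSb S Δ Ψ σ Φ → Atom.HSub σ.env Q P →
      Unif S Δ Ψ (.neu (.mvar X σ)) (.atom P)
  | transAssump {Ψ : Ctx} {h : Ne} {M : Tm} {A : Ty} {P : Atom} :
      Assump S Ψ h A → Foc S Δ Ψ h A M P → Unif S Δ Ψ M (.atom P)
inductive UnifSb (S : Sig) (Δ : MCtx) : Ctx → Sb → Ctx → Prop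
  | empty {Ψ : Ctx} : UnifSb S Δ Ψ .empty .nil
  | wk {Ψ : Ctx} {ψ : ℕ} : Ψ.base = some ψ → UnifSb S Δ Ψ (.wk ψ) (.cvar ψ)
  | subp {Ψ Φ : Ctx} {σ : Sb} {N : Tm} {B B₁ : Ty} :
      UnifSb S Δ Ψ σ Φ → Ty.HSub σ.env B B₁ → Unif S Δ Ψ N B₁ →
      UnifSb S Δ Ψ (.cons σ N) (.snoc Φ .hyp B)
  | subu {Ψ Φ : Ctx} {σ : Sb} {M : Tm} {B B₁ : Ty} :
      UnifSb S Δ Ψ σ Φ → Ty.HSub σ.env B B₁ → TmChk S Δ Ψ M B₁ →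
      UnifSb S Δ Ψ (.cons σ M) (.snoc Φ .param B)
inductive Foc (S : Sig) (Δ : MCtx) : Ctx → Ne → Ty → Tm → Atom → Prop
  | init {Ψ : Ctx} {R : Ne} {P : Atom} : Foc S Δ Ψ R (.atom P) (.neu R) P
  | arrL {Ψ : Ctx} {R : Ne} {N M : Tm} {A B : Ty} {P : Atom} :
      Unif S Δ Ψ N A → Foc S Δ Ψ (.app R N) B M P → Foc S Δ Ψ R (.arr A B) M P
  | piL {Ψ : Ctx} {R : Ne} {N M : Tm} {A B B₁ : Ty} {P : Atom} :
      TmChk S Δ Ψ N A → Ty.HSub (inst N) B B₁ → Foc S Δ Ψ (.app R N) B₁ M P →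
      Foc S Δ Ψ R (.pi A B) M P
end

/-- `Δ > X:(Φ ⊢ Q); Ψ ⇉ P`: `M = X[σ]` proves `P` with focus on the contextual variable `X`. -/
def FocMeta (S : Sig) (Δ : MCtx) (Ψ : Ctx) (X : ℕ) (Φ : Ctx) (Q : Atom) (M : Tm) (P : Atom) :
    Prop :=
  ∃ σ : Sb, UnifSb S Δ Ψ σ Φ ∧ Atom.HSub σ.env Q P ∧ M = .neu (.mvar X σ)

/-! ## Focusing calculus for the computation logic

`UnifR S Δ Γ τ` is the uniform right judgment, `UnifL S Δ Γ Γ₁ Ψ P` is the uniform left judgment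
`Δ; Γ ≫ Γ₁ ⟹ ⌈Ψ ⊢ P⌉`, and `CFoc S Δ Γ τ Ψ P` is `Δ; Γ > y:τ ⟹ ⌈Ψ ⊢ P⌉`. -/

mutual
inductive UnifR (S : Sig) : MCtx → CCtx → CTy → Prop
  | arrR {Δ : MCtx} {Γ : CCtx} {τ₁ τ₂ : CTy} :
      UnifR S Δ (τ₁ :: Γ) τ₂ → UnifR S Δ Γ (.arr τ₁ τ₂)
  | piR {Δ : MCtx} {Γ : CCtx} {U : MTy} {τ : CTy} :
      UnifR S (U :: Δ) Γ.shift τ → UnifR S Δ Γ (.pi U τ)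
  | toLeft {Δ : MCtx} {Γ : CCtx} {Ψ : Ctx} {P : Atom} :
      UnifL S Δ [] Γ Ψ P → UnifR S Δ Γ (.box Ψ P)
inductive UnifL (S : Sig) : MCtx → CCtx → CCtx → Ctx → Atom → Prop
  | boxL {Δ : MCtx} {Γ Γ₁ : CCtx} {Φ Ψ : Ctx} {Q P : Atom} :
      UnifL S (.ctxt Φ Q :: Δ) Γ.shift Γ₁.shift (Ψ.mren Nat.succ) (P.mren Nat.succ) →
      UnifL S Δ Γ (.box Φ Q :: Γ₁) Ψ P
  | shift {Δ : MCtx} {Γ Γ₁ : CCtx} {τ : CTy} {Ψ : Ctx} {P : Atom} :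
      (∀ Φ Q, τ ≠ .box Φ Q) → UnifL S Δ (τ :: Γ) Γ₁ Ψ P → UnifL S Δ Γ (τ :: Γ₁) Ψ P
  | level {Δ : MCtx} {Γ : CCtx} {Ψ : Ctx} {M : Tm} {P : Atom} :
      Unif S Δ Ψ M (.atom P) → UnifL S Δ Γ [] Ψ P
  | focus {Δ : MCtx} {Γ : CCtx} {τ : CTy} {Ψ : Ctx} {P : Atom} :
      τ ∈ Γ → CFoc S Δ Γ τ Ψ P → UnifL S Δ Γ [] Ψ P
inductive CFoc (S : Sig) : MCtx → CCtx → CTy → Ctx → Atom → Prop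
  | piL {Δ : MCtx} {Γ : CCtx} {U : MTy} {C : MTm} {τ τ₁ : CTy} {Ψ : Ctx} {P : Atom} :
      MTmChk S Δ C U → CTy.HMSub C 0 τ τ₁ → CFoc S Δ Γ τ₁ Ψ P → CFoc S Δ Γ (.pi U τ) Ψ P
  | arrL {Δ : MCtx} {Γ : CCtx} {τ₁ τ₂ : CTy} {Ψ : Ctx} {P : Atom} :
      UnifR S Δ Γ τ₁ → CFoc S Δ Γ τ₂ Ψ P → CFoc S Δ Γ (.arr τ₁ τ₂) Ψ P
  | blur {Δ : MCtx} {Γ : CCtx} {Φ Ψ : Ctx} {Q P : Atom} :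
      UnifL S Δ [] (.box Φ Q :: Γ) Ψ P → CFoc S Δ Γ (.box Φ Q) Ψ P
end

/-! ## The extended meta-context and the box-free context -/

def CTy.isBox : CTy → Bool
  | .box _ _ => true
  | _ => false

/-- The number of boxed assumptions of `Γ`. -/
def CCtx.boxes : CCtx → ℕ
  | [] => 0
  | .box _ _ :: Γ => CCtx.boxes Γ + 1
  | _ :: Γ => CCtx.boxes Γ

/-- Weakening of contextual indices from `Δ` to `Δ⁺`. -/
def CCtx.up (Γ : CCtx) : ℕ → ℕ := fun X => X + Γ.boxes

/-- `Δ⁺`: the meta-context `Δ` extended by `X : (Ψ ⊢ P)` for every assumption `⌈Ψ ⊢ P⌉` of `Γ`. -/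
def plus (Δ : MCtx) : CCtx → MCtx
  | [] => Δ
  | .box Ψ P :: Γ => (MTy.ctxt Ψ P).mren (CCtx.up Γ) :: plus Δ Γ
  | _ :: Γ => plus Δ Γ

/-- `Γ⁻`: the assumptions of `Γ` that are not of box type, read over `Δ⁺`. -/
def minus (Γ : CCtx) : CCtx := (Γ.filter (fun τ => !τ.isBox)).map (CTy.mren Γ.up)

end Beluga

open Beluga

namespace Beluga

/-! ## Substitution of neutral terms for variables -/

-- The focused calculi lack two things that the sequent calculi have: initial sequents at arbitrary
-- types, and left rules that may be applied at any moment. Both halves of the proof show that these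
-- rules are admissible, the first by identity expansion and the second by a restricted form of cut.
--
-- LF. A left rule or `reflect` ends with a proof term [R/x]N in which R is `h M` or `u[σ]`, hence
-- neutral. Replacing a variable by a neutral term creates no redex, so here hereditary substitution
-- is the plain function `nsub`. Wherever the uniform proof N focuses on x, the arguments of R are
-- put in front as further focusing steps and the focus falls on the head of R (`UNe.foc`). Together
-- with `Unif.nsub` this gives `Unif.hsub_inst`, without any measure on cut formulas. Initial
-- sequents are η-expanded by `UNe.eta`. Under a Π this requires [η(x)/x]B = B, the identity
-- property of hereditary substitution. That property depends only on the simple types `Sk` left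
-- after forgetting dependencies, and `etaCancels` proves its core by induction on their size.
-- Well-formedness enters the whole proof only through these skeletons, whose preservation under
-- substitution needs no dependent substitution lemma.
--
-- Computations. The scheme is the same, with a Kripke-style formulation. A type is `Adm` if in
-- every extension of the contexts (`Ext`: boxed assumptions may have moved to the meta-context) a
-- focus on it can be absorbed. An assumption is `Prov` if it is admissible, or, for a box, present
-- or already declared. `UnifR.prov` replaces assumptions by contexts that provide them. In a left
-- rule, a focus on the new assumption extends to a focus on the principal one, so the new
-- assumption is admissible and `UnifR.cut` removes it. If it is a box, the focused proof keeps it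
-- in the meta-context, and the cut is postponed to the end of the right phase, where a focus can be
-- blurred (`UnifR.cut_box`). Initial sequents come from `UnifR.of_adm`, which needs ⟦η(X)/X⟧τ = τ
-- (`SCTyOk.hmsub_id`).
--
-- `CSeq.unifR` combines these for arbitrary contexts that provide Γ, and Δ⁺; Γ⁻ is such a pair. The
-- remaining claims are inversions of the last rule, for e) after a change between the two forms of
-- a sequent without boxed assumptions (`UnifL.reshift`).

def liftN (f : ℕ → Ne) : ℕ → Ne
  | 0 => .var 0
  | i + 1 => (f i).ren Nat.succ

mutual
/-- Simultaneous replacement of variables by neutral terms; it creates no redexes. -/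
def Tm.nsub (f : ℕ → Ne) : Tm → Tm
  | .neu R => .neu (R.nsub f)
  | .lam M => .lam (M.nsub (liftN f))
def Ne.nsub (f : ℕ → Ne) : Ne → Ne
  | .var i => f i
  | .const c => .const c
  | .app R N => .app (R.nsub f) (N.nsub f)
  | .mvar u σ => .mvar u (σ.nsub f)
def Sb.nsub (f : ℕ → Ne) : Sb → Sb
  | .empty => .empty
  | .wk ψ => .wk ψ
  | .cons σ M => .cons (σ.nsub f) (M.nsub f)
end

def Atom.nsub (f : ℕ → Ne) (P : Atom) : Atom := ⟨P.fam, P.args.nsub f⟩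

def Ty.nsub (f : ℕ → Ne) : Ty → Ty
  | .atom P => .atom (P.nsub f)
  | .arr A B => .arr (A.nsub f) (B.nsub f)
  | .pi A B => .pi (A.nsub f) (B.nsub (liftN f))

theorem liftRen_comp (ρ ρ' : ℕ → ℕ) :
    (fun i => liftRen ρ' (liftRen ρ i)) = liftRen (fun i => ρ' (ρ i)) := by
  funext i; cases i <;> rfl

theorem liftRen_id : liftRen (fun i => i) = fun i => i := by
  funext i; cases i <;> rfl

mutual
theorem Tm.ren_ren (ρ ρ' : ℕ → ℕ) : ∀ M : Tm, (M.ren ρ).ren ρ' = M.ren (fun i => ρ' (ρ i))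
  | .neu R => by simp only [Tm.ren, Ne.ren_ren ρ ρ' R]
  | .lam M => by simp only [Tm.ren, Tm.ren_ren (liftRen ρ) (liftRen ρ') M, liftRen_comp]
theorem Ne.ren_ren (ρ ρ' : ℕ → ℕ) : ∀ R : Ne, (R.ren ρ).ren ρ' = R.ren (fun i => ρ' (ρ i))
  | .var _ => rfl
  | .const _ => rfl
  | .app R N => by simp only [Ne.ren, Ne.ren_ren ρ ρ' R, Tm.ren_ren ρ ρ' N]
  | .mvar _ σ => by simp only [Ne.ren, Sb.ren_ren ρ ρ' σ]
theorem Sb.ren_ren (ρ ρ' : ℕ → ℕ) : ∀ σ : Sb, (σ.ren ρ).ren ρ' = σ.ren (fun i => ρ' (ρ i))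
  | .empty => rfl
  | .wk _ => rfl
  | .cons σ M => by simp only [Sb.ren, Sb.ren_ren ρ ρ' σ, Tm.ren_ren ρ ρ' M]
end

theorem Tm.ren_succ_liftRen (ρ : ℕ → ℕ) (M : Tm) :
    (M.ren Nat.succ).ren (liftRen ρ) = (M.ren ρ).ren Nat.succ := by
  simp only [Tm.ren_ren, liftRen, Nat.succ_eq_add_one]

theorem Ne.ren_succ_liftRen (ρ : ℕ → ℕ) (R : Ne) :
    (R.ren Nat.succ).ren (liftRen ρ) = (R.ren ρ).ren Nat.succ := by
  simp only [Ne.ren_ren, liftRen, Nat.succ_eq_add_one]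

theorem liftN_liftRen (f : ℕ → Ne) (ρ : ℕ → ℕ) :
    (fun i => liftN f (liftRen ρ i)) = liftN (fun i => f (ρ i)) := by
  funext i; cases i <;> rfl

theorem liftN_ren (f : ℕ → Ne) (ρ : ℕ → ℕ) :
    (fun i => (liftN f i).ren (liftRen ρ)) = liftN (fun i => (f i).ren ρ) := by
  funext i; cases i
  · rfl
  · simp only [liftN, Ne.ren_succ_liftRen]

theorem liftN_var (ρ : ℕ → ℕ) :
    liftN (fun i => .var (ρ i)) = fun i => .var (liftRen ρ i) := by
  funext i; cases i <;> rfl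

theorem liftN_id : liftN Ne.var = Ne.var := by
  funext i; cases i <;> rfl

mutual
theorem Tm.ren_nsub (ρ : ℕ → ℕ) (f : ℕ → Ne) :
    ∀ M : Tm, (M.ren ρ).nsub f = M.nsub (fun i => f (ρ i))
  | .neu R => by simp only [Tm.ren, Tm.nsub, Ne.ren_nsub ρ f R]
  | .lam M => by
      simp only [Tm.ren, Tm.nsub, Tm.ren_nsub (liftRen ρ) (liftN f) M, liftN_liftRen]
theorem Ne.ren_nsub (ρ : ℕ → ℕ) (f : ℕ → Ne) :
    ∀ R : Ne, (R.ren ρ).nsub f = R.nsub (fun i => f (ρ i))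
  | .var _ => rfl
  | .const _ => rfl
  | .app R N => by simp only [Ne.ren, Ne.nsub, Ne.ren_nsub ρ f R, Tm.ren_nsub ρ f N]
  | .mvar _ σ => by simp only [Ne.ren, Ne.nsub, Sb.ren_nsub ρ f σ]
theorem Sb.ren_nsub (ρ : ℕ → ℕ) (f : ℕ → Ne) :
    ∀ σ : Sb, (σ.ren ρ).nsub f = σ.nsub (fun i => f (ρ i))
  | .empty => rfl
  | .wk _ => rfl
  | .cons σ M => by simp only [Sb.ren, Sb.nsub, Sb.ren_nsub ρ f σ, Tm.ren_nsub ρ f M]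
end

mutual
theorem Tm.nsub_ren (f : ℕ → Ne) (ρ : ℕ → ℕ) :
    ∀ M : Tm, (M.nsub f).ren ρ = M.nsub (fun i => (f i).ren ρ)
  | .neu R => by simp only [Tm.ren, Tm.nsub, Ne.nsub_ren f ρ R]
  | .lam M => by
      simp only [Tm.ren, Tm.nsub, Tm.nsub_ren (liftN f) (liftRen ρ) M, liftN_ren]
theorem Ne.nsub_ren (f : ℕ → Ne) (ρ : ℕ → ℕ) :
    ∀ R : Ne, (R.nsub f).ren ρ = R.nsub (fun i => (f i).ren ρ)
  | .var _ => rfl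
  | .const _ => rfl
  | .app R N => by simp only [Ne.ren, Ne.nsub, Ne.nsub_ren f ρ R, Tm.nsub_ren f ρ N]
  | .mvar _ σ => by simp only [Ne.ren, Ne.nsub, Sb.nsub_ren f ρ σ]
theorem Sb.nsub_ren (f : ℕ → Ne) (ρ : ℕ → ℕ) :
    ∀ σ : Sb, (σ.nsub f).ren ρ = σ.nsub (fun i => (f i).ren ρ)
  | .empty => rfl
  | .wk _ => rfl
  | .cons σ M => by simp only [Sb.ren, Sb.nsub, Sb.nsub_ren f ρ σ, Tm.nsub_ren f ρ M]
end

mutual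
theorem Tm.nsub_var (ρ : ℕ → ℕ) : ∀ M : Tm, M.nsub (fun i => .var (ρ i)) = M.ren ρ
  | .neu R => by simp only [Tm.ren, Tm.nsub, Ne.nsub_var ρ R]
  | .lam M => by simp only [Tm.ren, Tm.nsub, liftN_var, Tm.nsub_var (liftRen ρ) M]
theorem Ne.nsub_var (ρ : ℕ → ℕ) : ∀ R : Ne, R.nsub (fun i => .var (ρ i)) = R.ren ρ
  | .var _ => rfl
  | .const _ => rfl
  | .app R N => by simp only [Ne.ren, Ne.nsub, Ne.nsub_var ρ R, Tm.nsub_var ρ N]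
  | .mvar _ σ => by simp only [Ne.ren, Ne.nsub, Sb.nsub_var ρ σ]
theorem Sb.nsub_var (ρ : ℕ → ℕ) : ∀ σ : Sb, σ.nsub (fun i => .var (ρ i)) = σ.ren ρ
  | .empty => rfl
  | .wk _ => rfl
  | .cons σ M => by simp only [Sb.ren, Sb.nsub, Sb.nsub_var ρ σ, Tm.nsub_var ρ M]
end

mutual
theorem Tm.nsub_id : ∀ M : Tm, M.nsub Ne.var = M
  | .neu R => by simp only [Tm.nsub, Ne.nsub_id R]
  | .lam M => by simp only [Tm.nsub, liftN_id, Tm.nsub_id M]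
theorem Ne.nsub_id : ∀ R : Ne, R.nsub Ne.var = R
  | .var _ => rfl
  | .const _ => rfl
  | .app R N => by simp only [Ne.nsub, Ne.nsub_id R, Tm.nsub_id N]
  | .mvar _ σ => by simp only [Ne.nsub, Sb.nsub_id σ]
theorem Sb.nsub_id : ∀ σ : Sb, σ.nsub Ne.var = σ
  | .empty => rfl
  | .wk _ => rfl
  | .cons σ M => by simp only [Sb.nsub, Sb.nsub_id σ, Tm.nsub_id M]
end

theorem Sb.ren_id (σ : Sb) : σ.ren (fun i => i) = σ := by
  rw [← Sb.nsub_var]; exact σ.nsub_id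

theorem Atom.ren_nsub (ρ : ℕ → ℕ) (f : ℕ → Ne) (P : Atom) :
    (P.ren ρ).nsub f = P.nsub (fun i => f (ρ i)) := by
  simp only [Atom.ren, Atom.nsub, Sb.ren_nsub]

theorem Atom.nsub_ren (f : ℕ → Ne) (ρ : ℕ → ℕ) (P : Atom) :
    (P.nsub f).ren ρ = P.nsub (fun i => (f i).ren ρ) := by
  simp only [Atom.ren, Atom.nsub, Sb.nsub_ren]

theorem Ty.ren_nsub (ρ : ℕ → ℕ) (f : ℕ → Ne) (A : Ty) :
    (A.ren ρ).nsub f = A.nsub (fun i => f (ρ i)) := by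
  induction A generalizing ρ f with
  | atom P => simp only [Ty.ren, Ty.nsub, Atom.ren_nsub]
  | arr A B ihA ihB => simp only [Ty.ren, Ty.nsub, ihA, ihB]
  | pi A B ihA ihB => simp only [Ty.ren, Ty.nsub, ihA, ihB, liftN_liftRen]

theorem Ty.nsub_ren (f : ℕ → Ne) (ρ : ℕ → ℕ) (A : Ty) :
    (A.nsub f).ren ρ = A.nsub (fun i => (f i).ren ρ) := by
  induction A generalizing ρ f with
  | atom P => simp only [Ty.ren, Ty.nsub, Atom.nsub_ren]
  | arr A B ihA ihB => simp only [Ty.ren, Ty.nsub, ihA, ihB]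
  | pi A B ihA ihB => simp only [Ty.ren, Ty.nsub, ihA, ihB, liftN_ren]

theorem Ty.nsub_var (ρ : ℕ → ℕ) (A : Ty) : A.nsub (fun i => .var (ρ i)) = A.ren ρ := by
  induction A generalizing ρ with
  | atom P => simp only [Ty.ren, Ty.nsub, Atom.ren, Atom.nsub, Sb.nsub_var]
  | arr A B ihA ihB => simp only [Ty.ren, Ty.nsub, ihA, ihB]
  | pi A B ihA ihB => simp only [Ty.ren, Ty.nsub, ihA, ihB, liftN_var]

theorem Ty.nsub_id (A : Ty) : A.nsub Ne.var = A := by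
  induction A with
  | atom P => simp only [Ty.nsub, Atom.nsub, Sb.nsub_id]
  | arr A B ihA ihB => simp only [Ty.nsub, ihA, ihB]
  | pi A B ihA ihB => simp only [Ty.nsub, ihA, ihB, liftN_id]

theorem Ty.ren_id (A : Ty) : A.ren (fun i => i) = A := by
  rw [← Ty.nsub_var]; exact A.nsub_id

theorem Ty.shift_nsub (f : ℕ → Ne) (A : Ty) : A.shift.nsub (liftN f) = (A.nsub f).shift := by
  simp only [Ty.shift, Ty.ren_nsub, Ty.nsub_ren, liftN]

/-- The neutral substitution that replaces the most recent variable. -/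
def instN (R : Ne) : ℕ → Ne
  | 0 => R
  | i + 1 => .var i

theorem Ty.shift_instN (R : Ne) (A : Ty) : A.shift.nsub (instN R) = A := by
  simp only [Ty.shift, Ty.ren_nsub]; exact A.nsub_id

/-! ## Renaming of contextual variables -/

mutual
theorem Tm.mren_mren (ρ ρ' : ℕ → ℕ) : ∀ M : Tm, (M.mren ρ).mren ρ' = M.mren (fun i => ρ' (ρ i))
  | .neu R => by simp only [Tm.mren, Ne.mren_mren ρ ρ' R]
  | .lam M => by simp only [Tm.mren, Tm.mren_mren ρ ρ' M]
theorem Ne.mren_mren (ρ ρ' : ℕ → ℕ) : ∀ R : Ne, (R.mren ρ).mren ρ' = R.mren (fun i => ρ' (ρ i))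
  | .var _ => rfl
  | .const _ => rfl
  | .app R N => by simp only [Ne.mren, Ne.mren_mren ρ ρ' R, Tm.mren_mren ρ ρ' N]
  | .mvar _ σ => by simp only [Ne.mren, Sb.mren_mren ρ ρ' σ]
theorem Sb.mren_mren (ρ ρ' : ℕ → ℕ) : ∀ σ : Sb, (σ.mren ρ).mren ρ' = σ.mren (fun i => ρ' (ρ i))
  | .empty => rfl
  | .wk _ => rfl
  | .cons σ M => by simp only [Sb.mren, Sb.mren_mren ρ ρ' σ, Tm.mren_mren ρ ρ' M]
end

mutual
theorem Tm.mren_id : ∀ M : Tm, M.mren (fun i => i) = M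
  | .neu R => by simp only [Tm.mren, Ne.mren_id R]
  | .lam M => by simp only [Tm.mren, Tm.mren_id M]
theorem Ne.mren_id : ∀ R : Ne, R.mren (fun i => i) = R
  | .var _ => rfl
  | .const _ => rfl
  | .app R N => by simp only [Ne.mren, Ne.mren_id R, Tm.mren_id N]
  | .mvar _ σ => by simp only [Ne.mren, Sb.mren_id σ]
theorem Sb.mren_id : ∀ σ : Sb, σ.mren (fun i => i) = σ
  | .empty => rfl
  | .wk _ => rfl
  | .cons σ M => by simp only [Sb.mren, Sb.mren_id σ, Tm.mren_id M]
end

mutual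
theorem Tm.ren_mren (ρ m : ℕ → ℕ) : ∀ M : Tm, (M.ren ρ).mren m = (M.mren m).ren ρ
  | .neu R => by simp only [Tm.mren, Tm.ren, Ne.ren_mren ρ m R]
  | .lam M => by simp only [Tm.mren, Tm.ren, Tm.ren_mren (liftRen ρ) m M]
theorem Ne.ren_mren (ρ m : ℕ → ℕ) : ∀ R : Ne, (R.ren ρ).mren m = (R.mren m).ren ρ
  | .var _ => rfl
  | .const _ => rfl
  | .app R N => by simp only [Ne.mren, Ne.ren, Ne.ren_mren ρ m R, Tm.ren_mren ρ m N]
  | .mvar _ σ => by simp only [Ne.mren, Ne.ren, Sb.ren_mren ρ m σ]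
theorem Sb.ren_mren (ρ m : ℕ → ℕ) : ∀ σ : Sb, (σ.ren ρ).mren m = (σ.mren m).ren ρ
  | .empty => rfl
  | .wk _ => rfl
  | .cons σ M => by simp only [Sb.mren, Sb.ren, Sb.ren_mren ρ m σ, Tm.ren_mren ρ m M]
end

theorem Atom.mren_mren (ρ ρ' : ℕ → ℕ) (P : Atom) :
    (P.mren ρ).mren ρ' = P.mren (fun i => ρ' (ρ i)) := by
  simp only [Atom.mren, Sb.mren_mren]

theorem Ty.mren_mren (ρ ρ' : ℕ → ℕ) (A : Ty) :
    (A.mren ρ).mren ρ' = A.mren (fun i => ρ' (ρ i)) := by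
  induction A with
  | atom P => simp only [Ty.mren, Atom.mren_mren]
  | arr A B ihA ihB => simp only [Ty.mren, ihA, ihB]
  | pi A B ihA ihB => simp only [Ty.mren, ihA, ihB]

theorem Ctx.mren_mren (ρ ρ' : ℕ → ℕ) (Ψ : Ctx) :
    (Ψ.mren ρ).mren ρ' = Ψ.mren (fun i => ρ' (ρ i)) := by
  induction Ψ with
  | nil => rfl
  | cvar ψ => rfl
  | snoc Ψ r A ih => simp only [Ctx.mren, ih, Ty.mren_mren]

theorem Schema.mren_mren (ρ ρ' : ℕ → ℕ) (G : Schema) :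
    (G.mren ρ).mren ρ' = G.mren (fun i => ρ' (ρ i)) := by
  induction G with
  | elem Φ A => simp only [Schema.mren, Ctx.mren_mren, Ty.mren_mren]
  | plus G Φ A ih => simp only [Schema.mren, ih, Ctx.mren_mren, Ty.mren_mren]

theorem MTy.mren_mren (ρ ρ' : ℕ → ℕ) (U : MTy) :
    (U.mren ρ).mren ρ' = U.mren (fun i => ρ' (ρ i)) := by
  cases U <;> simp only [MTy.mren, Ctx.mren_mren, Atom.mren_mren, Schema.mren_mren]

theorem MTm.mren_mren (ρ ρ' : ℕ → ℕ) (C : MTm) :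
    (C.mren ρ).mren ρ' = C.mren (fun i => ρ' (ρ i)) := by
  cases C <;> simp only [MTm.mren, Ctx.mren_mren, Ne.mren_mren]

theorem CTy.mren_mren (ρ ρ' : ℕ → ℕ) (τ : CTy) :
    (τ.mren ρ).mren ρ' = τ.mren (fun i => ρ' (ρ i)) := by
  induction τ generalizing ρ ρ' with
  | box Ψ P => simp only [CTy.mren, Ctx.mren_mren, Atom.mren_mren]
  | arr τ₁ τ₂ ih₁ ih₂ => simp only [CTy.mren, ih₁, ih₂]
  | pi U τ ih => simp only [CTy.mren, ih, MTy.mren_mren, liftRen_comp]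

theorem Atom.mren_id (P : Atom) : P.mren (fun i => i) = P := by
  simp only [Atom.mren, Sb.mren_id]

theorem Ty.mren_id (A : Ty) : A.mren (fun i => i) = A := by
  induction A with
  | atom P => simp only [Ty.mren, Atom.mren_id]
  | arr A B ihA ihB => simp only [Ty.mren, ihA, ihB]
  | pi A B ihA ihB => simp only [Ty.mren, ihA, ihB]

theorem Ctx.mren_id (Ψ : Ctx) : Ψ.mren (fun i => i) = Ψ := by
  induction Ψ with
  | nil => rfl
  | cvar ψ => rfl
  | snoc Ψ r A ih => simp only [Ctx.mren, ih, Ty.mren_id]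

theorem Schema.mren_id (G : Schema) : G.mren (fun i => i) = G := by
  induction G with
  | elem Φ A => simp only [Schema.mren, Ctx.mren_id, Ty.mren_id]
  | plus G Φ A ih => simp only [Schema.mren, ih, Ctx.mren_id, Ty.mren_id]

theorem MTy.mren_id (U : MTy) : U.mren (fun i => i) = U := by
  cases U <;> simp only [MTy.mren, Ctx.mren_id, Atom.mren_id, Schema.mren_id]

theorem CTy.mren_id (τ : CTy) : τ.mren (fun i => i) = τ := by
  induction τ with
  | box Ψ P => simp only [CTy.mren, Ctx.mren_id, Atom.mren_id]
  | arr τ₁ τ₂ ih₁ ih₂ => simp only [CTy.mren, ih₁, ih₂]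
  | pi U τ ih => simp only [CTy.mren, ih, MTy.mren_id, liftRen_id]

theorem Ty.ren_mren (ρ m : ℕ → ℕ) (A : Ty) : (A.ren ρ).mren m = (A.mren m).ren ρ := by
  induction A generalizing ρ with
  | atom P => simp only [Ty.mren, Ty.ren, Atom.mren, Atom.ren, Sb.ren_mren]
  | arr A B ihA ihB => simp only [Ty.mren, Ty.ren, ihA, ihB]
  | pi A B ihA ihB => simp only [Ty.mren, Ty.ren, ihA, ihB]

theorem Ty.shift_mren (m : ℕ → ℕ) (A : Ty) : A.shift.mren m = (A.mren m).shift :=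
  A.ren_mren _ _

theorem Ctx.base_mren (m : ℕ → ℕ) (Ψ : Ctx) : (Ψ.mren m).base = Ψ.base.map m := by
  induction Ψ with
  | nil => rfl
  | cvar ψ => rfl
  | snoc Ψ r A ih => exact ih

theorem Ctx.length_mren (m : ℕ → ℕ) (Ψ : Ctx) : (Ψ.mren m).length = Ψ.length := by
  induction Ψ with
  | nil => rfl
  | cvar ψ => rfl
  | snoc Ψ r A ih => simp only [Ctx.mren, Ctx.length, ih]

theorem Ctx.Lookup.mren {Ψ : Ctx} {x : ℕ} {r : Role} {A : Ty} (m : ℕ → ℕ)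
    (h : Ψ.Lookup x r A) : (Ψ.mren m).Lookup x r (A.mren m) := by
  induction h with
  | here => rw [Ty.shift_mren]; exact .here
  | there _ ih => rw [Ty.shift_mren]; exact .there ih

theorem Sb.env_mren (m : ℕ → ℕ) : ∀ (σ : Sb) (i : ℕ), (σ.mren m).env i = (σ.env i).mren m
  | .empty, _ => rfl
  | .wk _, _ => rfl
  | .cons _ _, 0 => rfl
  | .cons σ _, i + 1 => Sb.env_mren m σ i

theorem Sb.env_ren (ρ : ℕ → ℕ) : ∀ (σ : Sb) (i : ℕ), (σ.ren ρ).env i = (σ.env i).ren ρ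
  | .empty, _ => rfl
  | .wk _, _ => rfl
  | .cons _ _, 0 => rfl
  | .cons σ _, i + 1 => Sb.env_ren ρ σ i

theorem Sb.env_nsub (f : ℕ → Ne) : ∀ (σ : Sb) (i : ℕ), (σ.nsub f).env i = (σ.env i).nsub f
  | .empty, _ => rfl
  | .wk _, _ => rfl
  | .cons _ _, 0 => rfl
  | .cons σ _, i + 1 => Sb.env_nsub f σ i

/-! ## Hereditary substitution and renaming -/

theorem liftEnv_ren {e e' : ℕ → Tm} {ρ ρ' : ℕ → ℕ} (h : ∀ i, e' (ρ i) = (e i).ren ρ') (i : ℕ) :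
    liftEnv e' (liftRen ρ i) = (liftEnv e i).ren (liftRen ρ') := by
  cases i with
  | zero => rfl
  | succ i => simp only [liftEnv, liftRen, h, Tm.ren_succ_liftRen]

theorem inst_ren (N : Tm) (ρ : ℕ → ℕ) (i : ℕ) :
    inst (N.ren ρ) (liftRen ρ i) = (inst N i).ren ρ := by
  cases i <;> rfl

mutual
-- Source and target are renamed separately because the contracted body in `app_lam` needs it: there
-- the source carries `liftRen ρ'` and the target only `ρ'`.
theorem Tm.HSub.ren {e e' : ℕ → Tm} {ρ ρ' : ℕ → ℕ} {M M₁ : Tm}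
    (h : ∀ i, e' (ρ i) = (e i).ren ρ') : Tm.HSub e M M₁ → Tm.HSub e' (M.ren ρ) (M₁.ren ρ')
  | .neu hR => .neu (Ne.HSub.ren h hR)
  | .lam hM => .lam (Tm.HSub.ren (liftEnv_ren h) hM)
theorem Ne.HSub.ren {e e' : ℕ → Tm} {ρ ρ' : ℕ → ℕ} {R : Ne} {M₁ : Tm}
    (h : ∀ i, e' (ρ i) = (e i).ren ρ') : Ne.HSub e R M₁ → Ne.HSub e' (R.ren ρ) (M₁.ren ρ')
  | .var => by rw [← h]; exact .var
  | .const => .const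
  | .app_neu hR hN => .app_neu (Ne.HSub.ren h hR) (Tm.HSub.ren h hN)
  | .app_lam hR hN hM =>
      .app_lam (Ne.HSub.ren h hR) (Tm.HSub.ren h hN) (Tm.HSub.ren (inst_ren _ _) hM)
  | .mvar hσ => .mvar (Sb.HSub.ren h hσ)
theorem Sb.HSub.ren {e e' : ℕ → Tm} {ρ ρ' : ℕ → ℕ} {σ σ₁ : Sb}
    (h : ∀ i, e' (ρ i) = (e i).ren ρ') : Sb.HSub e σ σ₁ → Sb.HSub e' (σ.ren ρ) (σ₁.ren ρ')
  | .empty => .empty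
  | .wk => .wk
  | .cons hσ hM => .cons (Sb.HSub.ren h hσ) (Tm.HSub.ren h hM)
end

theorem Ne.HSub.shift {e : ℕ → Tm} {R : Ne} {M : Tm} (h : Ne.HSub e R M) :
    Ne.HSub (liftEnv e) (R.ren Nat.succ) (M.ren Nat.succ) :=
  h.ren fun _ => rfl

theorem liftEnv_nsub {e e' : ℕ → Tm} {f g : ℕ → Ne}
    (h : ∀ i, Ne.HSub e' (g i) ((e i).nsub f)) (i : ℕ) :
    Ne.HSub (liftEnv e') (liftN g i) ((liftEnv e i).nsub (liftN f)) := by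
  cases i with
  | zero => exact .var
  | succ i =>
      have := (h i).shift
      simp only [liftEnv, liftN, Tm.ren_nsub] at this ⊢
      rwa [Tm.nsub_ren] at this

mutual
-- Hereditary substitution is given only as a graph, so existence of a result has to be proved where
-- it is used. With neutral values no redex appears and existence needs no typing. The extra
-- renaming covers the case where a fresh variable is instantiated in a weakened term.
theorem Tm.hsub_ren_nsub {e : ℕ → Tm} {ρ : ℕ → ℕ} {f : ℕ → Ne} (h : ∀ i, e (ρ i) = .neu (f i)) :
    ∀ M : Tm, Tm.HSub e (M.ren ρ) (M.nsub f)
  | .neu R => .neu (Ne.hsub_ren_nsub h R)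
  | .lam M => .lam (Tm.hsub_ren_nsub (fun i => by
      cases i with
      | zero => rfl
      | succ i => simp only [liftRen, liftEnv, liftN, h, Tm.ren]) M)
theorem Ne.hsub_ren_nsub {e : ℕ → Tm} {ρ : ℕ → ℕ} {f : ℕ → Ne} (h : ∀ i, e (ρ i) = .neu (f i)) :
    ∀ R : Ne, Ne.HSub e (R.ren ρ) (.neu (R.nsub f))
  | .var i => by simp only [Ne.nsub, ← h]; exact .var
  | .const _ => .const
  | .app R N => .app_neu (Ne.hsub_ren_nsub h R) (Tm.hsub_ren_nsub h N)
  | .mvar _ σ => .mvar (Sb.hsub_ren_nsub h σ)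
theorem Sb.hsub_ren_nsub {e : ℕ → Tm} {ρ : ℕ → ℕ} {f : ℕ → Ne} (h : ∀ i, e (ρ i) = .neu (f i)) :
    ∀ σ : Sb, Sb.HSub e (σ.ren ρ) (σ.nsub f)
  | .empty => .empty
  | .wk _ => .wk
  | .cons σ M => .cons (Sb.hsub_ren_nsub h σ) (Tm.hsub_ren_nsub h M)
end

theorem Ne.hsub_inst_shift (N : Tm) (R : Ne) :
    Ne.HSub (inst N) (R.ren Nat.succ) (.neu R) := by
  have := Ne.hsub_ren_nsub (e := inst N) (ρ := Nat.succ) (f := Ne.var) (fun _ => rfl) R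
  rwa [Ne.nsub_id] at this

theorem inst_nsub (N : Tm) (f : ℕ → Ne) (i : ℕ) :
    Ne.HSub (inst (N.nsub f)) (liftN f i) ((inst N i).nsub f) := by
  cases i with
  | zero => exact .var
  | succ i => exact Ne.hsub_inst_shift _ _

/-! Neutral substitution commutes with hereditary substitution. -/

mutual
-- The square closes when it closes on variables. A variable of the domain may itself be replaced by
-- the neutral term `g i`, so the hypothesis is again a hereditary substitution and not an equation.
theorem Tm.HSub.nsub {e e' : ℕ → Tm} {f g : ℕ → Ne} {M M₁ : Tm}
    (h : ∀ i, Ne.HSub e' (g i) ((e i).nsub f)) :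
    Tm.HSub e M M₁ → Tm.HSub e' (M.nsub g) (M₁.nsub f)
  | .neu hR => .neu (Ne.HSub.nsub h hR)
  | .lam hM => .lam (Tm.HSub.nsub (liftEnv_nsub h) hM)
theorem Ne.HSub.nsub {e e' : ℕ → Tm} {f g : ℕ → Ne} {R : Ne} {M₁ : Tm}
    (h : ∀ i, Ne.HSub e' (g i) ((e i).nsub f)) :
    Ne.HSub e R M₁ → Ne.HSub e' (R.nsub g) (M₁.nsub f)
  | .var => h _
  | .const => .const
  | .app_neu hR hN => .app_neu (Ne.HSub.nsub h hR) (Tm.HSub.nsub h hN)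
  | .app_lam hR hN hM =>
      .app_lam (Ne.HSub.nsub h hR) (Tm.HSub.nsub h hN) (Tm.HSub.nsub (inst_nsub _ _) hM)
  | .mvar hσ => .mvar (Sb.HSub.nsub h hσ)
theorem Sb.HSub.nsub {e e' : ℕ → Tm} {f g : ℕ → Ne} {σ σ₁ : Sb}
    (h : ∀ i, Ne.HSub e' (g i) ((e i).nsub f)) :
    Sb.HSub e σ σ₁ → Sb.HSub e' (σ.nsub g) (σ₁.nsub f)
  | .empty => .empty
  | .wk => .wk
  | .cons hσ hM => .cons (Sb.HSub.nsub h hσ) (Tm.HSub.nsub h hM)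
end

theorem Atom.HSub.nsub {e e' : ℕ → Tm} {f g : ℕ → Ne} {P P₁ : Atom}
    (h : ∀ i, Ne.HSub e' (g i) ((e i).nsub f)) :
    Atom.HSub e P P₁ → Atom.HSub e' (P.nsub g) (P₁.nsub f)
  | .mk hσ => .mk (hσ.nsub h)

theorem Ty.HSub.nsub {e e' : ℕ → Tm} {f g : ℕ → Ne} {A A₁ : Ty}
    (h : ∀ i, Ne.HSub e' (g i) ((e i).nsub f)) :
    Ty.HSub e A A₁ → Ty.HSub e' (A.nsub g) (A₁.nsub f)
  | .atom hP => .atom (hP.nsub h)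
  | .arr hA hB => .arr (Ty.HSub.nsub h hA) (Ty.HSub.nsub h hB)
  | .pi hA hB => .pi (Ty.HSub.nsub h hA) (Ty.HSub.nsub (liftEnv_nsub h) hB)

theorem env_nsub_hsub (σ : Sb) (f : ℕ → Ne) (i : ℕ) :
    Ne.HSub (σ.nsub f).env (.var i) ((σ.env i).nsub f) := by
  rw [← Sb.env_nsub]; exact .var

/-- `P` lives over the domain of `σ`, which `f` does not touch, so the source is replaced by itself
(`g` is `Ne.var`). -/
theorem Atom.HSub.nsub_env {σ : Sb} {P P₁ : Atom} (f : ℕ → Ne) (h : Atom.HSub σ.env P P₁) :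
    Atom.HSub (σ.nsub f).env P (P₁.nsub f) := by
  have := h.nsub (env_nsub_hsub σ f)
  simp only [Atom.nsub, Sb.nsub_id] at this ⊢
  exact this

theorem Ty.HSub.nsub_env {σ : Sb} {A A₁ : Ty} (f : ℕ → Ne) (h : Ty.HSub σ.env A A₁) :
    Ty.HSub (σ.nsub f).env A (A₁.nsub f) := by
  have := h.nsub (env_nsub_hsub σ f)
  rwa [Ty.nsub_id] at this

mutual
-- Neutral values never put a λ in head position, so `app_lam` cannot occur and the graph has only
-- one value.
theorem Tm.HSub.eq_nsub {e : ℕ → Tm} {f : ℕ → Ne} {M M₁ : Tm} (h : ∀ i, e i = .neu (f i)) :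
    Tm.HSub e M M₁ → M₁ = M.nsub f
  | .neu hR => Ne.HSub.eq_nsub h hR
  | .lam hM => congrArg Tm.lam (Tm.HSub.eq_nsub (fun i => by
      cases i with
      | zero => rfl
      | succ i => simp only [liftEnv, liftN, h, Tm.ren]) hM)
theorem Ne.HSub.eq_nsub {e : ℕ → Tm} {f : ℕ → Ne} {R : Ne} {M₁ : Tm} (h : ∀ i, e i = .neu (f i)) :
    Ne.HSub e R M₁ → M₁ = .neu (R.nsub f)
  | .var => h _
  | .const => rfl
  | .app_neu hR hN => by
      have h₁ := Ne.HSub.eq_nsub h hR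
      have h₂ := Tm.HSub.eq_nsub h hN
      simp only [Tm.neu.injEq] at h₁
      simp only [Ne.nsub, h₁, h₂]
  | .app_lam hR _ _ => by
      have h₁ := Ne.HSub.eq_nsub h hR
      simp at h₁
  | .mvar hσ => by simp only [Ne.nsub, Sb.HSub.eq_nsub h hσ]
theorem Sb.HSub.eq_nsub {e : ℕ → Tm} {f : ℕ → Ne} {σ σ₁ : Sb} (h : ∀ i, e i = .neu (f i)) :
    Sb.HSub e σ σ₁ → σ₁ = σ.nsub f
  | .empty => rfl
  | .wk => rfl
  | .cons hσ hM => by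
      simp only [Sb.nsub, Sb.HSub.eq_nsub h hσ, Tm.HSub.eq_nsub h hM]
end

theorem Tm.HSub.inst_neu {R : Ne} {M M₁ : Tm} (h : Tm.HSub (inst (.neu R)) M M₁) :
    M₁ = M.nsub (instN R) :=
  h.eq_nsub fun i => by cases i <;> rfl

/-! Hereditary substitution commutes with renaming of contextual variables. -/

theorem liftEnv_mren {e e' : ℕ → Tm} {m : ℕ → ℕ} (h : ∀ i, e' i = (e i).mren m) (i : ℕ) :
    liftEnv e' i = (liftEnv e i).mren m := by
  cases i with
  | zero => rfl
  | succ i => simp only [liftEnv, h, Tm.ren_mren]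

theorem inst_mren (N : Tm) (m : ℕ → ℕ) (i : ℕ) : inst (N.mren m) i = (inst N i).mren m := by
  cases i <;> rfl

mutual
theorem Tm.HSub.mren {e e' : ℕ → Tm} {m : ℕ → ℕ} {M M₁ : Tm}
    (h : ∀ i, e' i = (e i).mren m) : Tm.HSub e M M₁ → Tm.HSub e' (M.mren m) (M₁.mren m)
  | .neu hR => .neu (Ne.HSub.mren h hR)
  | .lam hM => .lam (Tm.HSub.mren (liftEnv_mren h) hM)
theorem Ne.HSub.mren {e e' : ℕ → Tm} {m : ℕ → ℕ} {R : Ne} {M₁ : Tm}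
    (h : ∀ i, e' i = (e i).mren m) : Ne.HSub e R M₁ → Ne.HSub e' (R.mren m) (M₁.mren m)
  | .var => by rw [← h]; exact .var
  | .const => .const
  | .app_neu hR hN => .app_neu (Ne.HSub.mren h hR) (Tm.HSub.mren h hN)
  | .app_lam hR hN hM =>
      .app_lam (Ne.HSub.mren h hR) (Tm.HSub.mren h hN) (Tm.HSub.mren (inst_mren _ _) hM)
  | .mvar hσ => .mvar (Sb.HSub.mren h hσ)
theorem Sb.HSub.mren {e e' : ℕ → Tm} {m : ℕ → ℕ} {σ σ₁ : Sb}
    (h : ∀ i, e' i = (e i).mren m) : Sb.HSub e σ σ₁ → Sb.HSub e' (σ.mren m) (σ₁.mren m)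
  | .empty => .empty
  | .wk => .wk
  | .cons hσ hM => .cons (Sb.HSub.mren h hσ) (Tm.HSub.mren h hM)
end

theorem Atom.HSub.mren {e e' : ℕ → Tm} {m : ℕ → ℕ} {P P₁ : Atom}
    (h : ∀ i, e' i = (e i).mren m) : Atom.HSub e P P₁ → Atom.HSub e' (P.mren m) (P₁.mren m)
  | .mk hσ => .mk (hσ.mren h)

theorem Ty.HSub.mren {e e' : ℕ → Tm} {m : ℕ → ℕ} {A A₁ : Ty}
    (h : ∀ i, e' i = (e i).mren m) : Ty.HSub e A A₁ → Ty.HSub e' (A.mren m) (A₁.mren m)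
  | .atom hP => .atom (hP.mren h)
  | .arr hA hB => .arr (Ty.HSub.mren h hA) (Ty.HSub.mren h hB)
  | .pi hA hB => .pi (Ty.HSub.mren h hA) (Ty.HSub.mren (liftEnv_mren h) hB)

/-! ## Simple types

The skeleton of a type forgets the dependencies. -/

inductive Sk : Type
  | o : Sk
  | arr : Sk → Sk → Sk

def Ty.sk : Ty → Sk
  | .atom _ => .o
  | .arr A B => .arr A.sk B.sk
  | .pi A B => .arr A.sk B.sk

theorem Ty.sk_ren (ρ : ℕ → ℕ) (A : Ty) : (A.ren ρ).sk = A.sk := by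
  induction A generalizing ρ with
  | atom P => rfl
  | arr A B ihA ihB => simp only [Ty.ren, Ty.sk, ihA, ihB]
  | pi A B ihA ihB => simp only [Ty.ren, Ty.sk, ihA, ihB]

theorem Ty.sk_shift (A : Ty) : A.shift.sk = A.sk := A.sk_ren _

theorem Ty.sk_mren (m : ℕ → ℕ) (A : Ty) : (A.mren m).sk = A.sk := by
  induction A with
  | atom P => rfl
  | arr A B ihA ihB => simp only [Ty.mren, Ty.sk, ihA, ihB]
  | pi A B ihA ihB => simp only [Ty.mren, Ty.sk, ihA, ihB]

/-- Substitution changes only the arguments of atoms, which skeletons drop. Inductions over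
dependent types can therefore run on the skeleton. -/
theorem Ty.HSub.sk {e : ℕ → Tm} {A A₁ : Ty} (h : Ty.HSub e A A₁) : A₁.sk = A.sk := by
  induction h with
  | atom _ => rfl
  | arr _ _ ihA ihB => simp only [Ty.sk, ihA, ihB]
  | pi _ _ ihA ihB => simp only [Ty.sk, ihA, ihB]

/-- η-expansion, guided by a skeleton. -/
def etaS : Sk → Ne → Tm
  | .o, R => .neu R
  | .arr a b, R => .lam (etaS b (.app (R.ren Nat.succ) (etaS a (.var 0))))

theorem eta_eq (A : Ty) (R : Ne) : eta A R = etaS A.sk R := by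
  induction A generalizing R with
  | atom P => rfl
  | arr A B ihA ihB => simp only [eta, Ty.sk, etaS, ihA, ihB]
  | pi A B ihA ihB => simp only [eta, Ty.sk, etaS, ihA, ihB]

theorem etaS_ren (s : Sk) (R : Ne) (ρ : ℕ → ℕ) : (etaS s R).ren ρ = etaS s (R.ren ρ) := by
  induction s generalizing R ρ with
  | o => rfl
  | arr a b iha ihb =>
      simp only [etaS, Tm.ren, ihb, Ne.ren, iha, Ne.ren_succ_liftRen, liftRen]

theorem etaS_mren (s : Sk) (R : Ne) (m : ℕ → ℕ) : (etaS s R).mren m = etaS s (R.mren m) := by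
  induction s generalizing R with
  | o => rfl
  | arr a b iha ihb => simp only [etaS, Tm.mren, ihb, Ne.mren, iha, Ne.ren_mren]

/-- Skeletons of LF contexts. -/
inductive SCtx : Type
  | nil : SCtx
  | cvar : ℕ → SCtx
  | snoc : SCtx → Sk → SCtx

def SCtx.get : SCtx → ℕ → Option Sk
  | .nil, _ => none
  | .cvar _, _ => none
  | .snoc _ s, 0 => some s
  | .snoc G _, i + 1 => G.get i

def SCtx.base : SCtx → Option ℕ
  | .nil => none
  | .cvar ψ => some ψ
  | .snoc G _ => G.base

def SCtx.mren (m : ℕ → ℕ) : SCtx → SCtx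
  | .nil => .nil
  | .cvar ψ => .cvar (m ψ)
  | .snoc G s => .snoc (G.mren m) s

def Ctx.sk : Ctx → SCtx
  | .nil => .nil
  | .cvar ψ => .cvar ψ
  | .snoc Ψ _ A => .snoc Ψ.sk A.sk

theorem SCtx.get_mren (m : ℕ → ℕ) : ∀ (G : SCtx) (i : ℕ), (G.mren m).get i = G.get i
  | .nil, _ => rfl
  | .cvar _, _ => rfl
  | .snoc _ _, 0 => rfl
  | .snoc G _, i + 1 => SCtx.get_mren m G i

theorem SCtx.base_mren (m : ℕ → ℕ) (G : SCtx) : (G.mren m).base = G.base.map m := by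
  induction G with
  | nil => rfl
  | cvar ψ => rfl
  | snoc G s ih => exact ih

theorem SCtx.mren_mren (m m' : ℕ → ℕ) (G : SCtx) :
    (G.mren m).mren m' = G.mren (fun i => m' (m i)) := by
  induction G with
  | nil => rfl
  | cvar ψ => rfl
  | snoc G s ih => simp only [SCtx.mren, ih]

theorem Ctx.sk_mren (m : ℕ → ℕ) (Ψ : Ctx) : (Ψ.mren m).sk = Ψ.sk.mren m := by
  induction Ψ with
  | nil => rfl
  | cvar ψ => rfl
  | snoc Ψ r A ih => simp only [Ctx.mren, Ctx.sk, ih, SCtx.mren, Ty.sk_mren]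

theorem Ctx.base_sk (Ψ : Ctx) : Ψ.sk.base = Ψ.base := by
  induction Ψ with
  | nil => rfl
  | cvar ψ => rfl
  | snoc Ψ r A ih => exact ih

theorem Ctx.Lookup.sk {Ψ : Ctx} {x : ℕ} {r : Role} {A : Ty} (h : Ψ.Lookup x r A) :
    Ψ.sk.get x = some A.sk := by
  induction h with
  | here => simp only [Ctx.sk, SCtx.get, Ty.sk_shift]
  | there _ ih => simp only [Ctx.sk, SCtx.get, ih, Ty.sk_shift]

/-- Skeletons of meta-types. -/
inductive MSk : Type
  | ctxt : SCtx → MSk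
  | schema : MSk

def MSk.mren (m : ℕ → ℕ) : MSk → MSk
  | .ctxt G => .ctxt (G.mren m)
  | .schema => .schema

theorem MSk.mren_mren (m m' : ℕ → ℕ) (U : MSk) :
    (U.mren m).mren m' = U.mren (fun i => m' (m i)) := by
  cases U <;> simp only [MSk.mren, SCtx.mren_mren]

/-- Skeletons of meta-contexts. -/
abbrev SMCtx : Type := ℕ → Option MSk

def SMCtx.cons (U : MSk) (D : SMCtx) : SMCtx
  | 0 => some (U.mren Nat.succ)
  | i + 1 => (D i).map (MSk.mren Nat.succ)

def MTy.sk : MTy → MSk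
  | .ctxt Ψ _ => .ctxt Ψ.sk
  | .schema _ => .schema

theorem MTy.sk_mren (m : ℕ → ℕ) (U : MTy) : (U.mren m).sk = U.sk.mren m := by
  cases U <;> simp only [MTy.mren, MTy.sk, MSk.mren, Ctx.sk_mren]

def MCtx.sk : MCtx → SMCtx
  | [] => fun _ => none
  | U :: Δ => SMCtx.cons U.sk (MCtx.sk Δ)

theorem MCtx.Lookup.sk {Δ : MCtx} {X : ℕ} {U : MTy} (h : MCtx.Lookup Δ X U) :
    MCtx.sk Δ X = some U.sk := by
  induction h with
  | here => simp only [MCtx.sk, SMCtx.cons, MTy.sk_mren]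
  | there _ ih => simp only [MCtx.sk, SMCtx.cons, ih, MTy.sk_mren, Option.map_some]

/-! Simple typing of canonical terms. Constants may have any skeleton. -/

mutual
inductive STm (D : SMCtx) : SCtx → Tm → Sk → Prop
  | neu {G : SCtx} {R : Ne} : SNe D G R .o → STm D G (.neu R) .o
  | lam {G : SCtx} {M : Tm} {a b : Sk} : STm D (.snoc G a) M b → STm D G (.lam M) (.arr a b)
inductive SNe (D : SMCtx) : SCtx → Ne → Sk → Prop
  | var {G : SCtx} {i : ℕ} {s : Sk} : G.get i = some s → SNe D G (.var i) s
  | const {G : SCtx} {c : ℕ} {s : Sk} : SNe D G (.const c) s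
  | app {G : SCtx} {R : Ne} {N : Tm} {a b : Sk} :
      SNe D G R (.arr a b) → STm D G N a → SNe D G (.app R N) b
  | mvar {G K : SCtx} {u : ℕ} {σ : Sb} :
      D u = some (.ctxt K) → SSb D G σ K → SNe D G (.mvar u σ) .o
inductive SSb (D : SMCtx) : SCtx → Sb → SCtx → Prop
  | empty {G : SCtx} : SSb D G .empty .nil
  -- `SMSub` and `MId` need to know that `ψ` is declared as a schema variable when a
  -- meta-substitution reaches `wk_ψ`.
  | wk {G : SCtx} {ψ : ℕ} : G.base = some ψ → D ψ = some .schema → SSb D G (.wk ψ) (.cvar ψ)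
  | cons {G K : SCtx} {σ : Sb} {M : Tm} {s : Sk} :
      SSb D G σ K → STm D G M s → SSb D G (.cons σ M) (.snoc K s)
end

theorem SSb.get {D : SMCtx} {G K : SCtx} {σ : Sb} (h : SSb D G σ K) {i : ℕ} {s : Sk}
    (hi : K.get i = some s) : STm D G (σ.env i) s := by
  induction K generalizing σ i with
  | nil => simp [SCtx.get] at hi
  | cvar ψ => simp [SCtx.get] at hi
  | snoc K s' ih =>
      cases h with
      | cons hσ hM =>
        cases i with
        | zero => simp only [SCtx.get, Option.some.injEq] at hi; subst hi; exact hM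
        | succ i => exact ih hσ hi

theorem SSb.base {D : SMCtx} {G K : SCtx} {σ : Sb} (h : SSb D G σ K) {ψ : ℕ}
    (hi : K.base = some ψ) : G.base = some ψ := by
  induction K generalizing σ with
  | nil => simp [SCtx.base] at hi
  | cvar ψ =>
      cases h with
      | wk hb => simp only [SCtx.base, Option.some.injEq] at hi; subst hi; exact hb
  | snoc K s' ih =>
      cases h with
      | cons hσ hM => exact ih hσ hi

theorem SCtx.get_snoc_ren {G G' : SCtx} {ρ : ℕ → ℕ} {a : Sk}
    (h : ∀ i s, G.get i = some s → G'.get (ρ i) = some s) (i : ℕ) (s : Sk)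
    (hi : (G.snoc a).get i = some s) : (G'.snoc a).get (liftRen ρ i) = some s := by
  cases i with
  | zero => exact hi
  | succ i => exact h i s hi

mutual
theorem STm.ren {D : SMCtx} {G G' : SCtx} {M : Tm} {s : Sk} {ρ : ℕ → ℕ}
    (h : ∀ i s, G.get i = some s → G'.get (ρ i) = some s)
    (hb : ∀ ψ, G.base = some ψ → G'.base = some ψ) : STm D G M s → STm D G' (M.ren ρ) s
  | .neu hR => .neu (SNe.ren h hb hR)
  | .lam hM => .lam (STm.ren (SCtx.get_snoc_ren h) hb hM)
theorem SNe.ren {D : SMCtx} {G G' : SCtx} {R : Ne} {s : Sk} {ρ : ℕ → ℕ}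
    (h : ∀ i s, G.get i = some s → G'.get (ρ i) = some s)
    (hb : ∀ ψ, G.base = some ψ → G'.base = some ψ) : SNe D G R s → SNe D G' (R.ren ρ) s
  | .var hi => .var (h _ _ hi)
  | .const => .const
  | .app hR hN => .app (SNe.ren h hb hR) (STm.ren h hb hN)
  | .mvar hu hσ => .mvar hu (SSb.ren h hb hσ)
theorem SSb.ren {D : SMCtx} {G G' K : SCtx} {σ : Sb} {ρ : ℕ → ℕ}
    (h : ∀ i s, G.get i = some s → G'.get (ρ i) = some s)
    (hb : ∀ ψ, G.base = some ψ → G'.base = some ψ) : SSb D G σ K → SSb D G' (σ.ren ρ) K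
  | .empty => .empty
  | .wk hψ hD => .wk (hb _ hψ) hD
  | .cons hσ hM => .cons (SSb.ren h hb hσ) (STm.ren h hb hM)
end

/-- `m` maps the declarations of `D` to declarations of `D'`. -/
def SMCtx.Ren (m : ℕ → ℕ) (D D' : SMCtx) : Prop :=
  ∀ u U, D u = some U → D' (m u) = some (U.mren m)

mutual
theorem STm.mren {D D' : SMCtx} {G : SCtx} {M : Tm} {s : Sk} {m : ℕ → ℕ}
    (h : SMCtx.Ren m D D') : STm D G M s → STm D' (G.mren m) (M.mren m) s
  | .neu hR => .neu (SNe.mren h hR)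
  | .lam hM => .lam (STm.mren h hM)
theorem SNe.mren {D D' : SMCtx} {G : SCtx} {R : Ne} {s : Sk} {m : ℕ → ℕ}
    (h : SMCtx.Ren m D D') : SNe D G R s → SNe D' (G.mren m) (R.mren m) s
  | .var hi => .var (by rw [SCtx.get_mren, hi])
  | .const => .const
  | .app hR hN => .app (SNe.mren h hR) (STm.mren h hN)
  | .mvar hu hσ => .mvar (h _ _ hu) (SSb.mren h hσ)
theorem SSb.mren {D D' : SMCtx} {G K : SCtx} {σ : Sb} {m : ℕ → ℕ}
    (h : SMCtx.Ren m D D') : SSb D G σ K → SSb D' (G.mren m) (σ.mren m) (K.mren m)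
  | .empty => .empty
  | .wk hψ hD => .wk (by rw [SCtx.base_mren, hψ]; rfl) (h _ _ hD)
  | .cons hσ hM => .cons (SSb.mren h hσ) (STm.mren h hM)
end

-- Hereditary substitution preserves simple typing.

/-- `M` has skeleton `s`, or is a neutral term of skeleton `s` that need not be η-long. -/
def SOk (D : SMCtx) (G : SCtx) (M : Tm) (s : Sk) : Prop :=
  STm D G M s ∨ ∃ R, M = .neu R ∧ SNe D G R s

theorem SOk.tm {D : SMCtx} {G : SCtx} {M : Tm} (h : SOk D G M .o) : STm D G M .o := by
  rcases h with h | ⟨R, rfl, h⟩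
  · exact h
  · exact .neu h

theorem SOk.ne {D : SMCtx} {G : SCtx} {R : Ne} {s : Sk} (h : SOk D G (.neu R) s) :
    SNe D G R s := by
  rcases h with h | ⟨R, h', h⟩
  · cases h; assumption
  · cases h'; exact h

theorem SOk.lam {D : SMCtx} {G : SCtx} {M : Tm} {a b : Sk} (h : SOk D G (.lam M) (.arr a b)) :
    STm D (G.snoc a) M b := by
  rcases h with h | ⟨R, h', h⟩
  · cases h; assumption
  · cases h'

theorem SOk.inst {D : SMCtx} {G : SCtx} {N : Tm} {a : Sk} (h : SOk D G N a) (i : ℕ) (s : Sk)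
    (hi : (G.snoc a).get i = some s) : SOk D G (inst N i) s := by
  cases i with
  | zero => simp only [SCtx.get, Option.some.injEq] at hi; subst hi; exact h
  | succ i => exact .inr ⟨_, rfl, .var hi⟩

theorem SOk.lift {D : SMCtx} {G G' : SCtx} {e : ℕ → Tm}
    (h : ∀ i s, G.get i = some s → SOk D G' (e i) s) (a : Sk) (i : ℕ) (s : Sk)
    (hi : (G.snoc a).get i = some s) : SOk D (G'.snoc a) (liftEnv e i) s := by
  cases i with
  | zero => exact .inr ⟨_, rfl, .var hi⟩
  | succ i =>
      rcases h i s hi with h | ⟨R, h', h⟩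
      · exact .inl (h.ren (fun _ _ h => h) fun _ h => h)
      · exact .inr ⟨R.ren Nat.succ, by simp only [liftEnv, h', Tm.ren],
          h.ren (fun _ _ h => h) fun _ h => h⟩

mutual
-- `inst` and `liftEnv` send variables to bare variables, which are not η-long at arrow skeletons;
-- this is why the environment is only required to satisfy `SOk`. A neutral term used as a normal
-- term has skeleton `o`, and there `SOk` gives back `STm`.
theorem STm.hsub {D : SMCtx} {G G' : SCtx} {e : ℕ → Tm} {M M₁ : Tm} {s : Sk}
    (h : ∀ i s, G.get i = some s → SOk D G' (e i) s)
    (hb : ∀ ψ, G.base = some ψ → G'.base = some ψ) :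
    Tm.HSub e M M₁ → STm D G M s → STm D G' M₁ s
  | .neu hR, .neu hs => (SNe.hsub h hb hR hs).tm
  | .lam hM, .lam hs => .lam (STm.hsub (SOk.lift h _) hb hM hs)
theorem SNe.hsub {D : SMCtx} {G G' : SCtx} {e : ℕ → Tm} {R : Ne} {M₁ : Tm} {s : Sk}
    (h : ∀ i s, G.get i = some s → SOk D G' (e i) s)
    (hb : ∀ ψ, G.base = some ψ → G'.base = some ψ) :
    Ne.HSub e R M₁ → SNe D G R s → SOk D G' M₁ s
  | .var, .var hi => h _ _ hi
  | .const, .const => .inr ⟨_, rfl, .const⟩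
  | .app_neu hR hN, .app hsR hsN =>
      .inr ⟨_, rfl, .app (SNe.hsub h hb hR hsR).ne (STm.hsub h hb hN hsN)⟩
  | .app_lam hR hN hM, .app hsR hsN =>
      .inl (STm.hsub (SOk.inst (.inl (STm.hsub h hb hN hsN))) (fun _ h => h) hM
        (SNe.hsub h hb hR hsR).lam)
  | .mvar hσ, .mvar hu hs => .inr ⟨_, rfl, .mvar hu (SSb.hsub h hb hσ hs)⟩
theorem SSb.hsub {D : SMCtx} {G G' K : SCtx} {e : ℕ → Tm} {σ σ₁ : Sb}
    (h : ∀ i s, G.get i = some s → SOk D G' (e i) s)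
    (hb : ∀ ψ, G.base = some ψ → G'.base = some ψ) :
    Sb.HSub e σ σ₁ → SSb D G σ K → SSb D G' σ₁ K
  | .empty, .empty => .empty
  | .wk, .wk hψ hD => .wk (hb _ hψ) hD
  | .cons hσ hM, .cons hsσ hsM => .cons (SSb.hsub h hb hσ hsσ) (STm.hsub h hb hM hsM)
end

/-! ## The identity property of hereditary substitution -/

/-- As long as the head stays neutral, η-expansion commutes with substitution: the variables it
binds are mapped to themselves. -/
theorem Tm.hsub_etaS_neu (s : Sk) {e : ℕ → Tm} {R R₁ : Ne} (h : Ne.HSub e R (.neu R₁)) :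
    Tm.HSub e (etaS s R) (etaS s R₁) := by
  induction s generalizing e R R₁ with
  | o => exact .neu h
  | arr a b iha ihb => exact .lam (ihb (.app_neu h.shift (iha .var)))

def Sk.size : Sk → ℕ
  | .o => 0
  | .arr a b => a.size + b.size + 1

/-- Substituting a canonical term of skeleton `s` for the head of `etaS s` gives that term. -/
def EtaCancels (s : Sk) : Prop :=
  ∀ (D : SMCtx) (G : SCtx) (e : ℕ → Tm) (R : Ne) (M : Tm),
    Ne.HSub e R M → STm D G M s → Tm.HSub e (etaS s R) M

/-- `e` undoes `ρ` on the variables of `G`, up to η-expansion at skeletons of size at most `n`. -/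
def IdEnv (n : ℕ) (G : SCtx) (ρ : ℕ → ℕ) (e : ℕ → Tm) : Prop :=
  ∀ i a, G.get i = some a →
    e (ρ i) = .neu (.var i) ∨ (e (ρ i) = etaS a (.var i) ∧ a.size ≤ n)

theorem IdEnv.lift {n : ℕ} {G : SCtx} {ρ : ℕ → ℕ} {e : ℕ → Tm} (h : IdEnv n G ρ e) (a : Sk) :
    IdEnv n (G.snoc a) (liftRen ρ) (liftEnv e) := by
  intro i s hi
  cases i with
  | zero => exact .inl rfl
  | succ i =>
      rcases h i s hi with h | ⟨h, hs⟩
      · exact .inl (by simp only [liftRen, liftEnv, h, Tm.ren, Ne.ren])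
      · exact .inr ⟨by simp only [liftRen, liftEnv, h, etaS_ren, Ne.ren], hs⟩

mutual
-- The identity property at η-expansions of size at most `n`, given cancellation strictly below `n`.
-- A neutral term either comes back as itself or as its η-expansion; the size bound in the second
-- case decreases along the spine.
theorem STm.hsub_id_of {n : ℕ} (hB : ∀ s : Sk, s.size < n → EtaCancels s)
    {D : SMCtx} {G : SCtx} {ρ : ℕ → ℕ} {e : ℕ → Tm} {M : Tm} {s : Sk} (h : IdEnv n G ρ e) :
    STm D G M s → Tm.HSub e (M.ren ρ) M
  | .neu hR => by
      rcases SNe.hsub_id_of hB h hR with h | ⟨h, _⟩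
      · exact .neu h
      · exact .neu h
  | .lam hM => .lam (STm.hsub_id_of hB (h.lift _) hM)
theorem SNe.hsub_id_of {n : ℕ} (hB : ∀ s : Sk, s.size < n → EtaCancels s)
    {D : SMCtx} {G : SCtx} {ρ : ℕ → ℕ} {e : ℕ → Tm} {R : Ne} {s : Sk} (h : IdEnv n G ρ e) :
    SNe D G R s →
      Ne.HSub e (R.ren ρ) (.neu R) ∨ (Ne.HSub e (R.ren ρ) (etaS s R) ∧ s.size ≤ n)
  | .var hi => by
      rcases h _ _ hi with h | ⟨h, hs⟩
      · exact .inl (h ▸ .var)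
      · exact .inr ⟨h ▸ .var, hs⟩
  | .const => .inl .const
  | .app (a := a) (b := b) hR hN => by
      have hN' := STm.hsub_id_of hB h hN
      rcases SNe.hsub_id_of hB h hR with hR' | ⟨hR', hs⟩
      · exact .inl (.app_neu hR' hN')
      · simp only [Sk.size] at hs
        -- The head became λx. η(R η(x)). Contracting it against `N` requires [N/x]η(x) = N at the
        -- argument skeleton `a`, which is smaller than `n`.
        refine .inr ⟨.app_lam hR' hN' (Tm.hsub_etaS_neu b (.app_neu (Ne.hsub_inst_shift _ _) ?_)),
          by omega⟩
        exact hB a (by omega) _ _ _ _ _ .var hN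
  | .mvar _ hσ => .inl (.mvar (SSb.hsub_id_of hB h hσ))
theorem SSb.hsub_id_of {n : ℕ} (hB : ∀ s : Sk, s.size < n → EtaCancels s)
    {D : SMCtx} {G K : SCtx} {ρ : ℕ → ℕ} {e : ℕ → Tm} {σ : Sb} (h : IdEnv n G ρ e) :
    SSb D G σ K → Sb.HSub e (σ.ren ρ) σ
  | .empty => .empty
  | .wk _ _ => .wk
  | .cons hσ hM => .cons (SSb.hsub_id_of hB h hσ) (STm.hsub_id_of hB h hM)
end

/-- Strong induction on size. At `arr a b` the expanded head applied to η(x) contracts to the body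
of the λ with η(x) for x. This is the identity property at `a`, which uses cancellation below `a`;
cancellation at `b` then finishes. -/
theorem etaCancels (s : Sk) : EtaCancels s := by
  induction hn : s.size using Nat.strong_induction_on generalizing s with
  | _ n ih =>
  subst hn
  intro D G e R M hR hM
  cases s with
  | o => exact .neu hR
  | arr a b =>
      cases hM with
      | lam hM =>
      simp only [Sk.size] at ih
      refine .lam (ih b.size (by omega) b rfl D _ _ _ _
        (.app_lam hR.shift (Tm.hsub_etaS_neu a .var) ?_) hM)
      -- Only variable 0 is η-expanded, at skeleton `a`; all others are replaced by themselves, so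
      -- `a.size` bounds the environment.
      refine STm.hsub_id_of (n := a.size) (fun s hs => ih s.size (by omega) s rfl) ?_ hM
      intro i s hi
      cases i with
      | zero =>
          simp only [SCtx.get, Option.some.injEq] at hi
          subst hi
          exact .inr ⟨rfl, le_rfl⟩
      | succ i => exact .inl rfl

/-- `e` undoes `ρ` on the variables of `G`, up to η-expansion. -/
def EtaEnv (G : SCtx) (ρ : ℕ → ℕ) (e : ℕ → Tm) : Prop :=
  ∀ i a, G.get i = some a → e (ρ i) = .neu (.var i) ∨ e (ρ i) = etaS a (.var i)

def SCtx.maxSize : SCtx → ℕ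
  | .nil => 0
  | .cvar _ => 0
  | .snoc G s => max G.maxSize s.size

theorem SCtx.size_le_maxSize : ∀ {G : SCtx} {i : ℕ} {s : Sk}, G.get i = some s → s.size ≤ G.maxSize
  | .snoc G s', 0, s, h => by
      simp only [SCtx.get, Option.some.injEq] at h
      subst h
      exact le_max_right _ _
  | .snoc G s', i + 1, s, h => (SCtx.size_le_maxSize (G := G) h).trans (le_max_left _ _)

/-- A context declares finitely many variables, so a size bound always exists. -/
theorem EtaEnv.idEnv {G : SCtx} {ρ : ℕ → ℕ} {e : ℕ → Tm} (h : EtaEnv G ρ e) :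
    IdEnv G.maxSize G ρ e := fun i a hi =>
  (h i a hi).imp id fun h => ⟨h, SCtx.size_le_maxSize hi⟩

theorem EtaEnv.lift {G : SCtx} {ρ : ℕ → ℕ} {e : ℕ → Tm} (h : EtaEnv G ρ e) (a : Sk) :
    EtaEnv (G.snoc a) (liftRen ρ) (liftEnv e) := fun i s hi =>
  (h.idEnv.lift a i s hi).imp id And.left

theorem SSb.hsub_id {D : SMCtx} {G K : SCtx} {ρ : ℕ → ℕ} {e : ℕ → Tm} {σ : Sb}
    (h : EtaEnv G ρ e) (hσ : SSb D G σ K) : Sb.HSub e (σ.ren ρ) σ :=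
  hσ.hsub_id_of (fun s _ => etaCancels s) h.idEnv

/-! ## Simply typed types and contexts -/

inductive STy (D : SMCtx) : SCtx → Ty → Prop
  | atom {G K : SCtx} {P : Atom} : SSb D G P.args K → STy D G (.atom P)
  | arr {G : SCtx} {A B : Ty} : STy D G A → STy D G B → STy D G (.arr A B)
  | pi {G : SCtx} {A B : Ty} : STy D G A → STy D (G.snoc A.sk) B → STy D G (.pi A B)

/-- Used with a lifted successor for [η(x)/x] on a weakened type, and with the identity renaming for
the identity substitution of a context. -/
theorem STy.hsub_id {D : SMCtx} {G : SCtx} {ρ : ℕ → ℕ} {e : ℕ → Tm} {A : Ty}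
    (h : EtaEnv G ρ e) (hA : STy D G A) : Ty.HSub e (A.ren ρ) A := by
  induction hA generalizing ρ e with
  | atom hσ => exact .atom (.mk (hσ.hsub_id h))
  | arr _ _ ihA ihB => exact .arr (ihA h) (ihB h)
  | pi _ _ ihA ihB => exact .pi (ihA h) (ihB (h.lift _))

theorem STy.ren {D : SMCtx} {G G' : SCtx} {A : Ty} {ρ : ℕ → ℕ}
    (h : ∀ i s, G.get i = some s → G'.get (ρ i) = some s)
    (hb : ∀ ψ, G.base = some ψ → G'.base = some ψ) (hA : STy D G A) : STy D G' (A.ren ρ) := by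
  induction hA generalizing G' ρ with
  | atom hσ => exact .atom (hσ.ren h hb)
  | arr _ _ ihA ihB => exact .arr (ihA h hb) (ihB h hb)
  | pi _ _ ihA ihB =>
      refine .pi (ihA h hb) (ihB ?_ hb)
      rw [Ty.sk_ren]
      exact SCtx.get_snoc_ren h

theorem STy.shift {D : SMCtx} {G : SCtx} {A : Ty} (hA : STy D G A) (s : Sk) :
    STy D (G.snoc s) A.shift :=
  hA.ren (fun _ _ h => h) fun _ h => h

theorem STy.mren {D D' : SMCtx} {G : SCtx} {A : Ty} {m : ℕ → ℕ}
    (h : SMCtx.Ren m D D') (hA : STy D G A) : STy D' (G.mren m) (A.mren m) := by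
  induction hA with
  | atom hσ => exact .atom (hσ.mren h)
  | arr _ _ ihA ihB => exact .arr ihA ihB
  | @pi _ A _ _ _ ihA ihB =>
      refine .pi ihA ?_
      rw [Ty.sk_mren]
      exact ihB

theorem STy.hsub {D : SMCtx} {G G' : SCtx} {e : ℕ → Tm} {A A₁ : Ty}
    (h : ∀ i s, G.get i = some s → SOk D G' (e i) s)
    (hb : ∀ ψ, G.base = some ψ → G'.base = some ψ)
    (hs : Ty.HSub e A A₁) (hA : STy D G A) : STy D G' A₁ := by
  induction hs generalizing G G' with
  | atom hP =>
      cases hP with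
      | mk hσ => cases hA with | atom hA => exact .atom (hA.hsub h hb hσ)
  | arr _ _ ihA ihB => cases hA with | arr hA hB => exact .arr (ihA h hb hA) (ihB h hb hB)
  | @pi _ A A₁ _ _ hsA _ ihA ihB =>
      cases hA with
      | pi hA hB =>
        refine .pi (ihA h hb hA) (ihB (G := G.snoc A.sk) (G' := G'.snoc A₁.sk) ?_ hb hB)
        rw [hsA.sk]
        exact SOk.lift h _

theorem SSb.ok {D : SMCtx} {G K : SCtx} {σ : Sb} (h : SSb D G σ K) (i : ℕ) (s : Sk)
    (hi : K.get i = some s) : SOk D G (σ.env i) s :=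
  .inl (h.get hi)

theorem STy.hsub_env {D : SMCtx} {G K : SCtx} {σ : Sb} {A A₁ : Ty} (hσ : SSb D G σ K)
    (hs : Ty.HSub σ.env A A₁) (hA : STy D K A) : STy D G A₁ :=
  hA.hsub hσ.ok (fun _ => hσ.base) hs

theorem STy.hsub_inst {D : SMCtx} {G : SCtx} {N : Tm} {a : Sk} {B B₁ : Ty} (hN : STm D G N a)
    (hs : Ty.HSub (inst N) B B₁) (hB : STy D (G.snoc a) B) : STy D G B₁ :=
  hB.hsub (SOk.inst (.inl hN)) (fun _ h => h) hs

inductive SCtxOk (D : SMCtx) : Ctx → Prop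
  | nil : SCtxOk D .nil
  | cvar {ψ : ℕ} : D ψ = some .schema → SCtxOk D (.cvar ψ)
  | snoc {Ψ : Ctx} {r : Role} {A : Ty} :
      SCtxOk D Ψ → STy D Ψ.sk A → SCtxOk D (.snoc Ψ r A)

/-- The context variable of `Ψ` is declared in `D`. -/
def BaseOk (D : SMCtx) (Ψ : Ctx) : Prop := ∀ ψ, Ψ.base = some ψ → D ψ = some .schema

theorem SCtxOk.baseOk {D : SMCtx} {Ψ : Ctx} (h : SCtxOk D Ψ) : BaseOk D Ψ := by
  induction h with
  | nil => intro ψ h; cases h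
  | cvar hD => intro ψ h; cases h; exact hD
  | snoc _ _ ih => exact ih

theorem SCtxOk.lookup {D : SMCtx} {Ψ : Ctx} (h : SCtxOk D Ψ) {x : ℕ} {r : Role} {A : Ty}
    (hx : Ψ.Lookup x r A) : STy D Ψ.sk A := by
  induction hx with
  | here => cases h with | snoc _ hA => exact hA.shift _
  | there _ ih => cases h with | snoc hΨ _ => exact (ih hΨ).shift _

theorem SCtxOk.mren {D D' : SMCtx} {Ψ : Ctx} {m : ℕ → ℕ}
    (h : SMCtx.Ren m D D') (hΨ : SCtxOk D Ψ) : SCtxOk D' (Ψ.mren m) := by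
  induction hΨ with
  | nil => exact .nil
  | cvar hD => exact .cvar (h _ _ hD)
  | snoc _ hA ih => exact .snoc ih (by rw [Ctx.sk_mren]; exact hA.mren h)

inductive SMTyOk (D : SMCtx) : MTy → Prop
  | ctxt {Ψ : Ctx} {P : Atom} : SCtxOk D Ψ → STy D Ψ.sk (.atom P) → SMTyOk D (.ctxt Ψ P)
  | schema {G : Schema} :
      (∀ Φ A, G.Mem Φ A → SCtxOk D Φ ∧ STy D Φ.sk A) → SMTyOk D (.schema G)

theorem Schema.Mem.of_mren {G : Schema} {m : ℕ → ℕ} {Φ : Ctx} {A : Ty} (h : (G.mren m).Mem Φ A) :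
    ∃ Φ₀ A₀, G.Mem Φ₀ A₀ ∧ Φ = Φ₀.mren m ∧ A = A₀.mren m := by
  induction G with
  | elem Φ₀ A₀ => cases h; exact ⟨_, _, .elem, rfl, rfl⟩
  | plus G Φ₀ A₀ ih =>
      cases h with
      | last => exact ⟨_, _, .last, rfl, rfl⟩
      | prev h =>
        obtain ⟨Φ', A', h, h₁, h₂⟩ := ih h
        exact ⟨Φ', A', .prev h, h₁, h₂⟩

theorem Schema.Mem.mren {G : Schema} {Φ : Ctx} {A : Ty} (m : ℕ → ℕ) (h : G.Mem Φ A) :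
    (G.mren m).Mem (Φ.mren m) (A.mren m) := by
  induction h with
  | elem => exact .elem
  | last => exact .last
  | prev _ ih => exact .prev ih

theorem SMTyOk.mren {D D' : SMCtx} {U : MTy} {m : ℕ → ℕ}
    (h : SMCtx.Ren m D D') (hU : SMTyOk D U) : SMTyOk D' (U.mren m) := by
  cases hU with
  | ctxt hΨ hP =>
      refine .ctxt (hΨ.mren h) ?_
      rw [Ctx.sk_mren]
      exact hP.mren h
  | schema hG =>
      refine .schema fun Φ A hA => ?_
      obtain ⟨Φ₀, A₀, h₀, rfl, rfl⟩ := hA.of_mren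
      refine ⟨(hG Φ₀ A₀ h₀).1.mren h, ?_⟩
      rw [Ctx.sk_mren]
      exact (hG Φ₀ A₀ h₀).2.mren h

theorem MSk.mren_liftRen (m : ℕ → ℕ) (U : MSk) :
    (U.mren Nat.succ).mren (liftRen m) = (U.mren m).mren Nat.succ := by
  simp only [MSk.mren_mren, liftRen, Nat.succ_eq_add_one]

theorem SMCtx.Ren.cons {m : ℕ → ℕ} {D D' : SMCtx} (h : SMCtx.Ren m D D') (U : MSk) :
    SMCtx.Ren (liftRen m) (D.cons U) (D'.cons (U.mren m)) := by
  intro u V hu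
  cases u with
  | zero =>
      simp only [SMCtx.cons, Option.some.injEq] at hu
      subst hu
      simp only [liftRen, SMCtx.cons, MSk.mren_liftRen]
  | succ u =>
      simp only [SMCtx.cons, Option.map_eq_some_iff] at hu
      obtain ⟨V, hV, rfl⟩ := hu
      simp only [liftRen, SMCtx.cons, h u V hV, Option.map_some, MSk.mren_liftRen]

theorem SMCtx.Ren.succ (D : SMCtx) (U : MSk) : SMCtx.Ren Nat.succ D (D.cons U) := by
  intro u V hu
  simp only [SMCtx.cons, hu, Option.map_some]

inductive SCTyOk : SMCtx → CTy → Prop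
  | box {D : SMCtx} {Ψ : Ctx} {P : Atom} :
      SCtxOk D Ψ → STy D Ψ.sk (.atom P) → SCTyOk D (.box Ψ P)
  | arr {D : SMCtx} {τ₁ τ₂ : CTy} : SCTyOk D τ₁ → SCTyOk D τ₂ → SCTyOk D (.arr τ₁ τ₂)
  | pi {D : SMCtx} {U : MTy} {τ : CTy} :
      SMTyOk D U → SCTyOk (D.cons U.sk) τ → SCTyOk D (.pi U τ)

theorem SCTyOk.mren {D D' : SMCtx} {τ : CTy} {m : ℕ → ℕ}
    (h : SMCtx.Ren m D D') (hτ : SCTyOk D τ) : SCTyOk D' (τ.mren m) := by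
  induction hτ generalizing D' m with
  | box hΨ hP =>
      refine .box (hΨ.mren h) ?_
      rw [Ctx.sk_mren]
      exact hP.mren h
  | arr _ _ ih₁ ih₂ => exact .arr (ih₁ h) (ih₂ h)
  | @pi D U τ hU _ ih =>
      refine .pi (hU.mren h) (ih ?_)
      rw [MTy.sk_mren]
      exact h.cons _

/-! Well-formed objects are simply typed. -/

mutual
theorem TmChk.sk {S : Sig} {Δ : MCtx} {Ψ : Ctx} {M : Tm} {A : Ty} (hb : BaseOk (MCtx.sk Δ) Ψ) :
    TmChk S Δ Ψ M A → STm (MCtx.sk Δ) Ψ.sk M A.sk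
  | .neu hR => .neu (NeSyn.sk hb hR)
  | .lam_arr (B := B) hM => .lam (B.sk_shift ▸ TmChk.sk (Ψ := .snoc _ _ _) hb hM)
  | .lam_pi hM => .lam (TmChk.sk (Ψ := .snoc _ _ _) hb hM)
theorem NeSyn.sk {S : Sig} {Δ : MCtx} {Ψ : Ctx} {R : Ne} {A : Ty} (hb : BaseOk (MCtx.sk Δ) Ψ) :
    NeSyn S Δ Ψ R A → SNe (MCtx.sk Δ) Ψ.sk R A.sk
  | .var hx => .var hx.sk
  | .const _ => .const
  | .app_arr hR hN => .app (NeSyn.sk hb hR) (TmChk.sk hb hN)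
  | .app_pi hR hN hB => .app (hB.sk ▸ NeSyn.sk hb hR) (TmChk.sk hb hN)
  | .mvar hu hσ _ => .mvar hu.sk (SbChk.sk hb hσ)
theorem SbChk.sk {S : Sig} {Δ : MCtx} {Ψ Φ : Ctx} {σ : Sb} (hb : BaseOk (MCtx.sk Δ) Ψ) :
    SbChk S Δ Ψ σ Φ → SSb (MCtx.sk Δ) Ψ.sk σ Φ.sk
  | .empty => .empty
  | .wk hψ => .wk (by rw [Ctx.base_sk, hψ]) (hb _ hψ)
  | .cons hσ hB hM => .cons (SbChk.sk hb hσ) (hB.sk ▸ TmChk.sk hb hM)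
end

theorem TyWf.sk {S : Sig} {Δ : MCtx} {Ψ : Ctx} {A : Ty} (hb : BaseOk (MCtx.sk Δ) Ψ)
    (hA : TyWf S Δ Ψ A) : STy (MCtx.sk Δ) Ψ.sk A := by
  induction hA with
  | atom _ hσ => exact .atom (hσ.sk hb)
  | arr _ _ ihA ihB => exact .arr (ihA hb) (ihB hb)
  | pi _ _ ihA ihB => exact .pi (ihA hb) (ihB hb)

theorem CtxWf.sk {S : Sig} {Δ : MCtx} {Ψ : Ctx} (h : CtxWf S Δ Ψ) : SCtxOk (MCtx.sk Δ) Ψ := by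
  induction h with
  | nil => exact .nil
  | cvar hψ => exact .cvar hψ.sk
  | snoc _ hA ih => exact .snoc ih (hA.sk ih.baseOk)

theorem MTyWf.sk {S : Sig} {Δ : MCtx} {U : MTy} (h : MTyWf S Δ U) : SMTyOk (MCtx.sk Δ) U := by
  cases h with
  | ctxt hΨ hP => exact .ctxt hΨ.sk (hP.sk hΨ.sk.baseOk)
  | schema hG =>
      refine .schema fun Φ A h => ?_
      obtain ⟨_, hΦ, hA⟩ := hG Φ A h
      exact ⟨hΦ.sk, hA.sk hΦ.sk.baseOk⟩

theorem CTyWf.sk {S : Sig} {Δ : MCtx} {τ : CTy} (h : CTyWf S Δ τ) : SCTyOk (MCtx.sk Δ) τ := by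
  induction h with
  | box hΨ hP => exact .box hΨ.sk (hP.sk hΨ.sk.baseOk)
  | arr _ _ ih₁ ih₂ => exact .arr ih₁ ih₂
  | pi hU _ ih => exact .pi hU.sk ih

/-- All declarations of `Δ` are simply typed. -/
def SMCtxOk (Δ : MCtx) : Prop := ∀ X U, MCtx.Lookup Δ X U → SMTyOk (MCtx.sk Δ) U

theorem SMCtxOk.cons {Δ : MCtx} {U : MTy} (h : SMCtxOk Δ) (hU : SMTyOk (MCtx.sk Δ) U) :
    SMCtxOk (U :: Δ) := by
  intro X V hX
  cases hX with
  | here => exact hU.mren (.succ _ _)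
  | there hX => exact (h _ _ hX).mren (.succ _ _)

theorem MCtxWf.sk {S : Sig} {Δ : MCtx} (h : MCtxWf S Δ) : SMCtxOk Δ := by
  induction h with
  | nil => intro X U h; cases h
  | cons _ hU ih => exact ih.cons hU.sk

/-- The type of a constant is checked over empty contexts, and every condition on a renaming out of
an empty context is vacuous, so the type transfers to any `D` and `G`. -/
theorem SigWf.sk {S : Sig} (h : SigWf S) {c : ℕ} {A : Ty} (hc : Decl.con c A ∈ S) (D : SMCtx)
    (G : SCtx) : STy D G A := by
  induction h with
  | nil => cases hc
  | fam _ _ _ _ ih =>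
      rcases List.mem_cons.1 hc with hc | hc
      · cases hc
      · exact ih hc
  | con _ _ hA ih =>
      rcases List.mem_cons.1 hc with hc | hc
      · cases hc
        have h₁ := hA.sk fun _ h => by cases h
        have h₂ : STy D (SCtx.nil.mren fun i => i) _ :=
          STy.mren (m := fun i => i) (fun u U h => by cases h) h₁
        have h₃ := h₂.ren (G' := G) (ρ := fun i => i) (fun i s h => by cases h)
          (fun ψ h => by cases h)
        rwa [Ty.ren_id, Ty.mren_id] at h₃
      · exact ih hc

theorem Assump.sk {S : Sig} (hS : SigWf S) {D : SMCtx} {Ψ : Ctx} (hΨ : SCtxOk D Ψ) {h : Ne} {A : Ty}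
    (ha : Assump S Ψ h A) : STy D Ψ.sk A := by
  cases ha with
  | hyp hx => exact hΨ.lookup hx
  | con hc => exact hS.sk hc _ _

/-! ## Closed types of constants -/

theorem liftN_eq_var {G : SCtx} {f : ℕ → Ne} (h : ∀ i s, G.get i = some s → f i = .var i) (a : Sk)
    (i : ℕ) (s : Sk) (hi : (G.snoc a).get i = some s) : liftN f i = .var i := by
  cases i with
  | zero => rfl
  | succ i => simp only [liftN, h i s hi, Ne.ren]

mutual
theorem STm.nsub_eq {D : SMCtx} {G : SCtx} {M : Tm} {s : Sk} {f : ℕ → Ne}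
    (h : ∀ i s, G.get i = some s → f i = .var i) : STm D G M s → M.nsub f = M
  | .neu hR => by simp only [Tm.nsub, SNe.nsub_eq h hR]
  | .lam hM => by simp only [Tm.nsub, STm.nsub_eq (liftN_eq_var h _) hM]
theorem SNe.nsub_eq {D : SMCtx} {G : SCtx} {R : Ne} {s : Sk} {f : ℕ → Ne}
    (h : ∀ i s, G.get i = some s → f i = .var i) : SNe D G R s → R.nsub f = R
  | .var hi => h _ _ hi
  | .const => rfl
  | .app hR hN => by simp only [Ne.nsub, SNe.nsub_eq h hR, STm.nsub_eq h hN]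
  | .mvar _ hσ => by simp only [Ne.nsub, SSb.nsub_eq h hσ]
theorem SSb.nsub_eq {D : SMCtx} {G K : SCtx} {σ : Sb} {f : ℕ → Ne}
    (h : ∀ i s, G.get i = some s → f i = .var i) : SSb D G σ K → σ.nsub f = σ
  | .empty => rfl
  | .wk _ _ => rfl
  | .cons hσ hM => by simp only [Sb.nsub, SSb.nsub_eq h hσ, STm.nsub_eq h hM]
end

theorem STy.nsub_eq {D : SMCtx} {G : SCtx} {A : Ty} {f : ℕ → Ne}
    (h : ∀ i s, G.get i = some s → f i = .var i) (hA : STy D G A) : A.nsub f = A := by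
  induction hA generalizing f with
  | atom hσ => simp only [Ty.nsub, Atom.nsub, hσ.nsub_eq h]
  | arr _ _ ihA ihB => simp only [Ty.nsub, ihA h, ihB h]
  | pi _ _ ihA ihB => simp only [Ty.nsub, ihA h, ihB (liftN_eq_var h _)]

mutual
theorem STm.mren_eq {D : SMCtx} {G : SCtx} {M : Tm} {s : Sk} {m : ℕ → ℕ}
    (h : ∀ u U, D u = some U → m u = u) : STm D G M s → M.mren m = M
  | .neu hR => by simp only [Tm.mren, SNe.mren_eq h hR]
  | .lam hM => by simp only [Tm.mren, STm.mren_eq h hM]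
theorem SNe.mren_eq {D : SMCtx} {G : SCtx} {R : Ne} {s : Sk} {m : ℕ → ℕ}
    (h : ∀ u U, D u = some U → m u = u) : SNe D G R s → R.mren m = R
  | .var _ => rfl
  | .const => rfl
  | .app hR hN => by simp only [Ne.mren, SNe.mren_eq h hR, STm.mren_eq h hN]
  | .mvar hu hσ => by simp only [Ne.mren, SSb.mren_eq h hσ, h _ _ hu]
theorem SSb.mren_eq {D : SMCtx} {G K : SCtx} {σ : Sb} {m : ℕ → ℕ}
    (h : ∀ u U, D u = some U → m u = u) : SSb D G σ K → σ.mren m = σ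
  | .empty => rfl
  | .wk _ hψ => by simp only [Sb.mren, h _ _ hψ]
  | .cons hσ hM => by simp only [Sb.mren, SSb.mren_eq h hσ, STm.mren_eq h hM]
end

theorem STy.mren_eq {D : SMCtx} {G : SCtx} {A : Ty} {m : ℕ → ℕ}
    (h : ∀ u U, D u = some U → m u = u) (hA : STy D G A) : A.mren m = A := by
  induction hA with
  | atom hσ => simp only [Ty.mren, Atom.mren, hσ.mren_eq h]
  | arr _ _ ihA ihB => simp only [Ty.mren, ihA, ihB]
  | pi _ _ ihA ihB => simp only [Ty.mren, ihA, ihB]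

/-- Simple typing over the empty LF context means that no variable occurs free, so `f` has nothing
to replace. -/
theorem SigWf.nsub_con {S : Sig} (h : SigWf S) {c : ℕ} {A : Ty} (hc : Decl.con c A ∈ S)
    (f : ℕ → Ne) : A.nsub f = A :=
  (h.sk hc (fun _ => none) .nil).nsub_eq fun _ _ h => by cases h

theorem SigWf.mren_con {S : Sig} (h : SigWf S) {c : ℕ} {A : Ty} (hc : Decl.con c A ∈ S)
    (m : ℕ → ℕ) : A.mren m = A :=
  (h.sk hc (fun _ => none) .nil).mren_eq fun _ _ h => by cases h

/-! ## Neutral substitution preserves typing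

The two instances of interest, renamings and substitutions of proof-relevant neutral terms, are
treated together: `Q Ψ R r A` states which neutral terms may replace a variable of type `A` and
role `r`. -/

structure Replaces (S : Sig) (Δ : MCtx) (Q : Ctx → Ne → Role → Ty → Prop) : Prop where
  var : ∀ {Ψ : Ctx} {x : ℕ} {r : Role} {A : Ty}, Ψ.Lookup x r A → Q Ψ (.var x) r A
  shift : ∀ {Ψ : Ctx} {R : Ne} {r : Role} {A : Ty} (r₁ : Role) (B : Ty),
    Q Ψ R r A → Q (.snoc Ψ r₁ B) (R.ren Nat.succ) r A.shift
  syn : ∀ {Ψ : Ctx} {R : Ne} {r : Role} {A : Ty}, Q Ψ R r A → NeSyn S Δ Ψ R A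

structure NSubst (Q : Ctx → Ne → Role → Ty → Prop) (Φ : Ctx) (f : ℕ → Ne) (Ψ : Ctx) : Prop where
  var : ∀ x r A, Ψ.Lookup x r A → Q Φ (f x) r (A.nsub f)
  base : ∀ ψ, Ψ.base = some ψ → Φ.base = some ψ

theorem NSubst.lift {S : Sig} {Δ : MCtx} {Q : Ctx → Ne → Role → Ty → Prop} (hQ : Replaces S Δ Q)
    {Φ Ψ : Ctx} {f : ℕ → Ne} (h : NSubst Q Φ f Ψ) (r : Role) (A : Ty) :
    NSubst Q (.snoc Φ r (A.nsub f)) (liftN f) (.snoc Ψ r A) where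
  var x r' A' hx := by
    cases hx with
    | here => rw [Ty.shift_nsub]; exact hQ.var .here
    | there hx => rw [Ty.shift_nsub]; exact hQ.shift _ _ (h.var _ _ _ hx)
  base := h.base

theorem Ty.HSub.nsub_inst {N : Tm} {B B₁ : Ty} (f : ℕ → Ne) (h : Ty.HSub (inst N) B B₁) :
    Ty.HSub (inst (N.nsub f)) (B.nsub (liftN f)) (B₁.nsub f) :=
  h.nsub (inst_nsub N f)

mutual
theorem TmChk.nsub {S : Sig} (hS : SigWf S) {Δ : MCtx} {Q : Ctx → Ne → Role → Ty → Prop}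
    (hQ : Replaces S Δ Q) {Ψ Φ : Ctx} {f : ℕ → Ne} (h : NSubst Q Φ f Ψ) {M : Tm} {A : Ty} :
    TmChk S Δ Ψ M A → TmChk S Δ Φ (M.nsub f) (A.nsub f)
  | .neu hR => .neu (NeSyn.nsub hS hQ h hR)
  | .lam_arr (B := B) hM =>
      .lam_arr (Ty.shift_nsub f B ▸ TmChk.nsub hS hQ (h.lift hQ _ _) hM)
  | .lam_pi hM => .lam_pi (TmChk.nsub hS hQ (h.lift hQ _ _) hM)
theorem NeSyn.nsub {S : Sig} (hS : SigWf S) {Δ : MCtx} {Q : Ctx → Ne → Role → Ty → Prop}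
    (hQ : Replaces S Δ Q) {Ψ Φ : Ctx} {f : ℕ → Ne} (h : NSubst Q Φ f Ψ) {R : Ne} {A : Ty} :
    NeSyn S Δ Ψ R A → NeSyn S Δ Φ (R.nsub f) (A.nsub f)
  | .var hx => hQ.syn (h.var _ _ _ hx)
  | .const hc => (hS.nsub_con hc f).symm ▸ .const hc
  | .app_arr hR hN => .app_arr (NeSyn.nsub hS hQ h hR) (TmChk.nsub hS hQ h hN)
  | .app_pi hR hN hB =>
      .app_pi (NeSyn.nsub hS hQ h hR) (TmChk.nsub hS hQ h hN) (hB.nsub_inst f)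
  | .mvar hu hσ hP => .mvar hu (SbChk.nsub hS hQ h hσ) (hP.nsub_env f)
theorem SbChk.nsub {S : Sig} (hS : SigWf S) {Δ : MCtx} {Q : Ctx → Ne → Role → Ty → Prop}
    (hQ : Replaces S Δ Q) {Ψ Φ : Ctx} {f : ℕ → Ne} (h : NSubst Q Φ f Ψ) {σ : Sb} {Φ' : Ctx} :
    SbChk S Δ Ψ σ Φ' → SbChk S Δ Φ (σ.nsub f) Φ'
  | .empty => .empty
  | .wk hψ => .wk (h.base _ hψ)
  | .cons hσ hB hM => .cons (SbChk.nsub hS hQ h hσ) (hB.nsub_env f) (TmChk.nsub hS hQ h hM)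
end

mutual
-- The only place where the proof must be rebuilt is a transition to a replaced proof-relevant
-- variable: the result is a focus on the neutral term `f x`, and `hF` says how to absorb it. Focus
-- on a constant survives because its type is closed.
theorem Unif.nsub {S : Sig} (hS : SigWf S) {Δ : MCtx} {Q : Ctx → Ne → Role → Ty → Prop}
    (hQ : Replaces S Δ Q) (hF : ∀ {Ψ R A M P}, Q Ψ R .hyp A → Foc S Δ Ψ R A M P →
      Unif S Δ Ψ M (.atom P)) {Ψ Φ : Ctx} {f : ℕ → Ne} (h : NSubst Q Φ f Ψ) {M : Tm} {A : Ty} :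
    Unif S Δ Ψ M A → Unif S Δ Φ (M.nsub f) (A.nsub f)
  | .piR hM => .piR (Unif.nsub hS hQ hF (h.lift hQ _ _) hM)
  | .arrR (B := B) hM =>
      .arrR (Ty.shift_nsub f B ▸ Unif.nsub hS hQ hF (h.lift hQ _ _) hM)
  | .transMeta hX hσ hP => .transMeta hX (UnifSb.nsub hS hQ hF h hσ) (hP.nsub_env f)
  | .transAssump (.hyp hx) hM => hF (h.var _ _ _ hx) (Foc.nsub hS hQ hF h hM)
  | .transAssump (.con hc) hM =>
      .transAssump (.con hc) (by
        have := Foc.nsub hS hQ hF h hM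
        rwa [hS.nsub_con hc f] at this)
theorem UnifSb.nsub {S : Sig} (hS : SigWf S) {Δ : MCtx} {Q : Ctx → Ne → Role → Ty → Prop}
    (hQ : Replaces S Δ Q) (hF : ∀ {Ψ R A M P}, Q Ψ R .hyp A → Foc S Δ Ψ R A M P →
      Unif S Δ Ψ M (.atom P)) {Ψ Φ : Ctx} {f : ℕ → Ne} (h : NSubst Q Φ f Ψ) {σ : Sb} {Φ' : Ctx} :
    UnifSb S Δ Ψ σ Φ' → UnifSb S Δ Φ (σ.nsub f) Φ'
  | .empty => .empty
  | .wk hψ => .wk (h.base _ hψ)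
  | .subp hσ hB hN =>
      .subp (UnifSb.nsub hS hQ hF h hσ) (hB.nsub_env f) (Unif.nsub hS hQ hF h hN)
  | .subu hσ hB hM => .subu (UnifSb.nsub hS hQ hF h hσ) (hB.nsub_env f) (hM.nsub hS hQ h)
theorem Foc.nsub {S : Sig} (hS : SigWf S) {Δ : MCtx} {Q : Ctx → Ne → Role → Ty → Prop}
    (hQ : Replaces S Δ Q) (hF : ∀ {Ψ R A M P}, Q Ψ R .hyp A → Foc S Δ Ψ R A M P →
      Unif S Δ Ψ M (.atom P)) {Ψ Φ : Ctx} {f : ℕ → Ne} (h : NSubst Q Φ f Ψ) {R : Ne} {A : Ty}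
    {M : Tm} {P : Atom} :
    Foc S Δ Ψ R A M P → Foc S Δ Φ (R.nsub f) (A.nsub f) (M.nsub f) (P.nsub f)
  | .init => .init
  | .arrL hN hM => .arrL (Unif.nsub hS hQ hF h hN) (Foc.nsub hS hQ hF h hM)
  | .piL hN hB hM => .piL (hN.nsub hS hQ h) (hB.nsub_inst f) (Foc.nsub hS hQ hF h hM)
end

-- Renaming as an instance of neutral substitution.

/-- The replacement of variables by variables. -/
def VarRep (Ψ : Ctx) (R : Ne) (r : Role) (A : Ty) : Prop := ∃ x, R = .var x ∧ Ψ.Lookup x r A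

theorem replaces_varRep (S : Sig) (Δ : MCtx) : Replaces S Δ VarRep where
  var hx := ⟨_, rfl, hx⟩
  shift _ _ h := by obtain ⟨x, rfl, hx⟩ := h; exact ⟨_, rfl, .there hx⟩
  syn h := by obtain ⟨x, rfl, hx⟩ := h; exact .var hx

theorem VarRep.foc {S : Sig} {Δ : MCtx} {Ψ : Ctx} {R : Ne} {A : Ty} {M : Tm} {P : Atom}
    (h : VarRep Ψ R .hyp A) (hM : Foc S Δ Ψ R A M P) : Unif S Δ Ψ M (.atom P) := by
  obtain ⟨x, rfl, hx⟩ := h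
  exact .transAssump (.hyp hx) hM

theorem nsubst_succ (Ψ : Ctx) (r : Role) (B : Ty) :
    NSubst VarRep (.snoc Ψ r B) (fun i => .var (Nat.succ i)) Ψ where
  var x r' A hx := by rw [Ty.nsub_var]; exact ⟨_, rfl, .there hx⟩
  base _ h := h

theorem NeSyn.shift {S : Sig} (hS : SigWf S) {Δ : MCtx} {Ψ : Ctx} {R : Ne} {A : Ty}
    (h : NeSyn S Δ Ψ R A) (r : Role) (B : Ty) :
    NeSyn S Δ (.snoc Ψ r B) (R.ren Nat.succ) A.shift := by
  have := h.nsub hS (replaces_varRep S Δ) (nsubst_succ Ψ r B)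
  rwa [Ty.nsub_var, Ne.nsub_var] at this

theorem TmChk.shift {S : Sig} (hS : SigWf S) {Δ : MCtx} {Ψ : Ctx} {M : Tm} {A : Ty}
    (h : TmChk S Δ Ψ M A) (r : Role) (B : Ty) :
    TmChk S Δ (.snoc Ψ r B) (M.ren Nat.succ) A.shift := by
  have := h.nsub hS (replaces_varRep S Δ) (nsubst_succ Ψ r B)
  rwa [Ty.nsub_var, Tm.nsub_var] at this

theorem Unif.shift {S : Sig} (hS : SigWf S) {Δ : MCtx} {Ψ : Ctx} {M : Tm} {A : Ty}
    (h : Unif S Δ Ψ M A) (r : Role) (B : Ty) :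
    Unif S Δ (.snoc Ψ r B) (M.ren Nat.succ) A.shift := by
  have := h.nsub hS (replaces_varRep S Δ) VarRep.foc (nsubst_succ Ψ r B)
  rwa [Ty.nsub_var, Tm.nsub_var] at this

theorem UnifSb.shift {S : Sig} (hS : SigWf S) {Δ : MCtx} {Ψ Φ : Ctx} {σ : Sb}
    (h : UnifSb S Δ Ψ σ Φ) (r : Role) (B : Ty) :
    UnifSb S Δ (.snoc Ψ r B) (σ.ren Nat.succ) Φ := by
  have := h.nsub hS (replaces_varRep S Δ) VarRep.foc (nsubst_succ Ψ r B)
  rwa [Sb.nsub_var] at this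

/-! ## Uniform neutral terms -/

mutual
-- Parameters are instantiated by merely typed terms, and these may mention the variable being cut;
-- so a neutral term built from uniform arguments must be known to be typed as well.
theorem Unif.chk {S : Sig} {Δ : MCtx} {Ψ : Ctx} {M : Tm} {A : Ty} :
    Unif S Δ Ψ M A → TmChk S Δ Ψ M A
  | .piR hM => .lam_pi (Unif.chk hM)
  | .arrR hM => .lam_arr (Unif.chk hM)
  | .transMeta hX hσ hP => .neu (.mvar hX (UnifSb.chk hσ) hP)
  | .transAssump (.hyp hx) hM => Foc.chk (.var hx) hM
  | .transAssump (.con hc) hM => Foc.chk (.const hc) hM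
theorem UnifSb.chk {S : Sig} {Δ : MCtx} {Ψ Φ : Ctx} {σ : Sb} :
    UnifSb S Δ Ψ σ Φ → SbChk S Δ Ψ σ Φ
  | .empty => .empty
  | .wk hψ => .wk hψ
  | .subp hσ hB hN => .cons (UnifSb.chk hσ) hB (Unif.chk hN)
  | .subu hσ hB hM => .cons (UnifSb.chk hσ) hB hM
theorem Foc.chk {S : Sig} {Δ : MCtx} {Ψ : Ctx} {R : Ne} {A : Ty} {M : Tm} {P : Atom}
    (hR : NeSyn S Δ Ψ R A) : Foc S Δ Ψ R A M P → TmChk S Δ Ψ M (.atom P)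
  | .init => .neu hR
  | .arrL hN hM => Foc.chk (.app_arr hR (Unif.chk hN)) hM
  | .piL hN hB hM => Foc.chk (.app_pi hR hN hB) hM
end

/-- Neutral terms that a focused proof can reach. -/
inductive UNe (S : Sig) (Δ : MCtx) (Ψ : Ctx) : Ne → Ty → Prop
  | head {h : Ne} {A : Ty} : Assump S Ψ h A → UNe S Δ Ψ h A
  | app_arr {R : Ne} {N : Tm} {A B : Ty} :
      UNe S Δ Ψ R (.arr A B) → Unif S Δ Ψ N A → UNe S Δ Ψ (.app R N) B
  | app_pi {R : Ne} {N : Tm} {A B B₁ : Ty} :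
      UNe S Δ Ψ R (.pi A B) → TmChk S Δ Ψ N A → Ty.HSub (inst N) B B₁ → UNe S Δ Ψ (.app R N) B₁
  | mvar {Φ : Ctx} {u : ℕ} {σ : Sb} {P P₁ : Atom} :
      MCtx.Lookup Δ u (.ctxt Φ P) → UnifSb S Δ Ψ σ Φ → Atom.HSub σ.env P P₁ →
      UNe S Δ Ψ (.mvar u σ) (.atom P₁)

/-- Each argument of the spine, taken from the last to the first, becomes a focusing step in front
of the given proof, until the head is reached and a transition rule applies. A contextual variable
is atomic, so the focus on it can only be `init`. -/
theorem UNe.foc {S : Sig} {Δ : MCtx} {Ψ : Ctx} {R : Ne} {A : Ty} {M : Tm} {P : Atom}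
    (hR : UNe S Δ Ψ R A) (hM : Foc S Δ Ψ R A M P) : Unif S Δ Ψ M (.atom P) := by
  induction hR with
  | head ha => exact .transAssump ha hM
  | app_arr _ hN ih => exact ih (.arrL hN hM)
  | app_pi _ hN hB ih => exact ih (.piL hN hB hM)
  | mvar hu hσ hP => cases hM; exact .transMeta hu hσ hP

theorem UNe.syn {S : Sig} {Δ : MCtx} {Ψ : Ctx} {R : Ne} {A : Ty} (hR : UNe S Δ Ψ R A) :
    NeSyn S Δ Ψ R A := by
  induction hR with
  | head ha =>
      cases ha with
      | hyp hx => exact .var hx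
      | con hc => exact .const hc
  | app_arr _ hN ih => exact .app_arr ih hN.chk
  | app_pi _ hN hB ih => exact .app_pi ih hN hB
  | mvar hu hσ hP => exact .mvar hu hσ.chk hP

theorem Ty.HSub.shift_inst {N : Tm} {B B₁ : Ty} (h : Ty.HSub (inst N) B B₁) :
    Ty.HSub (inst (N.ren Nat.succ)) (B.ren (liftRen Nat.succ)) B₁.shift := by
  have := h.nsub_inst (fun i => .var (Nat.succ i))
  rwa [liftN_var, Ty.nsub_var, Ty.nsub_var, Tm.nsub_var] at this

theorem Ty.HSub.shift_env {σ : Sb} {B B₁ : Ty} (h : Ty.HSub σ.env B B₁) :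
    Ty.HSub (σ.ren Nat.succ).env B B₁.shift := by
  have := h.nsub_env (fun i => .var (Nat.succ i))
  rwa [Ty.nsub_var, Sb.nsub_var] at this

theorem Atom.HSub.shift_env {σ : Sb} {P P₁ : Atom} (h : Atom.HSub σ.env P P₁) :
    Atom.HSub (σ.ren Nat.succ).env P (P₁.ren Nat.succ) := by
  have := (Ty.HSub.atom h).shift_env
  cases this; assumption

theorem UNe.shift {S : Sig} (hS : SigWf S) {Δ : MCtx} {Ψ : Ctx} {R : Ne} {A : Ty}
    (hR : UNe S Δ Ψ R A) (r : Role) (C : Ty) :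
    UNe S Δ (.snoc Ψ r C) (R.ren Nat.succ) A.shift := by
  induction hR with
  | head ha =>
      cases ha with
      | hyp hx => exact .head (.hyp (.there hx))
      | con hc =>
          have := hS.nsub_con hc fun i => .var (Nat.succ i)
          rw [Ty.nsub_var] at this
          rw [Ty.shift, this]
          exact .head (.con hc)
  | app_arr _ hN ih => exact .app_arr ih (hN.shift hS _ _)
  | app_pi _ hN hB ih => exact .app_pi ih (hN.shift hS _ _) hB.shift_inst
  | mvar hu hσ hP => exact .mvar hu (hσ.shift hS _ _) hP.shift_env

/-! ## η-expansion -/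

/-- Applying a weakened `R : Πx̂:A. B` to η(x) gives a result of type [η(x)/x]B; the type required
of the body of the λ is `B`. -/
theorem STy.hsub_inst_eta {D : SMCtx} {G : SCtx} {A B : Ty} (hB : STy D (G.snoc A.sk) B) :
    Ty.HSub (inst (eta A (.var 0))) (B.ren (liftRen Nat.succ)) B := by
  refine hB.hsub_id fun i s hi => ?_
  cases i with
  | zero =>
      simp only [SCtx.get, Option.some.injEq] at hi
      subst hi
      exact .inr (eta_eq _ _)
  | succ i => exact .inl rfl

theorem eta_shift (A : Ty) (R : Ne) : eta A.shift R = eta A R := by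
  rw [eta_eq, eta_eq, Ty.sk_shift]

theorem NeSyn.eta {S : Sig} (hS : SigWf S) {Δ : MCtx} {D : SMCtx} {Ψ : Ctx} {R : Ne} {A : Ty}
    (hA : STy D Ψ.sk A) (hR : NeSyn S Δ Ψ R A) : TmChk S Δ Ψ (eta A R) A := by
  induction hs : A.sk generalizing Ψ R A with
  | o =>
      cases A with
      | atom P => exact .neu hR
      | arr A B => cases hs
      | pi A B => cases hs
  | arr a b iha ihb =>
      cases A with
      | atom P => cases hs
      | arr A B =>
          cases hs
          cases hA with
          | arr hA hB =>
          refine .lam_arr ?_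
          rw [← eta_shift B, ← eta_shift A]
          exact ihb (hB.shift _) (.app_arr (hR.shift hS .hyp A)
            (iha (hA.shift _) (.var .here) A.sk_shift)) B.sk_shift
      | pi A B =>
          cases hs
          cases hA with
          | pi hA hB =>
          refine .lam_pi (ihb hB (.app_pi (hR.shift hS .param A) ?_ hB.hsub_inst_eta) rfl)
          rw [← eta_shift A]
          exact iha (hA.shift _) (.var .here) A.sk_shift

/-- Identity expansion for LF. The induction is on the skeleton because the weakened types that
occur are not subterms of `A`. A variable bound by → is proof-relevant and is expanded uniformly;
one bound by Π is a parameter, for which LF typing of its expansion suffices. -/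
theorem UNe.eta {S : Sig} (hS : SigWf S) {Δ : MCtx} {D : SMCtx} {Ψ : Ctx} {R : Ne} {A : Ty}
    (hA : STy D Ψ.sk A) (hR : UNe S Δ Ψ R A) : Unif S Δ Ψ (eta A R) A := by
  induction hs : A.sk generalizing Ψ R A with
  | o =>
      cases A with
      | atom P => exact hR.foc .init
      | arr A B => cases hs
      | pi A B => cases hs
  | arr a b iha ihb =>
      cases A with
      | atom P => cases hs
      | arr A B =>
          cases hs
          cases hA with
          | arr hA hB =>
          refine .arrR ?_
          rw [← eta_shift B, ← eta_shift A]
          exact ihb (hB.shift _) (.app_arr (hR.shift hS .hyp A)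
            (iha (hA.shift _) (.head (.hyp .here)) A.sk_shift)) B.sk_shift
      | pi A B =>
          cases hs
          cases hA with
          | pi hA hB =>
          refine .piR (ihb hB (.app_pi (hR.shift hS .param A) ?_ hB.hsub_inst_eta) rfl)
          rw [← eta_shift A]
          exact NeSyn.eta hS (hA.shift _) (.var .here)

/-! ## The identity substitution -/

theorem idSb_env {Ψ : Ctx} {i : ℕ} {s : Sk} (h : Ψ.sk.get i = some s) :
    (idSb Ψ).env i = etaS s (.var i) := by
  induction Ψ generalizing i with
  | nil => cases h
  | cvar ψ => cases h
  | snoc Ψ r A ih =>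
      cases i with
      | zero => cases h; exact eta_eq _ _
      | succ i => simp only [idSb, Sb.env, Sb.env_ren, ih h, etaS_ren, Ne.ren]

theorem STy.hsub_idSb {D : SMCtx} {Ψ : Ctx} {A : Ty} (hA : STy D Ψ.sk A) :
    Ty.HSub (idSb Ψ).env A A := by
  have := hA.hsub_id (ρ := fun i => i) (e := (idSb Ψ).env) fun i s hi => .inr (idSb_env hi)
  rwa [Ty.ren_id] at this

theorem unifSb_idSb {S : Sig} (hS : SigWf S) {Δ : MCtx} {D : SMCtx} {Ψ : Ctx} (hΨ : SCtxOk D Ψ) :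
    UnifSb S Δ Ψ (idSb Ψ) Ψ := by
  induction hΨ with
  | nil => exact .empty
  | cvar _ => exact .wk rfl
  | @snoc Ψ r A _ hA ih =>
      have hB := hA.hsub_idSb.shift_env
      simp only [idSb]
      rw [← eta_shift]
      cases r with
      | hyp => exact .subp (ih.shift hS _ _) hB (UNe.eta hS (hA.shift _) (.head (.hyp .here)))
      | param => exact .subu (ih.shift hS _ _) hB (NeSyn.eta hS (hA.shift _) (.var .here))

/-- A contextual variable, under the identity substitution, proves its own judgment; this is the
base case of identity expansion for boxes. -/
theorem unif_mvar_idSb {S : Sig} (hS : SigWf S) {Δ : MCtx} {D : SMCtx} {Ψ : Ctx} {P : Atom} {X : ℕ}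
    (hΨ : SCtxOk D Ψ) (hP : STy D Ψ.sk (.atom P)) (hX : MCtx.Lookup Δ X (.ctxt Ψ P)) :
    Unif S Δ Ψ (.neu (.mvar X (idSb Ψ))) (.atom P) := by
  have h := hP.hsub_idSb
  cases h with
  | atom h => exact .transMeta hX (unifSb_idSb hS hΨ) h

/-! ## Completeness of focusing for LF -/

/-- The replacement of proof-relevant variables by uniform neutral terms, and of parameters by
arbitrary ones. -/
def UNeRep (S : Sig) (Δ : MCtx) (Ψ : Ctx) (R : Ne) (r : Role) (A : Ty) : Prop :=
  NeSyn S Δ Ψ R A ∧ (r = .hyp → UNe S Δ Ψ R A)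

theorem replaces_uNeRep {S : Sig} (hS : SigWf S) (Δ : MCtx) : Replaces S Δ (UNeRep S Δ) where
  var hx := ⟨.var hx, fun h => .head (.hyp (h ▸ hx))⟩
  shift _ _ h := ⟨h.1.shift hS _ _, fun hr => (h.2 hr).shift hS _ _⟩
  syn h := h.1

theorem nsubst_instN {S : Sig} {Δ : MCtx} {Ψ : Ctx} {R : Ne} {A : Ty} (hR : UNe S Δ Ψ R A) :
    NSubst (UNeRep S Δ) Ψ (instN R) (.snoc Ψ .hyp A) where
  var x r B hx := by
    cases hx with
    | here => rw [Ty.shift_instN]; exact ⟨hR.syn, fun _ => hR⟩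
    | there hx => rw [Ty.shift_instN]; exact ⟨.var hx, fun h => .head (.hyp (h ▸ hx))⟩
  base _ h := h

/-- The one form of cut that LF needs: `piL`, `arrL` and `reflect` all reduce to it. -/
theorem Unif.hsub_inst {S : Sig} (hS : SigWf S) {Δ : MCtx} {Ψ : Ctx} {R : Ne} {A B : Ty}
    {N N₁ : Tm} (hR : UNe S Δ Ψ R B) (hN : Unif S Δ (.snoc Ψ .hyp B) N A.shift)
    (h : Tm.HSub (inst (.neu R)) N N₁) : Unif S Δ Ψ N₁ A := by
  have := hN.nsub hS (replaces_uNeRep hS Δ) (fun h => (h.2 rfl).foc) (nsubst_instN hR)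
  rwa [Ty.shift_instN, ← h.inst_neu] at this

theorem STy.pi_inv {D : SMCtx} {G : SCtx} {A B : Ty} (h : STy D G (.pi A B)) :
    STy D (G.snoc A.sk) B := by
  cases h; assumption

theorem STy.arr_inv {D : SMCtx} {G : SCtx} {A B : Ty} (h : STy D G (.arr A B)) :
    STy D G A ∧ STy D G B := by
  cases h with | arr hA hB => exact ⟨hA, hB⟩

theorem SMTyOk.ctxt_inv {D : SMCtx} {Ψ : Ctx} {P : Atom} (h : SMTyOk D (.ctxt Ψ P)) :
    SCtxOk D Ψ ∧ STy D Ψ.sk (.atom P) := by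
  cases h with | ctxt hΨ hP => exact ⟨hΨ, hP⟩

mutual
-- Simple typing of the context and of the type is carried along because `init` needs it for
-- η-expansion. In the left rules and `reflect` it has to be established for the type of the new
-- assumption.
theorem LFSeq.unif {S : Sig} (hS : SigWf S) {Δ : MCtx} (hΔ : SMCtxOk Δ) {Ψ : Ctx} {M : Tm} {A : Ty} :
    SCtxOk (MCtx.sk Δ) Ψ → STy (MCtx.sk Δ) Ψ.sk A → LFSeq S Δ Ψ M A → Unif S Δ Ψ M A
  | _, hA, .init ha => UNe.eta hS hA (.head ha)
  | hΨ, .pi hA hB, .piR hM => .piR (LFSeq.unif hS hΔ (.snoc hΨ hA) hB hM)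
  | hΨ, .arr hA hB, .arrR hM => .arrR (LFSeq.unif hS hΔ (.snoc hΨ hA) (hB.shift _) hM)
  | hΨ, hA', .piL ha hM hs hN hs' =>
      have hB := (ha.sk hS hΨ).pi_inv
      .hsub_inst hS (.app_pi (.head ha) hM hs)
        (LFSeq.unif hS hΔ (.snoc hΨ (hB.hsub_inst (hM.sk hΨ.baseOk) hs)) (hA'.shift _) hN) hs'
  | hΨ, hA', .arrL ha hM hN hs' =>
      have ⟨hA, hB⟩ := (ha.sk hS hΨ).arr_inv
      .hsub_inst hS (.app_arr (.head ha) (LFSeq.unif hS hΔ hΨ hA hM))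
        (LFSeq.unif hS hΔ (.snoc hΨ hB) (hA'.shift _) hN) hs'
  | hΨ, hA', .reflect hu hσ hP hM hs' =>
      have ⟨hΦ, hQ⟩ := (hΔ _ _ hu).ctxt_inv
      have hσ' := LFSeqSb.unif hS hΔ hΨ hΦ hσ
      .hsub_inst hS (.mvar hu hσ' hP)
        (LFSeq.unif hS hΔ (.snoc hΨ (hQ.hsub_env (hσ'.chk.sk hΨ.baseOk) (.atom hP)))
          (hA'.shift _) hM) hs'
theorem LFSeqSb.unif {S : Sig} (hS : SigWf S) {Δ : MCtx} (hΔ : SMCtxOk Δ) {Ψ Φ : Ctx} {σ : Sb} :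
    SCtxOk (MCtx.sk Δ) Ψ → SCtxOk (MCtx.sk Δ) Φ → LFSeqSb S Δ Ψ σ Φ → UnifSb S Δ Ψ σ Φ
  | _, _, .empty => .empty
  | _, _, .wk hψ => .wk hψ
  | hΨ, .snoc hΦ hB, .subp hσ hs hN =>
      have hσ' := LFSeqSb.unif hS hΔ hΨ hΦ hσ
      .subp hσ' hs (LFSeq.unif hS hΔ hΨ (hB.hsub_env (hσ'.chk.sk hΨ.baseOk) hs) hN)
  | hΨ, .snoc hΦ _, .subu hσ hs hM => .subu (LFSeqSb.unif hS hΔ hΨ hΦ hσ) hs hM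
end

theorem Unif.atom_cases {S : Sig} {Δ : MCtx} {Ψ : Ctx} {M : Tm} {P : Atom}
    (h : Unif S Δ Ψ M (.atom P)) :
    (∃ (h : Ne) (A : Ty), Assump S Ψ h A ∧ Foc S Δ Ψ h A M P) ∨
    (∃ (X : ℕ) (Φ : Ctx) (Q : Atom), MCtx.Lookup Δ X (.ctxt Φ Q) ∧ FocMeta S Δ Ψ X Φ Q M P) := by
  cases h with
  | transMeta hX hσ hP => exact .inr ⟨_, _, _, hX, _, hσ, hP, rfl⟩
  | transAssump ha hM => exact .inl ⟨_, _, ha, hM⟩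

/-! ## Renaming of contextual variables in derivations -/

/-- `m` maps the declarations of `Δ` to declarations of `Δ'`. -/
def MRen (m : ℕ → ℕ) (Δ Δ' : MCtx) : Prop :=
  ∀ X U, MCtx.Lookup Δ X U → MCtx.Lookup Δ' (m X) (U.mren m)

theorem MTy.mren_liftRen (m : ℕ → ℕ) (U : MTy) :
    (U.mren Nat.succ).mren (liftRen m) = (U.mren m).mren Nat.succ := by
  simp only [MTy.mren_mren, liftRen, Nat.succ_eq_add_one]

theorem MRen.succ (Δ : MCtx) (U : MTy) : MRen Nat.succ Δ (U :: Δ) := fun _ _ h => .there h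

theorem MRen.id (Δ : MCtx) : MRen (fun i => i) Δ Δ := fun _ U h => by rwa [U.mren_id]

theorem MRen.comp {m m' : ℕ → ℕ} {Δ Δ' Δ'' : MCtx} (h : MRen m Δ Δ') (h' : MRen m' Δ' Δ'') :
    MRen (fun i => m' (m i)) Δ Δ'' := fun X U hX => by
  rw [← MTy.mren_mren]
  exact h' _ _ (h _ _ hX)

theorem MRen.cons {m : ℕ → ℕ} {Δ Δ' : MCtx} (h : MRen m Δ Δ') (U : MTy) :
    MRen (liftRen m) (U :: Δ) (U.mren m :: Δ') := by
  intro X V hX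
  cases hX with
  | here => rw [MTy.mren_liftRen]; exact .here
  | there hX => rw [MTy.mren_liftRen]; exact .there (h _ _ hX)

/-- Every skeleton comes from a declaration, so a renaming of meta-contexts is also one of their
skeletons. -/
theorem MCtx.lookup_of_sk {Δ : MCtx} {X : ℕ} {V : MSk} (h : MCtx.sk Δ X = some V) :
    ∃ U, MCtx.Lookup Δ X U ∧ U.sk = V := by
  induction Δ generalizing X V with
  | nil => cases h
  | cons U Δ ih =>
      cases X with
      | zero =>
          simp only [MCtx.sk, SMCtx.cons, Option.some.injEq] at h
          exact ⟨_, .here, by rw [MTy.sk_mren, h]⟩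
      | succ X =>
          simp only [MCtx.sk, SMCtx.cons, Option.map_eq_some_iff] at h
          obtain ⟨V, hV, rfl⟩ := h
          obtain ⟨U, hU, rfl⟩ := ih hV
          exact ⟨_, .there hU, by rw [MTy.sk_mren]⟩

theorem MRen.sk {m : ℕ → ℕ} {Δ Δ' : MCtx} (h : MRen m Δ Δ') :
    SMCtx.Ren m (MCtx.sk Δ) (MCtx.sk Δ') := by
  intro X V hX
  obtain ⟨U, hU, rfl⟩ := MCtx.lookup_of_sk hX
  rw [(h _ _ hU).sk, MTy.sk_mren]

theorem Ty.HSub.mren_inst {N : Tm} {B B₁ : Ty} (m : ℕ → ℕ) (h : Ty.HSub (inst N) B B₁) :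
    Ty.HSub (inst (N.mren m)) (B.mren m) (B₁.mren m) :=
  h.mren (inst_mren N m)

mutual
theorem TmChk.mren {S : Sig} (hS : SigWf S) {Δ Δ' : MCtx} {m : ℕ → ℕ} (h : MRen m Δ Δ')
    {Ψ : Ctx} {M : Tm} {A : Ty} :
    TmChk S Δ Ψ M A → TmChk S Δ' (Ψ.mren m) (M.mren m) (A.mren m)
  | .neu hR => .neu (NeSyn.mren hS h hR)
  | .lam_arr (B := B) hM => .lam_arr (Ty.shift_mren m B ▸ TmChk.mren hS h hM)
  | .lam_pi hM => .lam_pi (TmChk.mren hS h hM)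
theorem NeSyn.mren {S : Sig} (hS : SigWf S) {Δ Δ' : MCtx} {m : ℕ → ℕ} (h : MRen m Δ Δ')
    {Ψ : Ctx} {R : Ne} {A : Ty} :
    NeSyn S Δ Ψ R A → NeSyn S Δ' (Ψ.mren m) (R.mren m) (A.mren m)
  | .var hx => .var (hx.mren m)
  | .const hc => (hS.mren_con hc m).symm ▸ .const hc
  | .app_arr hR hN => .app_arr (NeSyn.mren hS h hR) (TmChk.mren hS h hN)
  | .app_pi hR hN hB => .app_pi (NeSyn.mren hS h hR) (TmChk.mren hS h hN) (hB.mren_inst m)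
  | .mvar hu hσ hP => .mvar (h _ _ hu) (SbChk.mren hS h hσ) (hP.mren (Sb.env_mren m _))
theorem SbChk.mren {S : Sig} (hS : SigWf S) {Δ Δ' : MCtx} {m : ℕ → ℕ} (h : MRen m Δ Δ')
    {Ψ Φ : Ctx} {σ : Sb} :
    SbChk S Δ Ψ σ Φ → SbChk S Δ' (Ψ.mren m) (σ.mren m) (Φ.mren m)
  | .empty => .empty
  | .wk hψ => .wk (by rw [Ctx.base_mren, hψ]; rfl)
  | .cons hσ hB hM =>
      .cons (SbChk.mren hS h hσ) (hB.mren (Sb.env_mren m _)) (TmChk.mren hS h hM)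
end

theorem Assump.mren {S : Sig} (hS : SigWf S) {Ψ : Ctx} {h : Ne} {A : Ty} (m : ℕ → ℕ)
    (ha : Assump S Ψ h A) : Assump S (Ψ.mren m) (h.mren m) (A.mren m) := by
  cases ha with
  | hyp hx => exact .hyp (hx.mren m)
  | con hc => rw [hS.mren_con hc m]; exact .con hc

mutual
theorem Unif.mren {S : Sig} (hS : SigWf S) {Δ Δ' : MCtx} {m : ℕ → ℕ} (h : MRen m Δ Δ')
    {Ψ : Ctx} {M : Tm} {A : Ty} :
    Unif S Δ Ψ M A → Unif S Δ' (Ψ.mren m) (M.mren m) (A.mren m)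
  | .piR hM => .piR (Unif.mren hS h hM)
  | .arrR (B := B) hM => .arrR (Ty.shift_mren m B ▸ Unif.mren hS h hM)
  | .transMeta hX hσ hP =>
      .transMeta (h _ _ hX) (UnifSb.mren hS h hσ) (hP.mren (Sb.env_mren m _))
  | .transAssump ha hM => .transAssump (ha.mren hS m) (Foc.mren hS h hM)
theorem UnifSb.mren {S : Sig} (hS : SigWf S) {Δ Δ' : MCtx} {m : ℕ → ℕ} (h : MRen m Δ Δ')
    {Ψ Φ : Ctx} {σ : Sb} :
    UnifSb S Δ Ψ σ Φ → UnifSb S Δ' (Ψ.mren m) (σ.mren m) (Φ.mren m)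
  | .empty => .empty
  | .wk hψ => .wk (by rw [Ctx.base_mren, hψ]; rfl)
  | .subp hσ hB hN =>
      .subp (UnifSb.mren hS h hσ) (hB.mren (Sb.env_mren m _)) (Unif.mren hS h hN)
  | .subu hσ hB hM =>
      .subu (UnifSb.mren hS h hσ) (hB.mren (Sb.env_mren m _)) (hM.mren hS h)
theorem Foc.mren {S : Sig} (hS : SigWf S) {Δ Δ' : MCtx} {m : ℕ → ℕ} (h : MRen m Δ Δ')
    {Ψ : Ctx} {R : Ne} {A : Ty} {M : Tm} {P : Atom} :
    Foc S Δ Ψ R A M P →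
      Foc S Δ' (Ψ.mren m) (R.mren m) (A.mren m) (M.mren m) (P.mren m)
  | .init => .init
  | .arrL hN hM => .arrL (Unif.mren hS h hN) (Foc.mren hS h hM)
  | .piL hN hB hM => .piL (hN.mren hS h) (hB.mren_inst m) (Foc.mren hS h hM)
end

theorem SchemaChk.mren {S : Sig} (hS : SigWf S) {Δ Δ' : MCtx} {m : ℕ → ℕ} (h : MRen m Δ Δ')
    {G : Schema} {Ψ : Ctx} (hΨ : SchemaChk S Δ G Ψ) : SchemaChk S Δ' (G.mren m) (Ψ.mren m) := by
  induction hΨ with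
  | nil => exact .nil
  | cvar hψ => exact .cvar (h _ _ hψ)
  | snoc _ hG hσ hA ih =>
      exact .snoc ih (hG.mren m) (hσ.mren hS h) (hA.mren (Sb.env_mren m _))

theorem MTmChk.mren {S : Sig} (hS : SigWf S) {Δ Δ' : MCtx} {m : ℕ → ℕ} (h : MRen m Δ Δ')
    {C : MTm} {U : MTy} (hC : MTmChk S Δ C U) : MTmChk S Δ' (C.mren m) (U.mren m) := by
  cases hC with
  | tm hR => exact .tm (hR.mren hS h)
  | ctx hΨ => exact .ctx (hΨ.mren hS h)

/-! ## Meta-substitution and renaming of contextual variables -/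

/-- The renamings `ms` of the source and `mt` of the target agree up to the removal of the index
`j`, which becomes `j'`. -/
structure DropRen (j j' : ℕ) (ms mt : ℕ → ℕ) : Prop where
  eq : ms j = j'
  ne : ∀ i, i ≠ j → ms i ≠ j'
  drop : ∀ i, i ≠ j → dropIdx j' (ms i) = mt (dropIdx j i)

theorem dropIdx_succ {j i : ℕ} (h : i ≠ j) : dropIdx (j + 1) (i + 1) = dropIdx j i + 1 := by
  unfold dropIdx
  split_ifs <;> omega

theorem DropRen.lift {j j' : ℕ} {ms mt : ℕ → ℕ} (h : DropRen j j' ms mt) :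
    DropRen (j + 1) (j' + 1) (liftRen ms) (liftRen mt) where
  eq := by simp only [liftRen, h.eq]
  ne i hi := by
    cases i with
    | zero => simp [liftRen]
    | succ i => simpa [liftRen] using h.ne i (by omega)
  drop i hi := by
    cases i with
    | zero => simp [liftRen, dropIdx]
    | succ i =>
        have hi' : i ≠ j := by omega
        simp only [liftRen, dropIdx_succ (h.ne i hi'), dropIdx_succ hi', h.drop i hi']

theorem dropRen_zero (m : ℕ → ℕ) : DropRen 0 0 (liftRen m) m where
  eq := rfl
  ne i hi := by
    cases i with
    | zero => exact absurd rfl hi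
    | succ i => simp [liftRen]
  drop i hi := by
    cases i with
    | zero => exact absurd rfl hi
    | succ i => rfl

theorem eta_mren (A : Ty) (R : Ne) (m : ℕ → ℕ) : (eta A R).mren m = eta (A.mren m) (R.mren m) := by
  simp only [eta_eq, etaS_mren, Ty.sk_mren]

theorem idSb_mren (m : ℕ → ℕ) (Ψ : Ctx) : (idSb Ψ).mren m = idSb (Ψ.mren m) := by
  induction Ψ with
  | nil => rfl
  | cvar ψ => rfl
  | snoc Ψ r A ih => simp only [idSb, Sb.mren, Sb.ren_mren, ih, eta_mren, Ctx.mren, Ne.mren]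

mutual
theorem Tm.HMSub.mren {j j' : ℕ} {ms mt : ℕ → ℕ} (h : DropRen j j' ms mt) {C : MTm} {k : ℕ}
    {M M₁ : Tm} : Tm.HMSub C j k M M₁ → Tm.HMSub (C.mren mt) j' k (M.mren ms) (M₁.mren mt)
  | .neu hR => .neu (Ne.HMSub.mren h hR)
  | .lam hM => .lam (Tm.HMSub.mren h hM)
theorem Ne.HMSub.mren {j j' : ℕ} {ms mt : ℕ → ℕ} (h : DropRen j j' ms mt) {C : MTm} {k : ℕ}
    {R : Ne} {M₁ : Tm} : Ne.HMSub C j k R M₁ → Ne.HMSub (C.mren mt) j' k (R.mren ms) (M₁.mren mt)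
  | .var => .var
  | .const => .const
  | .app_neu hR hN => .app_neu (Ne.HMSub.mren h hR) (Tm.HMSub.mren h hN)
  | .app_lam hR hN hM =>
      .app_lam (Ne.HMSub.mren h hR) (Tm.HMSub.mren h hN) (hM.mren (inst_mren _ mt))
  | .mvar_ne hu hσ => by
      simp only [Ne.mren, Tm.mren, ← h.drop _ hu]
      exact .mvar_ne (h.ne _ hu) (Sb.HMSub.mren h hσ)
  | .mvar_eq hσ hR => by
      simp only [Ne.mren, h.eq]
      exact .mvar_eq (Sb.HMSub.mren h hσ) (hR.mren (Sb.env_mren mt _))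
theorem Sb.HMSub.mren {j j' : ℕ} {ms mt : ℕ → ℕ} (h : DropRen j j' ms mt) {C : MTm} {k : ℕ}
    {σ σ₁ : Sb} : Sb.HMSub C j k σ σ₁ → Sb.HMSub (C.mren mt) j' k (σ.mren ms) (σ₁.mren mt)
  | .empty => .empty
  | .wk_ne hψ => by
      simp only [Sb.mren, ← h.drop _ hψ]
      exact .wk_ne (h.ne _ hψ)
  | .wk_eq => by
      simp only [Sb.mren, h.eq, Sb.ren_mren, idSb_mren]
      exact .wk_eq
  | .cons hσ hM => .cons (Sb.HMSub.mren h hσ) (Tm.HMSub.mren h hM)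
end

theorem Atom.HMSub.mren {j j' : ℕ} {ms mt : ℕ → ℕ} (h : DropRen j j' ms mt) {C : MTm} {k : ℕ}
    {P P₁ : Atom} : Atom.HMSub C j k P P₁ → Atom.HMSub (C.mren mt) j' k (P.mren ms) (P₁.mren mt)
  | .mk hσ => .mk (hσ.mren h)

theorem Ty.HMSub.mren {j j' : ℕ} {ms mt : ℕ → ℕ} (h : DropRen j j' ms mt) {C : MTm} {k : ℕ}
    {A A₁ : Ty} : Ty.HMSub C j k A A₁ → Ty.HMSub (C.mren mt) j' k (A.mren ms) (A₁.mren mt)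
  | .atom hP => .atom (hP.mren h)
  | .arr hA hB => .arr (Ty.HMSub.mren h hA) (Ty.HMSub.mren h hB)
  | .pi hA hB => .pi (Ty.HMSub.mren h hA) (Ty.HMSub.mren h hB)

theorem Ctx.HMSub.mren {j j' : ℕ} {ms mt : ℕ → ℕ} (h : DropRen j j' ms mt) {C : MTm}
    {Ψ Ψ₁ : Ctx} : Ctx.HMSub C j Ψ Ψ₁ → Ctx.HMSub (C.mren mt) j' (Ψ.mren ms) (Ψ₁.mren mt)
  | .nil => .nil
  | .cvar_ne hψ => by
      simp only [Ctx.mren, ← h.drop _ hψ]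
      exact .cvar_ne (h.ne _ hψ)
  | .cvar_eq => by
      simp only [Ctx.mren, h.eq]
      exact .cvar_eq
  | .snoc hΨ hA => .snoc (Ctx.HMSub.mren h hΨ) (by rw [Ctx.length_mren]; exact hA.mren h)

theorem Schema.HMSub.mren {j j' : ℕ} {ms mt : ℕ → ℕ} (h : DropRen j j' ms mt) {C : MTm}
    {G G₁ : Schema} : Schema.HMSub C j G G₁ → Schema.HMSub (C.mren mt) j' (G.mren ms) (G₁.mren mt)
  | .elem hΦ hA => .elem (hΦ.mren h) (by rw [Ctx.length_mren]; exact hA.mren h)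
  | .plus hG hΦ hA =>
      .plus (Schema.HMSub.mren h hG) (hΦ.mren h) (by rw [Ctx.length_mren]; exact hA.mren h)

theorem MTy.HMSub.mren {j j' : ℕ} {ms mt : ℕ → ℕ} (h : DropRen j j' ms mt) {C : MTm}
    {U U₁ : MTy} : MTy.HMSub C j U U₁ → MTy.HMSub (C.mren mt) j' (U.mren ms) (U₁.mren mt)
  | .ctxt hΨ hP => .ctxt (hΨ.mren h) (by rw [Ctx.length_mren]; exact hP.mren h)
  | .schema hG => .schema (hG.mren h)

theorem MTm.mren_liftRen (m : ℕ → ℕ) (C : MTm) :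
    (C.mren Nat.succ).mren (liftRen m) = (C.mren m).mren Nat.succ := by
  simp only [MTm.mren_mren, liftRen, Nat.succ_eq_add_one]

theorem CTy.HMSub.mren {j j' : ℕ} {ms mt : ℕ → ℕ} (h : DropRen j j' ms mt) {C : MTm}
    {τ τ₁ : CTy} (hτ : CTy.HMSub C j τ τ₁) :
    CTy.HMSub (C.mren mt) j' (τ.mren ms) (τ₁.mren mt) := by
  induction hτ generalizing j' ms mt with
  | box hΨ hP => exact .box (hΨ.mren h) (by rw [Ctx.length_mren]; exact hP.mren h)
  | arr _ _ ih₁ ih₂ => exact .arr (ih₁ h) (ih₂ h)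
  | pi hU _ ih => exact .pi (hU.mren h) (by rw [← MTm.mren_liftRen]; exact ih h.lift)

theorem CTy.HMSub.mren_zero (m : ℕ → ℕ) {C : MTm} {τ τ₁ : CTy} (hτ : CTy.HMSub C 0 τ τ₁) :
    CTy.HMSub (C.mren m) 0 (τ.mren (liftRen m)) (τ₁.mren m) :=
  hτ.mren (dropRen_zero m)

/-! ## Meta-substitution preserves simple typing -/

/-- The skeleton of the context that replaces a context variable. -/
def MTm.sk : MTm → SCtx
  | .tm _ => .nil
  | .ctx Ψ => Ψ.sk

def SCtx.msub (C : MTm) (j : ℕ) : SCtx → SCtx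
  | .nil => .nil
  | .cvar ψ => if ψ = j then C.sk else .cvar (dropIdx j ψ)
  | .snoc G s => .snoc (G.msub C j) s

def MSk.msub (C : MTm) (j : ℕ) : MSk → MSk
  | .ctxt G => .ctxt (G.msub C j)
  | .schema => .schema

def SCtx.length : SCtx → ℕ
  | .nil => 0
  | .cvar _ => 0
  | .snoc G _ => G.length + 1

theorem Ctx.length_sk (Ψ : Ctx) : Ψ.sk.length = Ψ.length := by
  induction Ψ with
  | nil => rfl
  | cvar ψ => rfl
  | snoc Ψ r A ih => simp only [Ctx.sk, SCtx.length, ih, Ctx.length]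

theorem SCtx.get_msub (C : MTm) (j : ℕ) :
    ∀ (G : SCtx) {i : ℕ} {s : Sk}, G.get i = some s → (G.msub C j).get i = some s
  | .snoc _ _, 0, _, h => h
  | .snoc G _, _ + 1, _, h => SCtx.get_msub C j G h

theorem SCtx.base_msub_ne (C : MTm) {j ψ : ℕ} (hψ : ψ ≠ j) {G : SCtx} (h : G.base = some ψ) :
    (G.msub C j).base = some (dropIdx j ψ) := by
  induction G with
  | nil => cases h
  | cvar ψ => cases h; simp only [SCtx.msub, if_neg hψ, SCtx.base]
  | snoc G s ih => exact ih h

theorem SCtx.base_msub_eq (C : MTm) {j : ℕ} {G : SCtx} (h : G.base = some j) :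
    (G.msub C j).base = C.sk.base := by
  induction G with
  | nil => cases h
  | cvar ψ => cases h; simp only [SCtx.msub, if_true]
  | snoc G s ih => exact ih h

/-- The replacing context goes to the front, behind the existing declarations in de Bruijn order.
Its variables are therefore shifted by the length of `G`, exactly as in `Sb.HMSub.wk_eq`. -/
theorem SCtx.get_msub_eq (C : MTm) {j : ℕ} {G : SCtx} (h : G.base = some j) (i : ℕ) :
    (G.msub C j).get (i + G.length) = C.sk.get i := by
  induction G with
  | nil => cases h
  | cvar ψ => cases h; simp only [SCtx.msub, if_true, SCtx.length, Nat.add_zero]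
  | snoc G s ih => exact ih h

theorem MTm.sk_mren (m : ℕ → ℕ) (C : MTm) : (C.mren m).sk = C.sk.mren m := by
  cases C with
  | tm R => rfl
  | ctx Ψ => exact Ψ.sk_mren m

theorem SCtx.msub_mren_succ (C : MTm) (j : ℕ) (G : SCtx) :
    (G.mren Nat.succ).msub (C.mren Nat.succ) (j + 1) = (G.msub C j).mren Nat.succ := by
  induction G with
  | nil => rfl
  | cvar ψ =>
      by_cases h : ψ = j
      · simp [SCtx.mren, SCtx.msub, h, MTm.sk_mren]
      · simp [SCtx.mren, SCtx.msub, h, dropIdx_succ h]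
  | snoc G s ih => simp only [SCtx.mren, SCtx.msub, ih]

theorem SCtx.msub_zero (C : MTm) (G : SCtx) : (G.mren Nat.succ).msub C 0 = G := by
  induction G with
  | nil => rfl
  | cvar ψ => simp [SCtx.mren, SCtx.msub, dropIdx]
  | snoc G s ih => simp only [SCtx.mren, SCtx.msub, ih]

theorem MSk.msub_mren_succ (C : MTm) (j : ℕ) (U : MSk) :
    (U.mren Nat.succ).msub (C.mren Nat.succ) (j + 1) = (U.msub C j).mren Nat.succ := by
  cases U <;> simp only [MSk.mren, MSk.msub, SCtx.msub_mren_succ]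

theorem MSk.msub_zero (C : MTm) (U : MSk) : (U.mren Nat.succ).msub C 0 = U := by
  cases U <;> simp only [MSk.mren, MSk.msub, SCtx.msub_zero]

/-- `⟦C/X⟧`, with `X` the index `j`, is a simply typed meta-substitution from `D` to `D'`. -/
structure SMSub (C : MTm) (j : ℕ) (D D' : SMCtx) : Prop where
  ne : ∀ u U, u ≠ j → D u = some U → D' (dropIdx j u) = some (U.msub C j)
  tm : ∀ R K, C = .tm R → D j = some (.ctxt K) → SNe D' (K.msub C j) R .o
  ctx : ∀ Ψ, C = .ctx Ψ → D j = some .schema → SCtxOk D' Ψ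

theorem SMSub.cons {C : MTm} {j : ℕ} {D D' : SMCtx} (h : SMSub C j D D') (U : MSk) :
    SMSub (C.mren Nat.succ) (j + 1) (D.cons U) (D'.cons (U.msub C j)) where
  ne u V hu hV := by
    cases u with
    | zero =>
        simp only [SMCtx.cons, Option.some.injEq] at hV
        subst hV
        rw [MSk.msub_mren_succ]
        rfl
    | succ u =>
        have hu' : u ≠ j := by omega
        simp only [SMCtx.cons, Option.map_eq_some_iff] at hV
        obtain ⟨V, hV, rfl⟩ := hV
        rw [MSk.msub_mren_succ, dropIdx_succ hu']
        simp only [SMCtx.cons, h.ne u V hu' hV, Option.map_some]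
  tm R K hC hK := by
    cases C with
    | ctx Ψ => cases hC
    | tm R₀ =>
        cases hC
        simp only [SMCtx.cons, Option.map_eq_some_iff] at hK
        obtain ⟨V, hV, hK⟩ := hK
        cases V with
        | schema => cases hK
        | ctxt K₀ =>
            cases hK
            rw [SCtx.msub_mren_succ]
            exact (h.tm R₀ K₀ rfl hV).mren (.succ _ _)
  ctx Ψ hC hK := by
    cases C with
    | tm R => cases hC
    | ctx Ψ₀ =>
        cases hC
        simp only [SMCtx.cons, Option.map_eq_some_iff] at hK
        obtain ⟨V, hV, hK⟩ := hK
        cases V with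
        | ctxt K => cases hK
        | schema => exact (h.ctx Ψ₀ rfl hV).mren (.succ _ _)

theorem SNe.eta {D : SMCtx} {G : SCtx} {R : Ne} {s : Sk} (h : SNe D G R s) :
    STm D G (etaS s R) s := by
  induction s generalizing G R with
  | o => exact .neu h
  | arr a b iha ihb =>
      exact .lam (ihb (.app (h.ren (fun _ _ h => h) fun _ h => h) (iha (.var rfl))))

theorem SCtxOk.idSb {D : SMCtx} {Ψ : Ctx} (h : SCtxOk D Ψ) : SSb D Ψ.sk (idSb Ψ) Ψ.sk := by
  induction h with
  | nil => exact .empty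
  | cvar hψ => exact .wk rfl hψ
  | snoc _ _ ih =>
      refine .cons (ih.ren (fun _ _ h => h) fun _ h => h) ?_
      rw [eta_eq]
      exact SNe.eta (.var rfl)

mutual
-- The counter `k` has to be the length of the LF context, since `wk_X` expands to an identity
-- substitution weakened past exactly those variables. At an occurrence X[σ] preservation for
-- hereditary substitution takes over.
theorem STm.hmsub {C : MTm} {j : ℕ} {D D' : SMCtx} (h : SMSub C j D D') {G : SCtx} {M M₁ : Tm}
    {s : Sk} {k : ℕ} (hk : G.length = k) :
    Tm.HMSub C j k M M₁ → STm D G M s → STm D' (G.msub C j) M₁ s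
  | .neu hR, .neu hs => (SNe.hmsub h hk hR hs).tm
  | .lam hM, .lam (a := a) hs =>
      .lam (STm.hmsub h (G := G.snoc a) (congrArg Nat.succ hk) hM hs)
theorem SNe.hmsub {C : MTm} {j : ℕ} {D D' : SMCtx} (h : SMSub C j D D') {G : SCtx} {R : Ne}
    {M₁ : Tm} {s : Sk} {k : ℕ} (hk : G.length = k) :
    Ne.HMSub C j k R M₁ → SNe D G R s → SOk D' (G.msub C j) M₁ s
  | .var, .var hi => .inr ⟨_, rfl, .var (G.get_msub C j hi)⟩
  | .const, .const => .inr ⟨_, rfl, .const⟩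
  | .app_neu hR hN, .app hsR hsN =>
      .inr ⟨_, rfl, .app (SNe.hmsub h hk hR hsR).ne (STm.hmsub h hk hN hsN)⟩
  | .app_lam hR hN hM, .app hsR hsN =>
      .inl (STm.hsub (SOk.inst (.inl (STm.hmsub h hk hN hsN))) (fun _ h => h) hM
        (SNe.hmsub h hk hR hsR).lam)
  | .mvar_ne hu hσ, .mvar hD hs =>
      .inr ⟨_, rfl, .mvar (h.ne _ _ hu hD) (SSb.hmsub h hk hσ hs)⟩
  | .mvar_eq hσ hR, .mvar hD hs =>
      have hσ' := SSb.hmsub h hk hσ hs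
      (h.tm _ _ rfl hD).hsub hσ'.ok (fun _ => hσ'.base) hR
theorem SSb.hmsub {C : MTm} {j : ℕ} {D D' : SMCtx} (h : SMSub C j D D') {G K : SCtx}
    {σ σ₁ : Sb} {k : ℕ} (hk : G.length = k) :
    Sb.HMSub C j k σ σ₁ → SSb D G σ K → SSb D' (G.msub C j) σ₁ (K.msub C j)
  | .empty, .empty => .empty
  | .wk_ne hψ, .wk hb hD => by
      simp only [SCtx.msub, if_neg hψ]
      exact .wk (SCtx.base_msub_ne C hψ hb) (h.ne _ _ hψ hD)
  | .wk_eq, .wk hb hD => by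
      simp only [SCtx.msub, if_true]
      refine (h.ctx _ rfl hD).idSb.ren (fun i s hi => ?_) fun ψ hψ => ?_
      · rw [← hk, SCtx.get_msub_eq _ hb]; exact hi
      · rw [SCtx.base_msub_eq _ hb]; exact hψ
  | .cons hσ hM, .cons hsσ hsM => .cons (SSb.hmsub h hk hσ hsσ) (STm.hmsub h hk hM hsM)
end

theorem Ty.HMSub.sk {C : MTm} {j k : ℕ} {A A₁ : Ty} (h : Ty.HMSub C j k A A₁) : A₁.sk = A.sk := by
  induction h with
  | atom _ => rfl
  | arr _ _ ihA ihB => simp only [Ty.sk, ihA, ihB]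
  | pi _ _ ihA ihB => simp only [Ty.sk, ihA, ihB]

theorem Ctx.HMSub.sk {C : MTm} {j : ℕ} {Ψ Ψ₁ : Ctx} (h : Ctx.HMSub C j Ψ Ψ₁) :
    Ψ₁.sk = Ψ.sk.msub C j := by
  induction h with
  | nil => rfl
  | cvar_ne hψ => simp only [Ctx.sk, SCtx.msub, if_neg hψ]
  | cvar_eq => simp only [Ctx.sk, SCtx.msub, if_true, MTm.sk]
  | snoc _ hA ih => simp only [Ctx.sk, SCtx.msub, ih, hA.sk]

theorem MTy.HMSub.sk {C : MTm} {j : ℕ} {U U₁ : MTy} (h : MTy.HMSub C j U U₁) :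
    U₁.sk = U.sk.msub C j := by
  cases h with
  | ctxt hΨ _ => simp only [MTy.sk, MSk.msub, hΨ.sk]
  | schema _ => rfl

theorem STy.hmsub {C : MTm} {j : ℕ} {D D' : SMCtx} (h : SMSub C j D D') {G : SCtx} {A A₁ : Ty}
    {k : ℕ} (hk : G.length = k) (hs : Ty.HMSub C j k A A₁) (hA : STy D G A) :
    STy D' (G.msub C j) A₁ := by
  induction hs generalizing G with
  | atom hP =>
      cases hP with
      | mk hσ => cases hA with | atom hA => exact .atom (hA.hmsub h hk hσ)
  | arr _ _ ihA ihB => cases hA with | arr hA hB => exact .arr (ihA hk hA) (ihB hk hB)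
  | @pi _ A A₁ _ _ hsA _ ihA ihB =>
      cases hA with
      | pi hA hB =>
        refine .pi (ihA hk hA) ?_
        rw [hsA.sk]
        exact ihB (G := G.snoc A.sk) (congrArg Nat.succ hk) hB

theorem SCtxOk.hmsub {C : MTm} {j : ℕ} {D D' : SMCtx} (h : SMSub C j D D') {Ψ Ψ₁ : Ctx}
    (hs : Ctx.HMSub C j Ψ Ψ₁) (hΨ : SCtxOk D Ψ) : SCtxOk D' Ψ₁ := by
  induction hs with
  | nil => exact .nil
  | cvar_ne hψ => cases hΨ with | cvar hD => exact .cvar (h.ne _ _ hψ hD)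
  | cvar_eq => cases hΨ with | cvar hD => exact h.ctx _ rfl hD
  | snoc hs hA ih =>
      cases hΨ with
      | snoc hΨ hA' =>
        refine .snoc (ih h hΨ) ?_
        rw [hs.sk]
        exact hA'.hmsub h (Ctx.length_sk _) hA

theorem Schema.HMSub.mem {C : MTm} {j : ℕ} {G G₁ : Schema} (h : Schema.HMSub C j G G₁) {Φ₁ : Ctx}
    {A₁ : Ty} (hm : G₁.Mem Φ₁ A₁) :
    ∃ Φ A, G.Mem Φ A ∧ Ctx.HMSub C j Φ Φ₁ ∧ Ty.HMSub C j Φ.length A A₁ := by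
  induction h with
  | elem hΦ hA => cases hm; exact ⟨_, _, .elem, hΦ, hA⟩
  | plus _ hΦ hA ih =>
      cases hm with
      | last => exact ⟨_, _, .last, hΦ, hA⟩
      | prev hm =>
        obtain ⟨Φ, A, h, h'⟩ := ih hm
        exact ⟨Φ, A, .prev h, h'⟩

theorem SMTyOk.hmsub {C : MTm} {j : ℕ} {D D' : SMCtx} (h : SMSub C j D D') {U U₁ : MTy}
    (hs : MTy.HMSub C j U U₁) (hU : SMTyOk D U) : SMTyOk D' U₁ := by
  cases hs with
  | ctxt hΨ hP =>
      cases hU with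
      | ctxt hΨ' hP' =>
        refine .ctxt (hΨ'.hmsub h hΨ) ?_
        rw [hΨ.sk]
        exact hP'.hmsub h (Ctx.length_sk _) (.atom hP)
  | schema hG =>
      cases hU with
      | schema hG' =>
        refine .schema fun Φ₁ A₁ hm => ?_
        obtain ⟨Φ, A, hm, hΦ, hA⟩ := hG.mem hm
        refine ⟨(hG' Φ A hm).1.hmsub h hΦ, ?_⟩
        rw [hΦ.sk]
        exact (hG' Φ A hm).2.hmsub h (Ctx.length_sk _) hA

theorem SCTyOk.hmsub {C : MTm} {j : ℕ} {D D' : SMCtx} (h : SMSub C j D D') {τ τ₁ : CTy}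
    (hs : CTy.HMSub C j τ τ₁) (hτ : SCTyOk D τ) : SCTyOk D' τ₁ := by
  induction hs generalizing D D' with
  | box hΨ hP =>
      cases hτ with
      | box hΨ' hP' =>
        refine .box (hΨ'.hmsub h hΨ) ?_
        rw [hΨ.sk]
        exact hP'.hmsub h (Ctx.length_sk _) (.atom hP)
  | arr _ _ ih₁ ih₂ => cases hτ with | arr h₁ h₂ => exact .arr (ih₁ h h₁) (ih₂ h h₂)
  | pi hU _ ih =>
      cases hτ with
      | pi hU' hτ =>
        refine .pi (hU'.hmsub h hU) (ih ?_ hτ)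
        rw [hU.sk]
        exact h.cons _

theorem SchemaChk.sk {S : Sig} {Δ : MCtx} {G : Schema} {Ψ : Ctx}
    (hG : SMTyOk (MCtx.sk Δ) (.schema G)) (h : SchemaChk S Δ G Ψ) : SCtxOk (MCtx.sk Δ) Ψ := by
  induction h with
  | nil => exact .nil
  | cvar hψ => exact .cvar hψ.sk
  | snoc _ hm hσ hA ih =>
      cases hG with
      | schema hG => exact .snoc ih ((hG _ _ hm).2.hsub_env (hσ.sk ih.baseOk) hA)

/-- This keeps the simple-typing invariant when a `Π□` assumption is instantiated. -/
theorem MTmChk.smsub {S : Sig} {Δ : MCtx} {C : MTm} {U : MTy} (hU : SMTyOk (MCtx.sk Δ) U)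
    (h : MTmChk S Δ C U) : SMSub C 0 (SMCtx.cons U.sk (MCtx.sk Δ)) (MCtx.sk Δ) where
  ne u V hu hV := by
    cases u with
    | zero => exact absurd rfl hu
    | succ u =>
        simp only [SMCtx.cons, Option.map_eq_some_iff] at hV
        obtain ⟨V, hV, rfl⟩ := hV
        rw [MSk.msub_zero]
        exact hV
  tm R K hC hK := by
    cases h with
    | ctx _ => cases hC
    | tm hR =>
        cases hC
        cases hK
        rw [SCtx.msub_zero]
        exact hR.sk hU.ctxt_inv.1.baseOk
  ctx Ψ hC hK := by
    cases h with
    | tm _ => cases hC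
    | ctx hΨ => cases hC; exact hΨ.sk hU

/-! ## The identity meta-substitution -/

/-- `C` is the η-expansion of the contextual variable `j` of `D`, and `m` makes room for one more
variable after `j`. -/
structure MId (D : SMCtx) (C : MTm) (j : ℕ) (m : ℕ → ℕ) : Prop where
  eq : m j = j
  ne : ∀ u, u ≠ j → m u ≠ j
  drop : ∀ u, u ≠ j → dropIdx j (m u) = u
  tm : ∀ K, D j = some (.ctxt K) → ∃ Φ : Ctx, Φ.sk = K ∧ C = .tm (.mvar j (idSb Φ))
  ctx : D j = some .schema → C = .ctx (.cvar j)

theorem MId.cons {D : SMCtx} {C : MTm} {j : ℕ} {m : ℕ → ℕ} (h : MId D C j m) (U : MSk) :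
    MId (D.cons U) (C.mren Nat.succ) (j + 1) (liftRen m) where
  eq := by simp only [liftRen, h.eq]
  ne u hu := by
    cases u with
    | zero => simp [liftRen]
    | succ u => simpa [liftRen] using h.ne u (by omega)
  drop u hu := by
    cases u with
    | zero => simp [liftRen, dropIdx]
    | succ u =>
        have hu' : u ≠ j := by omega
        simp only [liftRen, dropIdx_succ (h.ne u hu'), h.drop u hu']
  tm K hK := by
    simp only [SMCtx.cons, Option.map_eq_some_iff] at hK
    obtain ⟨V, hV, hK⟩ := hK
    cases V with
    | schema => cases hK
    | ctxt K₀ =>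
        cases hK
        obtain ⟨Φ, rfl, rfl⟩ := h.tm K₀ hV
        exact ⟨Φ.mren Nat.succ, Φ.sk_mren _, by simp only [MTm.mren, Ne.mren, idSb_mren,
          Nat.succ_eq_add_one]⟩
  ctx hK := by
    simp only [SMCtx.cons, Option.map_eq_some_iff] at hK
    obtain ⟨V, hV, hK⟩ := hK
    cases V with
    | ctxt K => cases hK
    | schema => rw [h.ctx hV]; rfl

/-- Each entry of the identity substitution is an η-expanded variable, and `etaCancels` turns it
into the corresponding entry of `σ`. The renaming `ρ` is there because the tail of an identity
substitution is weakened. -/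
theorem SSb.hsub_idSb_aux {D : SMCtx} {G : SCtx} {Ψ : Ctx} {σ : Sb} (hσ : SSb D G σ Ψ.sk)
    {e : ℕ → Tm} {ρ : ℕ → ℕ} (he : ∀ i s, Ψ.sk.get i = some s → e (ρ i) = σ.env i) :
    Sb.HSub e ((idSb Ψ).ren ρ) σ := by
  induction Ψ generalizing σ ρ with
  | nil => cases hσ; exact .empty
  | cvar ψ => cases hσ; exact .wk
  | snoc Ψ r A ih =>
      cases hσ with
      | cons hσ hM =>
        simp only [idSb, Sb.ren, Sb.ren_ren, eta_eq, etaS_ren, Ne.ren]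
        refine .cons (ih hσ fun i s hi => he (i + 1) s hi) ?_
        refine etaCancels _ _ _ _ _ _ ?_ hM
        have := he 0 A.sk rfl
        simp only [Sb.env] at this
        rw [← this]
        exact .var

theorem SSb.hsub_idSb {D : SMCtx} {G : SCtx} {Ψ : Ctx} {σ : Sb} (hσ : SSb D G σ Ψ.sk) :
    Sb.HSub σ.env (idSb Ψ) σ := by
  have := hσ.hsub_idSb_aux (e := σ.env) (ρ := fun i => i) fun _ _ _ => rfl
  rwa [Sb.ren_id] at this

mutual
-- The only interesting occurrence is X[σ] itself: it becomes [σ](X[id]), which is X[σ] again by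
-- `SSb.hsub_idSb`.
theorem STm.hmsub_id {D : SMCtx} {C : MTm} {j : ℕ} {m : ℕ → ℕ} (h : MId D C j m) {G : SCtx}
    {M : Tm} {s : Sk} (k : ℕ) : STm D G M s → Tm.HMSub C j k (M.mren m) M
  | .neu hR => .neu (SNe.hmsub_id h k hR)
  | .lam hM => .lam (STm.hmsub_id h (k + 1) hM)
theorem SNe.hmsub_id {D : SMCtx} {C : MTm} {j : ℕ} {m : ℕ → ℕ} (h : MId D C j m) {G : SCtx}
    {R : Ne} {s : Sk} (k : ℕ) : SNe D G R s → Ne.HMSub C j k (R.mren m) (.neu R)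
  | .var _ => .var
  | .const => .const
  | .app hR hN => .app_neu (SNe.hmsub_id h k hR) (STm.hmsub_id h k hN)
  | .mvar (u := u) hu hσ => by
      have hσ' := SSb.hmsub_id h k hσ
      by_cases hj : u = j
      · subst hj
        obtain ⟨Φ, rfl, rfl⟩ := h.tm _ hu
        simp only [Ne.mren, h.eq]
        exact .mvar_eq hσ' (.mvar hσ.hsub_idSb)
      · have := Ne.HMSub.mvar_ne (h.ne u hj) hσ'
        rwa [h.drop u hj] at this
theorem SSb.hmsub_id {D : SMCtx} {C : MTm} {j : ℕ} {m : ℕ → ℕ} (h : MId D C j m) {G K : SCtx}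
    {σ : Sb} (k : ℕ) : SSb D G σ K → Sb.HMSub C j k (σ.mren m) σ
  | .empty => .empty
  | .wk (ψ := ψ) _ hD => by
      by_cases hj : ψ = j
      · subst hj
        rw [h.ctx hD]
        simp only [Sb.mren, h.eq]
        exact .wk_eq
      · have := Sb.HMSub.wk_ne (C := C) (k := k) (h.ne ψ hj)
        rwa [h.drop ψ hj] at this
  | .cons hσ hM => .cons (SSb.hmsub_id h k hσ) (STm.hmsub_id h k hM)
end

theorem STy.hmsub_id {D : SMCtx} {C : MTm} {j : ℕ} {m : ℕ → ℕ} (h : MId D C j m) {G : SCtx}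
    {A : Ty} (k : ℕ) (hA : STy D G A) : Ty.HMSub C j k (A.mren m) A := by
  induction hA generalizing k with
  | atom hσ => exact .atom (.mk (hσ.hmsub_id h k))
  | arr _ _ ihA ihB => exact .arr (ihA k) (ihB k)
  | pi _ _ ihA ihB => exact .pi (ihA k) (ihB (k + 1))

theorem STy.hmsub_id_atom {D : SMCtx} {C : MTm} {j : ℕ} {m : ℕ → ℕ} (h : MId D C j m) {G : SCtx}
    {P : Atom} (k : ℕ) (hP : STy D G (.atom P)) : Atom.HMSub C j k (P.mren m) P := by
  have := hP.hmsub_id h k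
  cases this
  assumption

theorem SCtxOk.hmsub_id {D : SMCtx} {C : MTm} {j : ℕ} {m : ℕ → ℕ} (h : MId D C j m) {Ψ : Ctx}
    (hΨ : SCtxOk D Ψ) : Ctx.HMSub C j (Ψ.mren m) Ψ := by
  induction hΨ with
  | nil => exact .nil
  | @cvar ψ hD =>
      by_cases hj : ψ = j
      · subst hj
        rw [h.ctx hD]
        simp only [Ctx.mren, h.eq]
        exact .cvar_eq
      · have := Ctx.HMSub.cvar_ne (C := C) (h.ne ψ hj)
        rwa [h.drop ψ hj] at this
  | snoc _ hA ih => exact .snoc ih (hA.hmsub_id h _)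

theorem Schema.hmsub_id {D : SMCtx} {C : MTm} {j : ℕ} {m : ℕ → ℕ} (h : MId D C j m) {G : Schema}
    (hG : ∀ Φ A, G.Mem Φ A → SCtxOk D Φ ∧ STy D Φ.sk A) : Schema.HMSub C j (G.mren m) G := by
  induction G with
  | elem Φ A =>
      obtain ⟨hΦ, hA⟩ := hG Φ A .elem
      exact .elem (hΦ.hmsub_id h) (hA.hmsub_id h _)
  | plus G Φ A ih =>
      obtain ⟨hΦ, hA⟩ := hG Φ A .last
      exact .plus (ih fun Φ A hm => hG Φ A (.prev hm)) (hΦ.hmsub_id h) (hA.hmsub_id h _)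

theorem SMTyOk.hmsub_id {D : SMCtx} {C : MTm} {j : ℕ} {m : ℕ → ℕ} (h : MId D C j m) {U : MTy}
    (hU : SMTyOk D U) : MTy.HMSub C j (U.mren m) U := by
  cases hU with
  | ctxt hΨ hP =>
      exact .ctxt (hΨ.hmsub_id h) (hP.hmsub_id_atom h _)
  | schema hG => exact .schema (Schema.hmsub_id h hG)

theorem SCTyOk.hmsub_id {D : SMCtx} {C : MTm} {j : ℕ} {m : ℕ → ℕ} (h : MId D C j m) {τ : CTy}
    (hτ : SCTyOk D τ) : CTy.HMSub C j (τ.mren m) τ := by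
  induction hτ generalizing C j m with
  | box hΨ hP =>
      exact .box (hΨ.hmsub_id h) (hP.hmsub_id_atom h _)
  | arr _ _ ih₁ ih₂ => exact .arr (ih₁ h) (ih₂ h)
  | pi hU _ ih => exact .pi (hU.hmsub_id h) (ih (h.cons _))

/-- The most recent contextual variable, as a meta-term. -/
def idMTm : MTy → MTm
  | .ctxt Ψ _ => .tm (.mvar 0 (idSb (Ψ.mren Nat.succ)))
  | .schema _ => .ctx (.cvar 0)

theorem mId_idMTm (D : SMCtx) (U : MTy) : MId (D.cons U.sk) (idMTm U) 0 (liftRen Nat.succ) where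
  eq := rfl
  ne u hu := by
    cases u with
    | zero => exact absurd rfl hu
    | succ u => simp [liftRen]
  drop u hu := by
    cases u with
    | zero => exact absurd rfl hu
    | succ u => rfl
  tm K hK := by
    cases U with
    | schema G => cases hK
    | ctxt Ψ P => cases hK; exact ⟨_, Ψ.sk_mren _, rfl⟩
  ctx hK := by
    cases U with
    | schema G => rfl
    | ctxt Ψ P => cases hK

theorem mTmChk_idMTm {S : Sig} (hS : SigWf S) {Δ : MCtx} {U : MTy} (hU : SMTyOk (MCtx.sk Δ) U) :
    MTmChk S (U :: Δ) (idMTm U) (U.mren Nat.succ) := by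
  have hU' : SMTyOk (MCtx.sk (U :: Δ)) (U.mren Nat.succ) := hU.mren (.succ _ _)
  cases U with
  | schema G => exact .ctx (.cvar .here)
  | ctxt Ψ P =>
      obtain ⟨hΨ, hP⟩ := hU'.ctxt_inv
      have hX : MCtx.Lookup (.ctxt Ψ P :: Δ) 0 (.ctxt (Ψ.mren Nat.succ) (P.mren Nat.succ)) := .here
      have := (unif_mvar_idSb hS hΨ hP hX).chk
      cases this with
      | neu h => exact .tm h

/-! ## Extensions of meta-contexts and computation contexts -/

/-- `τ` is a box type that is declared in `Δ`. -/
def Declared (Δ : MCtx) (τ : CTy) : Prop :=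
  ∃ Φ Q X, τ = .box Φ Q ∧ MCtx.Lookup Δ X (.ctxt Φ Q)

def NonBox (Γ : CCtx) : Prop := ∀ τ ∈ Γ, τ.isBox = false

theorem Declared.isBox {Δ : MCtx} {τ : CTy} (h : Declared Δ τ) : τ.isBox = true := by
  obtain ⟨Φ, Q, X, rfl, _⟩ := h
  rfl

theorem Declared.mren {m : ℕ → ℕ} {Δ Δ' : MCtx} {τ : CTy} (hm : MRen m Δ Δ')
    (h : Declared Δ τ) : Declared Δ' (τ.mren m) := by
  obtain ⟨Φ, Q, X, rfl, hX⟩ := h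
  exact ⟨_, _, _, rfl, hm _ _ hX⟩

theorem CTy.isBox_mren (m : ℕ → ℕ) (τ : CTy) : (τ.mren m).isBox = τ.isBox := by
  cases τ <;> rfl

theorem CTy.mren_liftRen (m : ℕ → ℕ) (τ : CTy) :
    (τ.mren Nat.succ).mren (liftRen m) = (τ.mren m).mren Nat.succ := by
  simp only [CTy.mren_mren, liftRen, Nat.succ_eq_add_one]

theorem CCtx.mem_shift {Γ : CCtx} {τ : CTy} :
    τ ∈ Γ.shift ↔ ∃ σ ∈ Γ, σ.mren Nat.succ = τ := by
  simp only [CCtx.shift, List.mem_map]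

theorem NonBox.shift {Γ : CCtx} (h : NonBox Γ) : NonBox Γ.shift := by
  intro τ hτ
  obtain ⟨σ, hσ, rfl⟩ := CCtx.mem_shift.1 hτ
  rw [CTy.isBox_mren]
  exact h σ hσ

theorem isBox_eq_false {τ : CTy} (h : ∀ Φ Q, τ ≠ .box Φ Q) : τ.isBox = false := by
  cases τ with
  | box Φ Q => exact absurd rfl (h Φ Q)
  | arr _ _ => rfl
  | pi _ _ => rfl

/-- `Δ'; Γ'` contains the assumptions of `Δ; Γ`, where boxed assumptions may have been moved to
the meta-context. -/
structure Ext (m : ℕ → ℕ) (Δ : MCtx) (Γ : CCtx) (Δ' : MCtx) (Γ' : CCtx) : Prop where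
  ren : MRen m Δ Δ'
  mem : ∀ τ ∈ Γ, τ.mren m ∈ Γ' ∨ Declared Δ' (τ.mren m)

theorem Ext.refl (Δ : MCtx) (Γ : CCtx) : Ext (fun i => i) Δ Γ Δ Γ where
  ren := .id Δ
  mem τ hτ := .inl (by rwa [CTy.mren_id])

theorem Ext.comp {m m' : ℕ → ℕ} {Δ Δ' Δ'' : MCtx} {Γ Γ' Γ'' : CCtx} (h : Ext m Δ Γ Δ' Γ')
    (h' : Ext m' Δ' Γ' Δ'' Γ'') : Ext (fun i => m' (m i)) Δ Γ Δ'' Γ'' where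
  ren := h.ren.comp h'.ren
  mem τ hτ := by
    rw [← CTy.mren_mren]
    rcases h.mem τ hτ with h₁ | h₁
    · exact h'.mem _ h₁
    · exact .inr (h₁.mren h'.ren)

theorem Ext.mono {m : ℕ → ℕ} {Δ Δ' : MCtx} {Γ₀ Γ Γ' : CCtx} (h : Ext m Δ Γ Δ' Γ')
    (hΓ : ∀ τ ∈ Γ₀, τ ∈ Γ) : Ext m Δ Γ₀ Δ' Γ' where
  ren := h.ren
  mem τ hτ := h.mem τ (hΓ τ hτ)

theorem Ext.tail {m : ℕ → ℕ} {Δ Δ' : MCtx} {Γ Γ' : CCtx} {τ : CTy}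
    (h : Ext m Δ (τ :: Γ) Δ' Γ') : Ext m Δ Γ Δ' Γ' :=
  h.mono fun _ => List.mem_cons_of_mem _

theorem Ext.cons (Δ : MCtx) (Γ : CCtx) (τ : CTy) : Ext (fun i => i) Δ Γ Δ (τ :: Γ) where
  ren := .id Δ
  mem σ hσ := .inl (by rw [CTy.mren_id]; exact List.mem_cons_of_mem _ hσ)

theorem Ext.shift (Δ : MCtx) (Γ : CCtx) (U : MTy) : Ext Nat.succ Δ Γ (U :: Δ) Γ.shift where
  ren := .succ Δ U
  mem τ hτ := .inl (CCtx.mem_shift.2 ⟨τ, hτ, rfl⟩)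

/-- The left phase moves every boxed assumption to the meta-context, and it may be stopped only
after that. -/
theorem UnifL.of_ext {S : Sig} {Δ : MCtx} {Γ Γ₁ : CCtx} {Ψ : Ctx} {P : Atom} (hΓ : NonBox Γ)
    (h : ∀ m Δ' Γ', Ext m Δ (Γ ++ Γ₁) Δ' Γ' → NonBox Γ' →
      UnifL S Δ' Γ' [] (Ψ.mren m) (P.mren m)) : UnifL S Δ Γ Γ₁ Ψ P := by
  -- On the length, because `boxL` replaces the pending list by its weakening and not by a sublist.
  induction hn : Γ₁.length generalizing Δ Γ Γ₁ Ψ P with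
  | zero =>
      obtain rfl := List.length_eq_zero_iff.1 hn
      have := h (fun i => i) Δ Γ (by simpa using Ext.refl Δ Γ) hΓ
      rwa [Ctx.mren_id, Atom.mren_id] at this
  | succ n ih =>
      cases Γ₁ with
      | nil => cases hn
      | cons τ Γ₁ =>
          simp only [List.length_cons, Nat.add_right_cancel_iff] at hn
          by_cases hτ : ∀ Φ Q, τ ≠ .box Φ Q
          · refine .shift hτ (ih ?_ (fun m Δ' Γ' hE hΓ' => h m Δ' Γ' (hE.mono ?_) hΓ') hn)
            · intro σ hσ
              rcases List.mem_cons.1 hσ with rfl | hσ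
              · exact isBox_eq_false hτ
              · exact hΓ σ hσ
            · intro σ
              simp only [List.mem_append, List.mem_cons]
              tauto
          · push Not at hτ
            obtain ⟨Φ, Q, rfl⟩ := hτ
            refine .boxL (ih hΓ.shift (fun m Δ' Γ' hE hΓ' => ?_) (by simpa [CCtx.shift] using hn))
            rw [Ctx.mren_mren, Atom.mren_mren]
            refine h _ Δ' Γ' ⟨MRen.comp (.succ _ _) hE.ren, fun σ hσ => ?_⟩ hΓ'
            have hσ' : σ = .box Φ Q ∨ σ ∈ Γ ++ Γ₁ := by
              simp only [List.mem_append, List.mem_cons] at hσ ⊢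
              tauto
            rw [← CTy.mren_mren]
            rcases hσ' with rfl | hσ'
            -- The box has become the newest declaration, and its image under the extension
            -- witnesses this.
            · exact .inr ⟨_, _, _, rfl, hE.ren _ _ .here⟩
            · refine hE.mem _ ?_
              rw [List.mem_append, CCtx.mem_shift, CCtx.mem_shift]
              rcases List.mem_append.1 hσ' with h | h
              · exact .inl ⟨σ, h, rfl⟩
              · exact .inr ⟨σ, h, rfl⟩

theorem UnifL.of_ext_nil {S : Sig} {Δ : MCtx} {Γ : CCtx} {Ψ : Ctx} {P : Atom}
    (h : ∀ m Δ' Γ', Ext m Δ Γ Δ' Γ' → NonBox Γ' →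
      UnifL S Δ' Γ' [] (Ψ.mren m) (P.mren m)) : UnifL S Δ [] Γ Ψ P :=
  .of_ext (fun _ h => by cases h) h

-- Admissible foci and provided assumptions.

/-- A focus on `τ` may be added to every derivation over an extension of `Δ; Γ`. -/
def Adm (S : Sig) (Δ : MCtx) (Γ : CCtx) (τ : CTy) : Prop :=
  ∀ m Δ' Γ' Ψ P, Ext m Δ Γ Δ' Γ' → NonBox Γ' → CFoc S Δ' Γ' (τ.mren m) Ψ P →
    UnifL S Δ' Γ' [] Ψ P

theorem Adm.ext {S : Sig} {m : ℕ → ℕ} {Δ Δ' : MCtx} {Γ Γ' : CCtx} {τ : CTy}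
    (h : Adm S Δ Γ τ) (hE : Ext m Δ Γ Δ' Γ') : Adm S Δ' Γ' (τ.mren m) := by
  intro m' Δ'' Γ'' Ψ P hE' hΓ'' hF
  rw [CTy.mren_mren] at hF
  exact h _ _ _ _ _ (hE.comp hE') hΓ'' hF

/-- Only boxes can leave the computation context in an extension, so the assumption is still there
to be focused on. -/
theorem Adm.of_mem {S : Sig} {Δ : MCtx} {Γ : CCtx} {τ : CTy} (hτ : τ ∈ Γ) (hb : τ.isBox = false) :
    Adm S Δ Γ τ := by
  intro m Δ' Γ' Ψ P hE _ hF
  rcases hE.mem τ hτ with h | h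
  · exact .focus h hF
  · have := h.isBox
    rw [CTy.isBox_mren, hb] at this
    cases this

/-- The assumption `τ` is provided by `Δ; Γ`. -/
structure Prov (S : Sig) (Δ : MCtx) (Γ : CCtx) (τ : CTy) : Prop where
  adm : τ.isBox = false → Adm S Δ Γ τ
  box : τ.isBox = true → τ ∈ Γ ∨ Declared Δ τ

theorem Prov.of_mem {S : Sig} {Δ : MCtx} {Γ : CCtx} {τ : CTy} (hτ : τ ∈ Γ) : Prov S Δ Γ τ where
  adm hb := .of_mem hτ hb
  box _ := .inl hτ

theorem Prov.of_declared {S : Sig} {Δ : MCtx} {Γ : CCtx} {τ : CTy} (hτ : Declared Δ τ) :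
    Prov S Δ Γ τ where
  adm hb := by rw [hτ.isBox] at hb; cases hb
  box _ := .inr hτ

theorem Prov.ext {S : Sig} {m : ℕ → ℕ} {Δ Δ' : MCtx} {Γ Γ' : CCtx} {τ : CTy}
    (h : Prov S Δ Γ τ) (hE : Ext m Δ Γ Δ' Γ') : Prov S Δ' Γ' (τ.mren m) where
  adm hb := (h.adm (by rwa [CTy.isBox_mren] at hb)).ext hE
  box hb := by
    rcases h.box (by rwa [CTy.isBox_mren] at hb) with h | h
    · exact hE.mem τ h
    · exact .inr (h.mren hE.ren)

theorem Prov.cons {S : Sig} {Δ : MCtx} {Γ : CCtx} {τ : CTy} (h : Prov S Δ Γ τ) (σ : CTy) :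
    Prov S Δ (σ :: Γ) τ := by
  have := h.ext (Ext.cons Δ Γ σ)
  rwa [CTy.mren_id] at this

theorem Prov.declared {S : Sig} {Δ : MCtx} {Γ : CCtx} {Φ : Ctx} {Q : Atom}
    (h : Prov S Δ Γ (.box Φ Q)) (hΓ : NonBox Γ) : ∃ X, MCtx.Lookup Δ X (.ctxt Φ Q) := by
  rcases h.box rfl with h | ⟨_, _, X, h, hX⟩
  · cases hΓ _ h
  · cases h; exact ⟨X, hX⟩

/-- All assumptions of `Γ` are provided by `Δ'; Γ'`. -/
def ProvCtx (S : Sig) (m : ℕ → ℕ) (Γ : CCtx) (Δ' : MCtx) (Γ' : CCtx) : Prop :=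
  ∀ σ ∈ Γ, Prov S Δ' Γ' (σ.mren m)

theorem ProvCtx.ext {S : Sig} {m m' : ℕ → ℕ} {Δ' Δ'' : MCtx} {Γ Γ' Γ'' : CCtx}
    (h : ProvCtx S m Γ Δ' Γ') (hE : Ext m' Δ' Γ' Δ'' Γ'') :
    ProvCtx S (fun i => m' (m i)) Γ Δ'' Γ'' := fun σ hσ => by
  rw [← CTy.mren_mren]
  exact (h σ hσ).ext hE

theorem ProvCtx.cons {S : Sig} {m : ℕ → ℕ} {Δ' : MCtx} {Γ Γ' : CCtx} {τ : CTy}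
    (h : ProvCtx S m Γ Δ' Γ') (hτ : Prov S Δ' Γ' (τ.mren m)) : ProvCtx S m (τ :: Γ) Δ' Γ' := by
  intro σ hσ
  rcases List.mem_cons.1 hσ with rfl | hσ
  · exact hτ
  · exact h σ hσ

theorem ProvCtx.lift {S : Sig} {m : ℕ → ℕ} {Δ' : MCtx} {Γ Γ' : CCtx} {τ : CTy}
    (h : ProvCtx S m Γ Δ' Γ') : ProvCtx S m (τ :: Γ) Δ' (τ.mren m :: Γ') :=
  ProvCtx.cons (fun σ hσ => (h σ hσ).cons _) (.of_mem List.mem_cons_self)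

theorem ProvCtx.shift {S : Sig} {m : ℕ → ℕ} {Δ' : MCtx} {Γ Γ' : CCtx}
    (h : ProvCtx S m Γ Δ' Γ') (U : MTy) : ProvCtx S (liftRen m) Γ.shift (U :: Δ') Γ'.shift := by
  intro _ hσ'
  obtain ⟨σ, hσ, rfl⟩ := CCtx.mem_shift.1 hσ'
  rw [CTy.mren_liftRen]
  exact (h σ hσ).ext (.shift _ _ _)

theorem ProvCtx.refl (S : Sig) (Δ : MCtx) (Γ : CCtx) : ProvCtx S (fun i => i) Γ Δ Γ :=
  fun σ hσ => by rw [CTy.mren_id]; exact .of_mem hσ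

-- Instantiating a contextual variable by a declared one.

/-- Extension of a renaming by a value for the most recent variable. -/
def consRen (X : ℕ) (m : ℕ → ℕ) : ℕ → ℕ
  | 0 => X
  | i + 1 => m i

theorem MRen.consRen {m : ℕ → ℕ} {Δ Δ' : MCtx} {U : MTy} {X : ℕ} (h : MRen m Δ Δ')
    (hX : MCtx.Lookup Δ' X (U.mren m)) : MRen (consRen X m) (U :: Δ) Δ' := by
  intro Y V hY
  cases hY with
  | here => rw [MTy.mren_mren]; exact hX
  | there hY => rw [MTy.mren_mren]; exact h _ _ hY

theorem ProvCtx.consRen {S : Sig} {m : ℕ → ℕ} {Δ' : MCtx} {Γ Γ' : CCtx}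
    (h : ProvCtx S m Γ Δ' Γ') (X : ℕ) : ProvCtx S (consRen X m) Γ.shift Δ' Γ' := by
  intro _ hσ'
  obtain ⟨σ, hσ, rfl⟩ := CCtx.mem_shift.1 hσ'
  rw [CTy.mren_mren]
  exact h σ hσ

/-! Assumptions may be replaced by contexts that provide them. -/

mutual
-- At the end of a right phase the target starts its own left phase, which moves all boxes of `Γ'`
-- to the meta-context. The left phase of the source then needs no rules: `boxL` is matched by
-- renaming its new variable to one already declared, `shift` only regroups assumptions, and a focus
-- is handed to `Adm`.
theorem UnifR.prov {S : Sig} (hS : SigWf S) {Δ : MCtx} {Γ : CCtx} {τ : CTy} {m : ℕ → ℕ}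
    {Δ' : MCtx} {Γ' : CCtx} (hm : MRen m Δ Δ') (hp : ProvCtx S m Γ Δ' Γ') :
    UnifR S Δ Γ τ → UnifR S Δ' Γ' (τ.mren m)
  | .arrR h => .arrR (UnifR.prov hS hm hp.lift h)
  | .piR h => .piR (UnifR.prov hS (hm.cons _) (hp.shift _) h)
  | .toLeft h => .toLeft (.of_ext_nil fun m' Δ'' Γ'' hE hΓ'' => by
      rw [Ctx.mren_mren, Atom.mren_mren]
      exact UnifL.prov (Γ := []) hS (hm.comp hE.ren) hΓ'' (fun _ h => by cases h) (hp.ext hE) h)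
theorem UnifL.prov {S : Sig} (hS : SigWf S) {Δ : MCtx} {Γ Γ₁ : CCtx} {Ψ : Ctx} {P : Atom}
    {m : ℕ → ℕ} {Δ' : MCtx} {Γ' : CCtx} (hm : MRen m Δ Δ') (hΓ' : NonBox Γ') (hΓ : NonBox Γ)
    (hp : ProvCtx S m (Γ ++ Γ₁) Δ' Γ') :
    UnifL S Δ Γ Γ₁ Ψ P → UnifL S Δ' Γ' [] (Ψ.mren m) (P.mren m)
  | .boxL (Φ := Φ) (Q := Q) h => by
      obtain ⟨X, hX⟩ := (hp (.box Φ Q) (by simp)).declared hΓ'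
      have := UnifL.prov hS (hm.consRen hX) hΓ' hΓ.shift (by
        have hp' : ProvCtx S m (Γ ++ _) Δ' Γ' := fun σ hσ => hp σ (by
          rcases List.mem_append.1 hσ with h | h
          · exact List.mem_append_left _ h
          · exact List.mem_append_right _ (List.mem_cons_of_mem _ h))
        have := hp'.consRen X
        rwa [CCtx.shift, List.map_append] at this) h
      rwa [Ctx.mren_mren, Atom.mren_mren] at this
  | .shift hτ h => UnifL.prov hS hm hΓ' (fun σ hσ => by
        rcases List.mem_cons.1 hσ with rfl | hσ
        · exact isBox_eq_false hτ
        · exact hΓ σ hσ) (fun σ hσ => hp σ (by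
        simp only [List.mem_append, List.mem_cons] at hσ ⊢
        tauto)) h
  | .level h => .level (h.mren hS hm)
  | .focus (τ := τ) hτ h => by
      have h' := CFoc.prov hS hm hΓ' hΓ (fun σ hσ => hp σ (by simpa using hσ)) h
      refine (hp τ (by simpa using hτ)).adm (by rw [CTy.isBox_mren]; exact hΓ τ hτ) (fun i => i)
        _ _ _ _ (.refl _ _) hΓ' ?_
      rwa [CTy.mren_id]
theorem CFoc.prov {S : Sig} (hS : SigWf S) {Δ : MCtx} {Γ : CCtx} {τ : CTy} {Ψ : Ctx} {P : Atom}
    {m : ℕ → ℕ} {Δ' : MCtx} {Γ' : CCtx} (hm : MRen m Δ Δ') (hΓ' : NonBox Γ') (hΓ : NonBox Γ)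
    (hp : ProvCtx S m Γ Δ' Γ') :
    CFoc S Δ Γ τ Ψ P → CFoc S Δ' Γ' (τ.mren m) (Ψ.mren m) (P.mren m)
  | .piL hC hτ h => .piL (hC.mren hS hm) (hτ.mren_zero m) (CFoc.prov hS hm hΓ' hΓ hp h)
  | .arrL h₁ h₂ => .arrL (UnifR.prov hS hm hp h₁) (CFoc.prov hS hm hΓ' hΓ hp h₂)
  | .blur (Φ := Φ) (Q := Q) h => .blur (.of_ext_nil fun m' Δ'' Γ'' hE hΓ'' => by
      rw [Ctx.mren_mren, Atom.mren_mren]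
      exact UnifL.prov (Γ := []) hS (hm.comp hE.ren) hΓ'' (fun _ h => by cases h)
        ((hp.lift (τ := .box Φ Q)).ext hE) h)
end

/-- Without boxes it makes no difference whether the assumptions are still pending or already
processed. The change of form is needed since `blur` and `toLeft` make the whole context pending. -/
theorem UnifL.unshift {S : Sig} (hS : SigWf S) {Δ : MCtx} {Γ : CCtx} {Ψ : Ctx} {P : Atom}
    (hΓ : NonBox Γ) (h : UnifL S Δ Γ [] Ψ P) : UnifL S Δ [] Γ Ψ P :=
  .of_ext_nil fun _ _ _ hE hΓ' =>
    h.prov hS hE.ren hΓ' hΓ (by simpa using (ProvCtx.refl S Δ Γ).ext hE)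

theorem UnifL.reshift {S : Sig} (hS : SigWf S) {Δ : MCtx} {Γ : CCtx} {Ψ : Ctx} {P : Atom}
    (hΓ : NonBox Γ) (h : UnifL S Δ [] Γ Ψ P) : UnifL S Δ Γ [] Ψ P := by
  have := UnifL.prov (Γ := []) hS (.id Δ) hΓ (fun _ h => by cases h) (ProvCtx.refl S Δ Γ) h
  rwa [Ctx.mren_id, Atom.mren_id] at this

/-! ## Identity expansion -/

theorem UnifL.of_declared {S : Sig} (hS : SigWf S) {Δ : MCtx} {Γ : CCtx} {Ψ : Ctx} {P : Atom}
    (hτ : SCTyOk (MCtx.sk Δ) (.box Ψ P)) (h : Declared Δ (.box Ψ P)) : UnifL S Δ Γ [] Ψ P := by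
  obtain ⟨_, _, X, h, hX⟩ := h
  cases h
  cases hτ with
  | box hΨ hP => exact .level (unif_mvar_idSb hS hΨ hP hX)

theorem UnifL.of_box {S : Sig} (hS : SigWf S) {Δ : MCtx} {Γ : CCtx} {Ψ : Ctx} {P : Atom}
    (hτ : SCTyOk (MCtx.sk Δ) (.box Ψ P)) (h : Prov S Δ Γ (.box Ψ P)) : UnifL S Δ [] Γ Ψ P :=
  .of_ext_nil fun m _ _ hE hΓ' => by
    obtain ⟨X, hX⟩ := Prov.declared (h.ext hE) hΓ'
    exact .of_declared hS (hτ.mren hE.ren.sk) ⟨_, _, X, rfl, hX⟩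

/-- Identity expansion for computations, by induction on the type before renaming. The right rules
decompose the goal; each component then extends the focus: the new assumption, itself expanded,
serves as argument of →, and the new contextual variable instantiates `Π□`. -/
theorem UnifR.of_adm {S : Sig} (hS : SigWf S) {τ : CTy} {Δ₀ Δ : MCtx} {Γ : CCtx} {m : ℕ → ℕ}
    (hτ : SCTyOk (MCtx.sk Δ₀) τ) (hm : MRen m Δ₀ Δ) (h : Adm S Δ Γ (τ.mren m)) :
    UnifR S Δ Γ (τ.mren m) := by
  induction τ generalizing Δ₀ Δ Γ m with
  | box Ψ P =>
      refine .toLeft (.of_ext_nil fun m' Δ' Γ' hE hΓ' => ?_)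
      -- Blurring makes the box a pending assumption, which then proves itself.
      exact h m' Δ' Γ' _ _ hE hΓ' (.blur (.of_box hS (hτ.mren (hm.comp hE.ren).sk |>
        fun h => by rwa [← CTy.mren_mren] at h) (.of_mem List.mem_cons_self)))
  | arr τ₁ τ₂ ih₁ ih₂ =>
      cases hτ with
      | arr hτ₁ hτ₂ =>
      refine .arrR (ih₂ hτ₂ hm fun m' Δ' Γ' Ψ P hE hΓ' hF => ?_)
      refine h m' Δ' Γ' Ψ P hE.tail hΓ' (.arrL ?_ hF)
      have hp : Prov S Δ' Γ' ((τ₁.mren m).mren m') :=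
        Prov.ext (.of_mem List.mem_cons_self) hE
      rw [CTy.mren_mren] at hp ⊢
      cases hb : τ₁.isBox with
      | false => exact ih₁ hτ₁ (hm.comp hE.ren) (hp.adm (by rw [CTy.isBox_mren, hb]))
      | true =>
          cases τ₁ with
          | box Ψ₁ P₁ => exact .toLeft (.of_box hS (hτ₁.mren (hm.comp hE.ren).sk) hp)
          | arr _ _ => cases hb
          | pi _ _ => cases hb
  | pi U τ ih =>
      cases hτ with
      | pi hU hτ =>
      refine .piR (ih (Δ₀ := U :: Δ₀) hτ (hm.cons U) fun m' Δ' Γ' Ψ P hE hΓ' hF => ?_)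
      have hE' := (Ext.shift Δ Γ (U.mren m)).comp hE
      have hU' := hU.mren hm.sk
      have hτ' : SCTyOk (SMCtx.cons (U.mren m).sk (MCtx.sk Δ)) (τ.mren (liftRen m)) :=
        hτ.mren (MRen.sk (Δ := U :: Δ₀) (Δ' := U.mren m :: Δ) (hm.cons U))
      -- The instance is the η-expansion of the fresh variable; by the identity property,
      -- substituting it gives back the body of the quantifier.
      have hC := (mTmChk_idMTm hS hU').mren hS hE.ren
      have hs := (hτ'.hmsub_id (mId_idMTm _ _)).mren_zero m'
      rw [CTy.mren_mren (liftRen Nat.succ), liftRen_comp] at hs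
      rw [MTy.mren_mren Nat.succ] at hC
      exact h _ Δ' Γ' Ψ P hE' hΓ' (.piL hC hs hF)

/-! ## Boxed assumptions -/

/-- `Π□R` declares its variable after the variable of a boxed assumption, while `UnifR.cut_box`
expects the latter to be the most recent one. -/
def swapRen : ℕ → ℕ
  | 0 => 1
  | 1 => 0
  | i + 2 => i + 2

theorem MTy.mren_swap (U : MTy) :
    ((U.mren Nat.succ).mren Nat.succ).mren swapRen = (U.mren Nat.succ).mren Nat.succ := by
  simp only [MTy.mren_mren]
  rfl

theorem CTy.mren_swap (τ : CTy) :
    ((τ.mren Nat.succ).mren Nat.succ).mren swapRen = (τ.mren Nat.succ).mren Nat.succ := by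
  simp only [CTy.mren_mren]
  rfl

theorem mRen_swap (U V : MTy) (Δ : MCtx) :
    MRen swapRen (U.mren Nat.succ :: V :: Δ) (V.mren Nat.succ :: U :: Δ) := by
  intro X W hX
  cases hX with
  | here => rw [MTy.mren_swap]; exact .there .here
  | there hX =>
      cases hX with
      | here => rw [MTy.mren_swap]; exact .here
      | there hX => rw [MTy.mren_swap]; exact .there (.there hX)

theorem provCtx_swap (S : Sig) (Δ : MCtx) (Γ : CCtx) :
    ProvCtx S swapRen Γ.shift.shift Δ Γ.shift.shift := by
  intro σ hσ
  have : σ.mren swapRen = σ := by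
    obtain ⟨σ', hσ', rfl⟩ := CCtx.mem_shift.1 hσ
    obtain ⟨σ'', _, rfl⟩ := CCtx.mem_shift.1 hσ'
    exact CTy.mren_swap _
  rw [this]
  exact .of_mem hσ

theorem CTy.mren_liftRen_swap (τ : CTy) :
    (τ.mren (liftRen Nat.succ)).mren swapRen = τ.mren Nat.succ := by
  rw [CTy.mren_mren]
  congr 1
  funext i
  cases i <;> rfl

/-- The boxed assumption `⌈Φ ⊢ Q⌉` may be used in every derivation over an extension of `Δ; Γ`. -/
def Cuttable (S : Sig) (Δ : MCtx) (Γ : CCtx) (Φ : Ctx) (Q : Atom) : Prop :=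
  ∀ m Δ' Γ' Ψ P, Ext m Δ Γ Δ' Γ' → NonBox Γ' →
    UnifL S (.ctxt (Φ.mren m) (Q.mren m) :: Δ') Γ'.shift [] (Ψ.mren Nat.succ) (P.mren Nat.succ) →
    UnifL S Δ' Γ' [] Ψ P

theorem Cuttable.ext {S : Sig} {m : ℕ → ℕ} {Δ Δ' : MCtx} {Γ Γ' : CCtx} {Φ : Ctx} {Q : Atom}
    (h : Cuttable S Δ Γ Φ Q) (hE : Ext m Δ Γ Δ' Γ') :
    Cuttable S Δ' Γ' (Φ.mren m) (Q.mren m) := by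
  intro m' Δ'' Γ'' Ψ P hE' hΓ'' hL
  rw [Ctx.mren_mren, Atom.mren_mren] at hL
  exact h _ _ _ _ _ (hE.comp hE') hΓ'' hL

/-- Blurring the focus and applying `boxL` declares the box, which is the situation of the given
derivation. -/
theorem Adm.cuttable {S : Sig} (hS : SigWf S) {Δ : MCtx} {Γ : CCtx} {Φ : Ctx} {Q : Atom}
    (h : Adm S Δ Γ (.box Φ Q)) : Cuttable S Δ Γ Φ Q := fun m Δ' Γ' Ψ P hE hΓ' hL =>
  h m Δ' Γ' Ψ P hE hΓ' (.blur (.boxL (hL.unshift hS hΓ'.shift)))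

/-- Contraction: in a context without boxes the box is already declared, and the new variable is
renamed to that declaration. -/
theorem Prov.cuttable {S : Sig} (hS : SigWf S) {Δ : MCtx} {Γ : CCtx} {Φ : Ctx} {Q : Atom}
    (h : Prov S Δ Γ (.box Φ Q)) : Cuttable S Δ Γ Φ Q := by
  intro m Δ' Γ' Ψ P hE hΓ' hL
  obtain ⟨X, hX⟩ := Prov.declared (h.ext hE) hΓ'
  have hX' : MCtx.Lookup Δ' X ((MTy.ctxt (Φ.mren m) (Q.mren m)).mren fun i => i) := by
    rwa [MTy.mren_id]
  have := hL.prov hS ((MRen.id Δ').consRen hX') hΓ' hΓ'.shift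
    (by simpa using (ProvCtx.refl S Δ' Γ').consRen X)
  rw [Ctx.mren_mren, Atom.mren_mren] at this
  simp only [consRen] at this
  rwa [Ctx.mren_id, Atom.mren_id] at this

/-- Blurring is possible only when the goal is a box, so the cut is pushed through the right rules
by induction on the goal and performed at the end. -/
theorem UnifR.cut_box {S : Sig} (hS : SigWf S) {τ : CTy} {Δ : MCtx} {Γ : CCtx} {Φ : Ctx} {Q : Atom}
    (hc : Cuttable S Δ Γ Φ Q)
    (h : UnifR S (.ctxt Φ Q :: Δ) Γ.shift (τ.mren Nat.succ)) : UnifR S Δ Γ τ := by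
  induction τ generalizing Δ Γ Φ Q with
  | box Ψ P =>
      cases h with
      | toLeft h =>
      refine .toLeft (.of_ext_nil fun m Δ' Γ' hE hΓ' => hc m Δ' Γ' _ _ hE hΓ' ?_)
      have := UnifL.prov (Γ := []) (Γ' := Γ'.shift) hS (hE.ren.cons (.ctxt Φ Q)) hΓ'.shift
        (fun _ h => by cases h) (ProvCtx.shift (m := m) (Γ := Γ) (fun σ hσ => by
          have := (Prov.of_mem (S := S) (Δ := Δ) hσ).ext hE
          exact this) _) h
      simp only [Ctx.mren_mren, Atom.mren_mren, liftRen] at this ⊢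
      exact this
  | arr τ₁ τ₂ ih₁ ih₂ =>
      cases h with
      | arrR h =>
      have hc' := hc.ext (.cons Δ Γ τ₁)
      rw [Ctx.mren_id, Atom.mren_id] at hc'
      exact .arrR (ih₂ hc' h)
  | pi U τ ih =>
      cases h with
      | piR h =>
      have h' := h.prov hS (mRen_swap U (.ctxt Φ Q) Δ) (provCtx_swap S _ Γ)
      rw [CTy.mren_liftRen_swap] at h'
      exact .piR (ih (hc.ext (.shift Δ Γ U)) h')

/-- An admissible assumption may be cut out of a derivation. -/
theorem UnifR.cut {S : Sig} (hS : SigWf S) {υ τ : CTy} {Δ : MCtx} {Γ : CCtx} (hA : Adm S Δ Γ υ)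
    (h : ∀ m Δ' Γ', Ext m Δ Γ Δ' Γ' → Prov S Δ' Γ' (υ.mren m) → UnifR S Δ' Γ' (τ.mren m)) :
    UnifR S Δ Γ τ := by
  cases hb : υ.isBox with
  | false =>
      have := h _ _ _ (.refl Δ Γ) (by
        rw [CTy.mren_id]
        exact ⟨fun _ => hA, fun h => by rw [hb] at h; cases h⟩)
      rwa [CTy.mren_id] at this
  | true =>
      cases υ with
      | box Φ Q =>
          exact .cut_box hS (hA.cuttable hS)
            (h _ _ _ (.shift Δ Γ (.ctxt Φ Q)) (.of_declared ⟨_, _, _, rfl, .here⟩))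
      | arr _ _ => cases hb
      | pi _ _ => cases hb

/-! ## Completeness of focusing for computations -/

theorem SCTyOk.pi_inv {D : SMCtx} {U : MTy} {τ : CTy} (h : SCTyOk D (.pi U τ)) :
    SMTyOk D U ∧ SCTyOk (D.cons U.sk) τ := by
  cases h with | pi hU hτ => exact ⟨hU, hτ⟩

theorem SCTyOk.arr_inv {D : SMCtx} {τ₁ τ₂ : CTy} (h : SCTyOk D (.arr τ₁ τ₂)) :
    SCTyOk D τ₁ ∧ SCTyOk D τ₂ := by
  cases h with | arr h₁ h₂ => exact ⟨h₁, h₂⟩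

theorem SCTyOk.box_inv {D : SMCtx} {Ψ : Ctx} {P : Atom} (h : SCTyOk D (.box Ψ P)) :
    SCtxOk D Ψ ∧ STy D Ψ.sk (.atom P) := by
  cases h with | box h₁ h₂ => exact ⟨h₁, h₂⟩

theorem SCTyOk.shift_ctx {D : SMCtx} {Γ : CCtx} (h : ∀ σ ∈ Γ, SCTyOk D σ) (U : MSk) :
    ∀ σ ∈ Γ.shift, SCTyOk (D.cons U) σ := by
  intro _ hσ'
  obtain ⟨σ, hσ, rfl⟩ := CCtx.mem_shift.1 hσ'
  exact (h σ hσ).mren (.succ _ _)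

/-- The statement ranges over all contexts that provide `Γ`. This is what lets the induction
hypothesis for an argument of → be used in any later extension, where the focus on that implication
is replayed. -/
theorem CSeq.unifR {S : Sig} (hS : SigWf S) {Δ : MCtx} {Γ : CCtx} {τ : CTy} (h : CSeq S Δ Γ τ)
    (hΔ : SMCtxOk Δ) (hΓ : ∀ σ ∈ Γ, SCTyOk (MCtx.sk Δ) σ) (hτ : SCTyOk (MCtx.sk Δ) τ)
    {m : ℕ → ℕ} {Δ' : MCtx} {Γ' : CCtx} (hm : MRen m Δ Δ') (hp : ProvCtx S m Γ Δ' Γ') :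
    UnifR S Δ' Γ' (τ.mren m) := by
  induction h generalizing m Δ' Γ' with
  | @init Δ Γ τ hmem =>
      cases hb : τ.isBox with
      | false => exact .of_adm hS hτ hm ((hp τ hmem).adm (by rw [CTy.isBox_mren, hb]))
      | true =>
          cases τ with
          | box Ψ P => exact .toLeft (.of_box hS (hτ.mren hm.sk) (hp _ hmem))
          | arr _ _ => cases hb
          | pi _ _ => cases hb
  | piR _ ih =>
      obtain ⟨hU, hτ⟩ := hτ.pi_inv
      exact .piR (ih (hΔ.cons hU) (SCTyOk.shift_ctx hΓ _) hτ (hm.cons _) (hp.shift _))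
  | @piL Δ Γ U C τ₁ τ₂ τ hmem hC hs _ ih =>
      obtain ⟨hU, hτ₁⟩ := (hΓ _ hmem).pi_inv
      have hτ₂ := hτ₁.hmsub (hC.smsub hU) hs
      -- A focus on the instance is the continuation of a focus on the quantified assumption, which
      -- is itself provided.
      have hA : Adm S Δ' Γ' (τ₂.mren m) := by
        intro m' Δ'' Γ'' Ψ P hE hΓ'' hF
        exact (hp _ hmem).adm rfl m' Δ'' Γ'' Ψ P hE hΓ''
          (.piL ((hC.mren hS hm).mren hS hE.ren) ((hs.mren_zero m).mren_zero m') hF)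
      refine .cut hS hA fun m' Δ'' Γ'' hE hτ₂' => ?_
      rw [CTy.mren_mren] at hτ₂' ⊢
      exact ih hΔ (List.forall_mem_cons.2 ⟨hτ₂, hΓ⟩) hτ (hm.comp hE.ren) ((hp.ext hE).cons hτ₂')
  | arrR _ ih =>
      obtain ⟨hτ₁, hτ₂⟩ := hτ.arr_inv
      exact .arrR (ih hΔ (List.forall_mem_cons.2 ⟨hτ₁, hΓ⟩) hτ₂ hm hp.lift)
  | @arrL Δ Γ τ₁ τ₂ τ hmem _ _ ih₁ ih₂ =>
      obtain ⟨hτ₁, hτ₂⟩ := (hΓ _ hmem).arr_inv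
      have hA : Adm S Δ' Γ' (τ₂.mren m) := by
        intro m' Δ'' Γ'' Ψ P hE hΓ'' hF
        -- A focus on the conclusion of the implication is the continuation of a focus on the
        -- implication, once its argument is proved in the extended context.
        refine (hp _ hmem).adm rfl m' Δ'' Γ'' Ψ P hE hΓ'' (.arrL ?_ hF)
        rw [CTy.mren_mren]
        exact ih₁ hΔ hΓ hτ₁ (hm.comp hE.ren) (hp.ext hE)
      refine .cut hS hA fun m' Δ'' Γ'' hE hτ₂' => ?_
      rw [CTy.mren_mren] at hτ₂' ⊢
      exact ih₂ hΔ (List.forall_mem_cons.2 ⟨hτ₂, hΓ⟩) hτ (hm.comp hE.ren) ((hp.ext hE).cons hτ₂')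
  | boxR hR =>
      obtain ⟨hΨ, hP⟩ := hτ.box_inv
      have hU := hR.unif hS hΔ hΨ hP
      exact .toLeft (.of_ext_nil fun m' _ _ hE _ => .level ((hU.mren hS hm).mren hS hE.ren))
  | @boxL Δ Γ Ψ P τ hmem _ ih =>
      obtain ⟨hΨ, hP⟩ := (hΓ _ hmem).box_inv
      have h := ih (hΔ.cons (.ctxt hΨ hP)) (SCTyOk.shift_ctx hΓ _) (hτ.mren (.succ _ _))
        (hm.cons _) (hp.shift _)
      rw [CTy.mren_liftRen] at h
      exact .cut_box hS (Prov.cuttable hS (hp _ hmem)) h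

/-! ## The extended meta-context -/

theorem mRen_up (Δ : MCtx) (Γ : CCtx) : MRen Γ.up Δ (plus Δ Γ) := by
  induction Γ with
  | nil => exact .id Δ
  | cons τ Γ ih =>
      cases τ with
      | box Ψ P => exact ih.comp (.succ _ _)
      | arr _ _ => exact ih
      | pi _ _ => exact ih

theorem declared_plus (Δ : MCtx) {Γ : CCtx} {Ψ : Ctx} {P : Atom} (h : CTy.box Ψ P ∈ Γ) :
    Declared (plus Δ Γ) ((CTy.box Ψ P).mren Γ.up) := by
  induction Γ with
  | nil => cases h
  | cons τ Γ ih =>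
      cases τ with
      | box Φ Q =>
          -- A box at the head of the list adds one declaration, hence one successor to the
          -- weakening.
          have hup : (fun i => Nat.succ (CCtx.up Γ i)) = CCtx.up (.box Φ Q :: Γ) := rfl
          rw [← hup, ← CTy.mren_mren]
          rcases List.mem_cons.1 h with h | h
          · cases h
            exact ⟨_, _, _, rfl, .here⟩
          · exact (ih h).mren (.succ _ _)
      | arr _ _ => exact ih (by simpa using h)
      | pi _ _ => exact ih (by simpa using h)

theorem nonBox_minus (Γ : CCtx) : NonBox (minus Γ) := by
  intro τ hτ
  simp only [minus, List.mem_map, List.mem_filter] at hτ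
  obtain ⟨σ, ⟨_, hσ⟩, rfl⟩ := hτ
  rw [CTy.isBox_mren]
  simpa using hσ

/-- The split loses nothing: boxes are declared in Δ⁺ and all other assumptions remain in Γ⁻. This
is the instance at which `CSeq.unifR` is used. -/
theorem provCtx_plus_minus (S : Sig) (Δ : MCtx) (Γ : CCtx) :
    ProvCtx S Γ.up Γ (plus Δ Γ) (minus Γ) := by
  intro σ hσ
  cases hb : σ.isBox with
  | false =>
      refine .of_mem ?_
      simp only [minus, List.mem_map, List.mem_filter]
      exact ⟨σ, ⟨hσ, by simp [hb]⟩, rfl⟩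
  | true =>
      cases σ with
      | box Ψ P => exact .of_declared (declared_plus Δ hσ)
      | arr _ _ => cases hb
      | pi _ _ => cases hb

theorem CSeq.unifR_plus {S : Sig} (hS : SigWf S) {Δ : MCtx} (hΔ : MCtxWf S Δ) {Γ : CCtx} {τ : CTy}
    (hΓ : CCtxWf S Δ Γ) (hτ : CTyWf S Δ τ) (h : CSeq S Δ Γ τ) :
    UnifR S (plus Δ Γ) (minus Γ) (τ.mren Γ.up) :=
  h.unifR hS hΔ.sk (fun σ hσ => (hΓ σ hσ).sk) hτ.sk (mRen_up Δ Γ) (provCtx_plus_minus S Δ Γ)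

theorem CSeq.unifL_plus {S : Sig} (hS : SigWf S) {Δ : MCtx} (hΔ : MCtxWf S Δ) {Γ : CCtx} {Ψ : Ctx}
    {P : Atom} (hΓ : CCtxWf S Δ Γ) (hτ : CTyWf S Δ (.box Ψ P)) (h : CSeq S Δ Γ (.box Ψ P)) :
    UnifL S (plus Δ Γ) (minus Γ) [] (Ψ.mren Γ.up) (P.mren Γ.up) := by
  cases h.unifR_plus hS hΔ hΓ hτ with
  | toLeft h => exact h.reshift hS (nonBox_minus Γ)

end Beluga

theorem mainTheorem1 (S : Sig) (hS : SigWf S) (Δ : MCtx) (hΔ : MCtxWf S Δ) :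
    -- a)
    (∀ (Ψ : Ctx) (M : Tm) (A : Ty), CtxWf S Δ Ψ → TyWf S Δ Ψ A →
      LFSeq S Δ Ψ M A → Unif S Δ Ψ M A) ∧
    -- b)
    (∀ (Ψ Φ : Ctx) (σ : Sb), CtxWf S Δ Ψ → CtxWf S Δ Φ →
      LFSeqSb S Δ Ψ σ Φ → UnifSb S Δ Ψ σ Φ) ∧
    -- c)
    (∀ (Ψ : Ctx) (M : Tm) (P : Atom), CtxWf S Δ Ψ → TyWf S Δ Ψ (.atom P) →
      LFSeq S Δ Ψ M (.atom P) →
        (∃ (h : Ne) (A : Ty), Assump S Ψ h A ∧ Foc S Δ Ψ h A M P) ∨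
        (∃ (X : ℕ) (Φ : Ctx) (Q : Atom), MCtx.Lookup Δ X (.ctxt Φ Q) ∧
          FocMeta S Δ Ψ X Φ Q M P)) ∧
    -- d)
    (∀ (Γ : CCtx) (τ : CTy), CCtxWf S Δ Γ → CTyWf S Δ τ →
      CSeq S Δ Γ τ → UnifR S (plus Δ Γ) (minus Γ) (τ.mren Γ.up)) ∧
    -- e)
    (∀ (Γ : CCtx) (Ψ : Ctx) (P : Atom), CCtxWf S Δ Γ → CTyWf S Δ (.box Ψ P) →
      CSeq S Δ Γ (.box Ψ P) →
        UnifL S (plus Δ Γ) (minus Γ) [] (Ψ.mren Γ.up) (P.mren Γ.up)) ∧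
    -- f)
    (∀ (Γ : CCtx) (Ψ : Ctx) (P : Atom), CCtxWf S Δ Γ → CTyWf S Δ (.box Ψ P) →
      CSeq S Δ Γ (.box Ψ P) →
        (∃ M : Tm, Unif S (plus Δ Γ) (Ψ.mren Γ.up) M (.atom (P.mren Γ.up))) ∨
        (∃ τ ∈ minus Γ, CFoc S (plus Δ Γ) (minus Γ) τ (Ψ.mren Γ.up) (P.mren Γ.up))) := by
  refine ⟨fun Ψ M A hΨ hA h => h.unif hS hΔ.sk hΨ.sk (hA.sk hΨ.sk.baseOk),
    fun Ψ Φ σ hΨ hΦ h => h.unif hS hΔ.sk hΨ.sk hΦ.sk,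
    fun Ψ M P hΨ hP h => (h.unif hS hΔ.sk hΨ.sk (hP.sk hΨ.sk.baseOk)).atom_cases,
    fun Γ τ hΓ hτ h => h.unifR_plus hS hΔ hΓ hτ,
    fun Γ Ψ P hΓ hτ h => h.unifL_plus hS hΔ hΓ hτ, fun Γ Ψ P hΓ hτ h => ?_⟩
  -- With nothing pending, a left derivation can only end in a change of level or in a focus; these
  -- are the two alternatives of f).
  cases h.unifL_plus hS hΔ hΓ hτ with
  | level hM => exact .inl ⟨_, hM⟩
  | focus hmem hF => exact .inr ⟨_, hmem, hF⟩
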